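/- **Setting.** Let $N,d\ge 1$ be integers, and for $k\in[d]=\{1,\dots,d\}$ let $q_k\ge1$ be an integer and $f_k:[N]^{q_k}\to\mathbb R$ a symmetric function vanishing on diagonals (that is, $f_k(i_1,\dots,i_{q_k})=0$ unless $i_1,\dots,i_{q_k}$ are mutually different). Put $\bar q=\max_{1\le k\le d}q_k$, and assume that $d\ge2$, or that $d=1$ and $\bar q=1$ (in which case $(\log d)^0:=1$). For a sequence $x=(x_i)_{i=1}^N$ write $$Q(f_k;x)=\sum_{i_1,\dots,i_{q_k}=1}^N f_k(i_1,\dots,i_{q_k})x_{i_1}\cdots x_{i_{q_k}},\qquad \boldsymbol Q(x)=(Q(f_1;x),\dots,Q(f_d;x)),$$ $$\mathrm{Inf}_i(f_k)=\sum_{i_2,\dots,i_{q_k}=1}^N f_k(i,i_2,\dots,i_{q_k})^2 .$$ For $\beta>0$ let $\Phi_\beta(x)=\beta^{-1}\log\sum_{j=1}^d e^{\beta x_j}$, $x\in\mathbb R^d$. For $\alpha>0$ and a random variable $\xi$ let $\|\xi\|_{\psi_\alpha}=\inf\{c>0:\ \mathbb E[\exp((|\xi|/c)^\alpha)-1]\le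 1\}$ (with $\inf\emptyset=\infty$). For $x\ge0$ let $\chi_\varpi(x)=\exp(-x^{1/\varpi})$ if $\varpi>0$, and $\chi_0(x)=1_{[0,1)}(x)$. For an integer $m\ge 1$ let $C^m_b(\mathbb R)$ be the set of $C^m$ functions $h:\mathbb R\to\mathbb R$ whose derivatives $h^{(1)},\dots,h^{(m)}$ are bounded. **Proposition.** Let $X=(X_i)_{i=1}^N$ and $Y=(Y_i)_{i=1}^N$ be two sequences (possibly defined on different probability spaces), each consisting of independent centered random variables with unit variance. Suppose that $$M_N:=\max_{1\le i\le N}\left(\|X_i\|_{\psi_\alpha}\vee\|Y_i\|_{\psi_\alpha}\right)<\infty$$ for some $\alpha\in(0,2]$, and that there is an integer $m\ge3$ such that $\mathbb E[X_i^r]=\mathbb E[Y_i^r]$ for all $i\in[N]$ and $r\in\{1,\dots,m-1\}$. Set $$\Lambda_i:=(\log d)^{(\bar q-1)/\alpha}\max_{1\le k\le d}M_N^{q_k-1}\sqrt{\mathrm{Inf}_i(f_k)},\qquad i\in[N].$$ Then, for any $h\in C^m_b(\mathbb R)$, $\beta>0$ and $\tau,\rho\ge0$ with $\tau\rho M_N\max_{1\le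 i\le N}\Lambda_i\le\beta^{-1}$, the random variables $h(\Phi_\beta(\boldsymbol Q(X)-y))$ and $h(\Phi_\beta(\boldsymbol Q(Y)-y))$ are integrable for every $y\in\mathbb R^d$, and $$\sup_{y\in\mathbb R^d}\left|\mathbb E\left[h(\Phi_\beta(\boldsymbol Q(X)-y))\right]-\mathbb E\left[h(\Phi_\beta(\boldsymbol Q(Y)-y))\right]\right|$$ $$\le C\left(\max_{1\le j\le m}\beta^{m-j}\|h^{(j)}\|_\infty\right)\Bigg\{(\log d)^{m(\bar q-1)/\alpha}\max_{1\le k\le d}\left(M_N^{mq_k}\sum_{i=1}^N\mathrm{Inf}_i(f_k)^{m/2}\right)$$ $$+\left(e^{-(\tau/K_1)^\alpha}+\chi_{(\bar q-1)/\alpha}\left(\frac{\rho}{K_2}\right)(\rho\vee1)^m+\exp\left(-\left(\frac{\tau\rho}{K_3}\right)^{\alpha/\bar q}\right)(\tau\rho\vee1)^m\right)M_N^m\sum_{i=1}^N\Lambda_i^m\Bigg\},$$ where $C>0$ depends only on $m,\alpha,\bar q$, the constant $K_1>0$ depends only on $\alpha$, and $K_2,K_3>0$ depend only on $\alpha,\bar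 q$. -/

import Mathlib

open MeasureTheory ProbabilityTheory
open scoped ENNReal

noncomputable section

namespace HomSum

/-- `f : [N]^q → ℝ` is invariant under permutations of its arguments. -/
def IsSymm {N q : ℕ} (f : (Fin q → Fin N) → ℝ) : Prop :=
  ∀ (σ : Equiv.Perm (Fin q)) (j : Fin q → Fin N), f (j ∘ σ) = f j

/-- `f(i₁, …, i_q) = 0` unless `i₁, …, i_q` are mutually different. -/
def VanishesOnDiagonals {N q : ℕ} (f : (Fin q → Fin N) → ℝ) : Prop :=
  ∀ j : Fin q → Fin N, ¬ Function.Injective j → f j = 0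

/-- The homogeneous sum `Q(f; x) = ∑ f(i₁, …, i_q) x_{i₁} ⋯ x_{i_q}`. -/
def homSum {N q : ℕ} (f : (Fin q → Fin N) → ℝ) (x : Fin N → ℝ) : ℝ :=
  ∑ j : Fin q → Fin N, f j * ∏ l : Fin q, x (j l)

open Classical in
/-- The influence of the `i`-th variable, `∑_{i₂, …, i_q} f(i, i₂, …, i_q)²`: the sum of `f²` over
all index tuples whose first entry is `i`. -/
def influence {N q : ℕ} (f : (Fin q → Fin N) → ℝ) (i : Fin N) : ℝ :=
  ∑ j : Fin q → Fin N with (∀ l : Fin q, l.val = 0 → j l = i), f j ^ 2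

/-- The smooth maximum `Φ_β(x) = β⁻¹ log ∑ⱼ exp(β xⱼ)`. -/
def smoothMax {d : ℕ} (β : ℝ) (x : Fin d → ℝ) : ℝ :=
  β⁻¹ * Real.log (∑ j : Fin d, Real.exp (β * x j))

/-- The `ψ_α`-norm `inf {C > 0 : E[exp((|X|/C)^α) - 1] ≤ 1}`, with value `∞` if there is no
such `C`. -/
def psiNorm {Ω : Type*} [MeasurableSpace Ω] (α : ℝ) (X : Ω → ℝ) (P : Measure Ω) : ℝ≥0∞ :=
  sInf {c : ℝ≥0∞ | ∃ C : ℝ, 0 < C ∧ c = ENNReal.ofReal C ∧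
    ∫⁻ ω, ENNReal.ofReal (Real.exp ((|X ω| / C) ^ α) - 1) ∂P ≤ 1}

/-- A sequence of independent centered random variables with unit variance. -/
structure IsIndepStd {Ω : Type*} [MeasurableSpace Ω] {N : ℕ} (X : Fin N → Ω → ℝ)
    (P : Measure Ω) : Prop where
  measurable : ∀ i, Measurable (X i)
  indep : iIndepFun X P
  centered : ∀ i, Integrable (X i) P ∧ ∫ ω, X i ω ∂P = 0
  unit_variance : ∀ i, MemLp (X i) 2 P ∧ variance (X i) P = 1

/-- `C^m` functions on `ℝ` whose derivatives of order `1, …, m` are bounded. -/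
def IsCmb (m : ℕ) (h : ℝ → ℝ) : Prop :=
  ContDiff ℝ m h ∧ ∀ j ∈ Finset.Icc 1 m, ∃ B : ℝ, ∀ x : ℝ, |iteratedDeriv j h x| ≤ B

/-- `max_{1 ≤ j ≤ m} β^{m-j} ‖h^{(j)}‖_∞`. -/
def derivBound (m : ℕ) (β : ℝ) (h : ℝ → ℝ) : ℝ :=
  ⨆ j : Finset.Icc 1 m, β ^ (m - (j : ℕ)) * ⨆ x : ℝ, |iteratedDeriv (j : ℕ) h x|

/-- `χ_ϖ(x) = exp(-x^{1/ϖ})` for `ϖ > 0`, and the indicator function of `[0, 1)` for `ϖ = 0`. -/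
def chi (w x : ℝ) : ℝ :=
  if 0 < w then Real.exp (-x ^ (1 / w)) else Set.indicator (Set.Ico 0 1) 1 x

/-- `Λ_i = (log d)^{(q̄-1)/α} max_k M^{q_k-1} √(Inf_i(f_k))`, where `q̄ = max_k q_k`. -/
def Lam {N d : ℕ} (α : ℝ) (qbar : ℕ) (M : ℝ) {q : Fin d → ℕ}
    (f : (k : Fin d) → (Fin (q k) → Fin N) → ℝ) (i : Fin N) : ℝ :=
  Real.log d ^ (((qbar : ℝ) - 1) / α) * ⨆ k : Fin d, M ^ (q k - 1) * √(influence (f k) i)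

end HomSum

end

noncomputable section

namespace HomSum

/-! The proof is a Lindeberg replacement in which all coordinates are handled under one common law.
Since each `f k` vanishes on diagonals, the vector of homogeneous sums is affine in every
coordinate: it equals a part free of `x i` plus `x i` times a vector V_i of partial derivatives.
Expanding `h ∘ smoothMax β` along V_i to order m, matching moments cancel the Taylor polynomial and
leave a remainder. Every derivative of a log-sum-exp is a polynomial in softmax moments, with
coefficients that do not depend on the dimension. Products of such moments are dominated by a single
absolute moment, so the remainder is at most a constant times |t|^m times the softmax average of
|V_ik|^m over k (`exists_taylor_smoothMax`).

Replacing coordinates one after the other would use different weights at each step and yield a sum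
over i of maxima over k. The randomized interpolation `abs_sub_le_of_forall_sum_abs_le` averages
over subsets B and reduces the problem to one fixed product law, under which the errors of all
coordinates are added. Once the weights are all taken at the full vector of sums, they no longer
depend on i, and the average over k is at most the maximum over k of the sum over i
(`sum_ofReal_softAbs_le`). This produces the leading term with the maximum outside the sum.

Passing from the vector without coordinate i to the full vector changes the exponents by β x_i V_i.
This costs a factor exp 2 if |x_i| ≤ τM and ‖V_i‖ ≤ ρΛ_i, because then the change is at most 1. The
two exceptional events, and the event that the Taylor increment |t|‖V_i‖ exceeds 1/β, give the three
tail terms (`exists_lintegral_stepErr_le`).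

All expectations are controlled through moment growth, ‖Z‖_p ≤ A p^s for every integer p ≥ 1. A
finite ψ_α-norm gives s = 1/α. Hypercontractivity for multilinear polynomials
(`lintegral_multilin_pow_le`), which needs s ≥ 1/2 and hence α ≤ 2, gives exponent (q-1)/α for the
partial derivatives. A maximum over d functions costs (log d)^s (`MomGrowth.sup`), and Markov's
inequality at an optimal power gives the tails (`exists_lintegral_tail_le`). -/

/-! ### Derivatives of smooth maxima along lines -/

/-- The softmax weights `exp(uⱼ) / ∑ₖ exp(uₖ)`. -/
def softWeight {d : ℕ} (u : Fin d → ℝ) (j : Fin d) : ℝ :=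
  Real.exp (u j) / ∑ k, Real.exp (u k)

/-- The moments of `w` under the softmax weights at `u + t w`. -/
def softMoment {d : ℕ} (u w : Fin d → ℝ) (r : ℕ) (t : ℝ) : ℝ :=
  ∑ j, softWeight (fun k ↦ u k + t * w k) j * w j ^ r

/-- The logarithm of the sum of exponentials along a line. -/
def logSumLine {d : ℕ} (u w : Fin d → ℝ) (t : ℝ) : ℝ :=
  Real.log (∑ j, Real.exp (u j + t * w j))

lemma sum_exp_pos {d : ℕ} [NeZero d] (u : Fin d → ℝ) : 0 < ∑ k, Real.exp (u k) :=
  Finset.sum_pos (fun _ _ ↦ Real.exp_pos _) ⟨0, Finset.mem_univ _⟩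

lemma softWeight_nonneg {d : ℕ} (u : Fin d → ℝ) (j : Fin d) : 0 ≤ softWeight u j :=
  div_nonneg (Real.exp_pos _).le (Finset.sum_nonneg fun _ _ ↦ (Real.exp_pos _).le)

lemma sum_softWeight {d : ℕ} [NeZero d] (u : Fin d → ℝ) : ∑ j, softWeight u j = 1 := by
  unfold softWeight
  rw [← Finset.sum_div, div_self (sum_exp_pos u).ne']

lemma hasDerivAt_sum_exp_line {d : ℕ} (u w : Fin d → ℝ) (r : ℕ) (t : ℝ) :
    HasDerivAt (fun t ↦ ∑ j, Real.exp (u j + t * w j) * w j ^ r)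
      (∑ j, Real.exp (u j + t * w j) * w j ^ (r + 1)) t := by
  apply HasDerivAt.fun_sum
  intro j _
  have h := ((((hasDerivAt_id t).mul_const (w j)).const_add (u j)).exp).mul_const (w j ^ r)
  refine h.congr_deriv ?_
  simp only [id]; ring

lemma hasDerivAt_logSumLine {d : ℕ} [NeZero d] (u w : Fin d → ℝ) (t : ℝ) :
    HasDerivAt (logSumLine u w) (softMoment u w 1 t) t := by
  have h := (hasDerivAt_sum_exp_line u w 0 t)
  simp only [pow_zero, mul_one] at h
  have h2 := h.log (sum_exp_pos _).ne'
  refine h2.congr_deriv ?_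
  simp only [softMoment, softWeight, Finset.sum_div, zero_add]
  exact Finset.sum_congr rfl fun j _ ↦ by ring

lemma softMoment_eq_div {d : ℕ} (u w : Fin d → ℝ) (r : ℕ) (t : ℝ) :
    softMoment u w r t =
      (∑ j, Real.exp (u j + t * w j) * w j ^ r) / ∑ j, Real.exp (u j + t * w j) := by
  simp only [softMoment, softWeight, Finset.sum_div]
  exact Finset.sum_congr rfl fun j _ ↦ by ring

lemma hasDerivAt_softMoment {d : ℕ} [NeZero d] (u w : Fin d → ℝ) (r : ℕ) (t : ℝ) :
    HasDerivAt (softMoment u w r)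
      (softMoment u w (r + 1) t - softMoment u w r t * softMoment u w 1 t) t := by
  have h0 := (hasDerivAt_sum_exp_line u w 0 t)
  simp only [pow_zero, mul_one] at h0
  have h := (hasDerivAt_sum_exp_line u w r t).div h0 (sum_exp_pos _).ne'
  have e : softMoment u w r = (fun t ↦ ∑ j, Real.exp (u j + t * w j) * w j ^ r) /
      fun t ↦ ∑ j, Real.exp (u j + t * w j) := by
    ext t; exact softMoment_eq_div u w r t
  rw [e]
  refine h.congr_deriv ?_
  have hp := (sum_exp_pos fun j ↦ u j + t * w j).ne'
  simp only [softMoment_eq_div, zero_add, ← e]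
  field_simp

/-- By μ_r' = μ_{r+1} - μ_r μ_1, differentiating one factor raises the total degree by one. The list
`E` is chosen before d, u and w, and this is what makes the final constants dimension-free. -/
lemma exists_hasDerivAt_prod_softMoment (L : List ℕ) :
    ∃ E : List (ℝ × List ℕ), (∀ e ∈ E, e.2.sum = L.sum + 1) ∧
      ∀ (d : ℕ) [NeZero d] (u w : Fin d → ℝ) (t : ℝ),
        HasDerivAt (fun t ↦ (L.map fun r ↦ softMoment u w r t).prod)
          (E.map fun e ↦ e.1 * (e.2.map fun r ↦ softMoment u w r t).prod).sum t := by
  induction L with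
  | nil => exact ⟨[], by simp, fun d _ u w t ↦ by simpa using hasDerivAt_const t (1 : ℝ)⟩
  | cons r L ih =>
    obtain ⟨E, hE, hd⟩ := ih
    refine ⟨(1, (r + 1) :: L) :: (-1, r :: 1 :: L) :: E.map (fun e ↦ (e.1, r :: e.2)), ?_, ?_⟩
    · intro e he
      simp only [List.mem_cons, List.mem_map] at he
      rcases he with rfl | rfl | ⟨e, he, rfl⟩
      · simp; ring
      · simp; ring
      · simp [hE e he]; ring
    · intro d _ u w t
      have h := (hasDerivAt_softMoment u w r t).mul (hd d u w t)
      simp only [List.map_cons, List.prod_cons, List.sum_cons, List.map_map]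
      refine h.congr_deriv ?_
      have : (E.map ((fun e : ℝ × List ℕ ↦ e.1 * (e.2.map fun r ↦ softMoment u w r t).prod) ∘
          fun e ↦ (e.1, r :: e.2))).sum = softMoment u w r t *
          (E.map fun e ↦ e.1 * (e.2.map fun r ↦ softMoment u w r t).prod).sum := by
        rw [← List.sum_map_mul_left]
        congr 1
        apply List.map_congr_left
        intro e _
        simp only [Function.comp, List.map_cons, List.prod_cons]
        ring
      rw [this]
      ring

/-- A term `c · H⁽ʲ⁾(φ(t)) ∏_{r ∈ L} μ_r(t)` in the derivatives of `H ∘ φ`, where `φ` is the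
logarithm of a sum of exponentials. -/
def faaTerm {d : ℕ} (H : ℝ → ℝ) (u w : Fin d → ℝ) (t : ℝ) (e : ℝ × ℕ × List ℕ) : ℝ :=
  e.1 * iteratedDeriv e.2.1 H (logSumLine u w t) * (e.2.2.map fun r ↦ softMoment u w r t).prod

/-- Chain and product rule on one term. The middle clause records that the undifferentiated H
disappears after the first differentiation. Only derivatives of order at least 1 are bounded, so H
itself must not occur later. -/
lemma exists_hasDerivAt_faaTerm (e : ℝ × ℕ × List ℕ) :
    ∃ E : List (ℝ × ℕ × List ℕ),
      (∀ e' ∈ E, (e'.2.1 = e.2.1 ∨ e'.2.1 = e.2.1 + 1) ∧ e'.2.2.sum = e.2.2.sum + 1) ∧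
      ((e.2.1 = 0 → e.2.2 = [] → ∀ e' ∈ E, e'.2.1 = 1)) ∧
      ∀ (d : ℕ) [NeZero d] (u w : Fin d → ℝ) (H : ℝ → ℝ),
        Differentiable ℝ (iteratedDeriv e.2.1 H) → ∀ t : ℝ,
        HasDerivAt (fun t ↦ faaTerm H u w t e) (E.map (faaTerm H u w t)).sum t := by
  obtain ⟨c, j, L⟩ := e
  obtain ⟨E, hE, hd⟩ := exists_hasDerivAt_prod_softMoment L
  by_cases hL : L = []
  · subst hL
    refine ⟨[(c, j + 1, [1])], by simp, by simp +contextual, ?_⟩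
    intro d _ u w H hH t
    have h := (((hH (logSumLine u w t)).hasDerivAt.comp t (hasDerivAt_logSumLine u w t))).const_mul c
    simp only [faaTerm, List.map_nil, List.prod_nil, mul_one, List.map_cons, List.prod_cons,
      List.sum_cons, List.sum_nil, add_zero, iteratedDeriv_succ, mul_assoc]
    exact h
  refine ⟨(c, j + 1, 1 :: L) :: E.map (fun e ↦ (c * e.1, j, e.2)), ?_, fun _ h ↦ absurd h hL, ?_⟩
  · intro e he
    simp only [List.mem_cons, List.mem_map] at he
    rcases he with rfl | ⟨e, he, rfl⟩
    · simp; ring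
    · simp [hE e he]
  · intro d _ u w H hH t
    have h := ((((hH (logSumLine u w t)).hasDerivAt.comp t
      (hasDerivAt_logSumLine u w t))).const_mul c).mul (hd d u w t)
    simp only [faaTerm, List.map_cons, List.prod_cons, List.sum_cons, List.map_map]
    refine h.congr_deriv ?_
    have : (E.map ((faaTerm H u w t) ∘ fun e ↦ (c * e.1, j, e.2))).sum =
        c * iteratedDeriv j H (logSumLine u w t) *
          (E.map fun e ↦ e.1 * (e.2.map fun r ↦ softMoment u w r t).prod).sum := by
      rw [← List.sum_map_mul_left]
      congr 1
      apply List.map_congr_left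
      intro e _
      simp only [Function.comp, faaTerm]
      ring
    rw [this]
    simp only [iteratedDeriv_succ, Function.comp]
    ring

lemma exists_hasDerivAt_sum_faaTerm (n : ℕ) (D : List (ℝ × ℕ × List ℕ))
    (hD : ∀ e ∈ D, e.2.1 ≤ n ∧ (1 ≤ n → 1 ≤ e.2.1) ∧ e.2.2.sum = n ∧ (n = 0 → e.2.2 = [])) :
    ∃ E : List (ℝ × ℕ × List ℕ),
      (∀ e ∈ E, e.2.1 ≤ n + 1 ∧ 1 ≤ e.2.1 ∧ e.2.2.sum = n + 1) ∧
      ∀ (d : ℕ) [NeZero d] (u w : Fin d → ℝ) (H : ℝ → ℝ), ContDiff ℝ (n + 1 : ℕ) H → ∀ t : ℝ,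
        HasDerivAt (fun t ↦ (D.map (faaTerm H u w t)).sum) (E.map (faaTerm H u w t)).sum t := by
  induction D with
  | nil => exact ⟨[], by simp, fun d _ u w H _ t ↦ by simpa using hasDerivAt_const t (0 : ℝ)⟩
  | cons e D ih =>
    obtain ⟨E, hE, hd⟩ := ih fun e he ↦ hD e (List.mem_cons_of_mem _ he)
    obtain ⟨F, hF, hF0, hdF⟩ := exists_hasDerivAt_faaTerm e
    obtain ⟨h1, h2, h3, h4⟩ := hD e List.mem_cons_self
    refine ⟨F ++ E, ?_, ?_⟩
    · intro e' he'
      rcases List.mem_append.1 he' with he' | he'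
      · obtain ⟨a, b⟩ := hF e' he'
        refine ⟨by omega, ?_, by omega⟩
        rcases Nat.eq_zero_or_pos n with hn | hn
        · have := hF0 (by omega) (h4 hn) e' he'
          omega
        · have := h2 hn
          omega
      · exact hE e' he'
    · intro d _ u w H hH t
      simp only [List.map_cons, List.sum_cons, List.map_append, List.sum_append]
      refine (hdF d u w H ?_ t).add (hd d u w H hH t)
      exact hH.differentiable_iteratedDeriv _ (by exact_mod_cast Nat.lt_succ_of_le h1)

lemma exists_iteratedDeriv_comp_logSumLine (n : ℕ) :
    ∃ D : List (ℝ × ℕ × List ℕ),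
      (∀ e ∈ D, e.2.1 ≤ n ∧ (1 ≤ n → 1 ≤ e.2.1) ∧ e.2.2.sum = n ∧ (n = 0 → e.2.2 = [])) ∧
      ∀ (d : ℕ) [NeZero d] (u w : Fin d → ℝ) (H : ℝ → ℝ), ContDiff ℝ n H → ∀ t : ℝ,
        iteratedDeriv n (fun t ↦ H (logSumLine u w t)) t = (D.map (faaTerm H u w t)).sum := by
  induction n with
  | zero => exact ⟨[(1, 0, [])], by simp, fun d _ u w H _ t ↦ by simp [faaTerm]⟩
  | succ n ih =>
    obtain ⟨D, hD, hd⟩ := ih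
    obtain ⟨E, hE, hd2⟩ := exists_hasDerivAt_sum_faaTerm n D hD
    refine ⟨E, fun e he ↦ ⟨(hE e he).1, fun _ ↦ (hE e he).2.1, (hE e he).2.2, by simp⟩, ?_⟩
    intro d _ u w H hH t
    rw [iteratedDeriv_succ, ← (hd2 d u w H hH t).deriv]
    congr 1
    ext t
    exact hd d u w H (hH.of_le (by exact_mod_cast Nat.le_succ n)) t

/-- Chebyshev's association inequality: `a ^ r` and `a ^ n` are similarly ordered, so (a_j^r -
a_k^r)(a_j^n - a_k^n) ≥ 0, and this is averaged over two independent indices j and k. It collapses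
products of softmax moments into one moment. -/
lemma sum_pow_mul_sum_pow_le {ι : Type*} (s : Finset ι) (p a : ι → ℝ) (hp : ∀ j, 0 ≤ p j)
    (hp1 : ∑ j ∈ s, p j = 1) (ha : ∀ j, 0 ≤ a j) (r n : ℕ) :
    (∑ j ∈ s, p j * a j ^ r) * (∑ j ∈ s, p j * a j ^ n) ≤ ∑ j ∈ s, p j * a j ^ (r + n) := by
  have key : ∀ j k, p j * p k * (a j ^ r * a k ^ n + a j ^ n * a k ^ r) ≤
      p j * p k * (a j ^ (r + n) + a k ^ (r + n)) := by
    intro j k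
    refine mul_le_mul_of_nonneg_left ?_ (mul_nonneg (hp j) (hp k))
    have : 0 ≤ (a j ^ r - a k ^ r) * (a j ^ n - a k ^ n) := by
      rcases le_total (a j) (a k) with h | h
      · exact mul_nonneg_of_nonpos_of_nonpos
          (sub_nonpos.2 (pow_le_pow_left₀ (ha j) h r)) (sub_nonpos.2 (pow_le_pow_left₀ (ha j) h n))
      · exact mul_nonneg
          (sub_nonneg.2 (pow_le_pow_left₀ (ha k) h r)) (sub_nonneg.2 (pow_le_pow_left₀ (ha k) h n))
    rw [pow_add, pow_add]
    linarith
  have h1 : ∑ j ∈ s, ∑ k ∈ s, p j * p k * (a j ^ r * a k ^ n + a j ^ n * a k ^ r) =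
      2 * ((∑ j ∈ s, p j * a j ^ r) * (∑ j ∈ s, p j * a j ^ n)) := by
    have e1 := Finset.sum_mul_sum s s (fun j ↦ p j * a j ^ r) (fun j ↦ p j * a j ^ n)
    have e2 := Finset.sum_mul_sum s s (fun j ↦ p j * a j ^ n) (fun j ↦ p j * a j ^ r)
    rw [two_mul]
    nth_rw 2 [mul_comm]
    rw [e1, e2, ← Finset.sum_add_distrib]
    refine Finset.sum_congr rfl fun j _ ↦ ?_
    rw [← Finset.sum_add_distrib]
    exact Finset.sum_congr rfl fun k _ ↦ by ring
  have h2 : ∑ j ∈ s, ∑ k ∈ s, p j * p k * (a j ^ (r + n) + a k ^ (r + n)) =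
      2 * ∑ j ∈ s, p j * a j ^ (r + n) := by
    have e1 := Finset.sum_mul_sum s s (fun j ↦ p j * a j ^ (r + n)) p
    have e2 := Finset.sum_mul_sum s s p (fun j ↦ p j * a j ^ (r + n))
    rw [hp1, mul_one] at e1
    rw [hp1, one_mul] at e2
    rw [two_mul]
    nth_rw 2 [e2]
    rw [e1, ← Finset.sum_add_distrib]
    refine Finset.sum_congr rfl fun j _ ↦ ?_
    rw [← Finset.sum_add_distrib]
    exact Finset.sum_congr rfl fun k _ ↦ by ring
  have := Finset.sum_le_sum fun j (_ : j ∈ s) ↦ Finset.sum_le_sum fun k (_ : k ∈ s) ↦ key j k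
  rw [h1, h2] at this
  linarith

/-- The absolute moments of `v` under the softmax weights at `u`. -/
def softAbs {d : ℕ} (u v : Fin d → ℝ) (r : ℕ) : ℝ := ∑ j, softWeight u j * |v j| ^ r

lemma softAbs_nonneg {d : ℕ} (u v : Fin d → ℝ) (r : ℕ) : 0 ≤ softAbs u v r :=
  Finset.sum_nonneg fun _ _ ↦ mul_nonneg (softWeight_nonneg _ _) (by positivity)

lemma abs_prod_softMoment_le {d : ℕ} [NeZero d] (u w : Fin d → ℝ) (t : ℝ) (L : List ℕ) :
    |(L.map fun r ↦ softMoment u w r t).prod| ≤ softAbs (fun k ↦ u k + t * w k) w L.sum := by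
  induction L with
  | nil => simp [softAbs, sum_softWeight]
  | cons r L ih =>
    rw [List.map_cons, List.prod_cons, abs_mul, List.sum_cons]
    have h1 : |softMoment u w r t| ≤ softAbs (fun k ↦ u k + t * w k) w r := by
      refine (Finset.abs_sum_le_sum_abs _ _).trans (Finset.sum_le_sum fun j _ ↦ ?_)
      rw [abs_mul, abs_pow, abs_of_nonneg (softWeight_nonneg _ _)]
    refine (mul_le_mul h1 ih (abs_nonneg _) (softAbs_nonneg _ _ _)).trans ?_
    exact sum_pow_mul_sum_pow_le _ _ _ (softWeight_nonneg _) (sum_softWeight _)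
      (fun _ ↦ abs_nonneg _) _ _

lemma exists_abs_iteratedDeriv_comp_logSumLine_le (m : ℕ) (hm : 1 ≤ m) :
    ∃ C : ℝ, 0 < C ∧ ∀ (d : ℕ) [NeZero d] (u w : Fin d → ℝ) (H : ℝ → ℝ) (B : ℝ),
      ContDiff ℝ m H → (∀ j, 1 ≤ j → j ≤ m → ∀ x, |iteratedDeriv j H x| ≤ B) → ∀ t : ℝ,
        |iteratedDeriv m (fun t ↦ H (logSumLine u w t)) t| ≤
          C * B * softAbs (fun k ↦ u k + t * w k) w m := by
  obtain ⟨D, hD, hd⟩ := exists_iteratedDeriv_comp_logSumLine m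
  have h0 : 0 ≤ (D.map fun e ↦ |e.1|).sum :=
    List.sum_nonneg (by simp only [List.mem_map]; rintro _ ⟨e, _, rfl⟩; exact abs_nonneg _)
  refine ⟨(D.map fun e ↦ |e.1|).sum + 1, by linarith, ?_⟩
  intro d _ u w H B hH hB t
  rw [hd d u w H hH t]
  have hB0 : 0 ≤ B := (abs_nonneg _).trans (hB 1 le_rfl hm 0)
  have hS := softAbs_nonneg (fun k ↦ u k + t * w k) w m
  suffices h : |(D.map (faaTerm H u w t)).sum| ≤
      (D.map fun e ↦ |e.1|).sum * (B * softAbs (fun k ↦ u k + t * w k) w m) by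
    nlinarith [mul_nonneg hB0 hS]
  clear h0 hd
  induction D with
  | nil => simp
  | cons e D ih =>
    simp only [List.map_cons, List.sum_cons, add_mul]
    refine (abs_add_le _ _).trans (add_le_add ?_ (ih fun e he ↦ hD e (List.mem_cons_of_mem _ he)))
    obtain ⟨h1, h2, h3, -⟩ := hD e List.mem_cons_self
    rw [faaTerm, abs_mul, abs_mul, mul_assoc]
    refine mul_le_mul_of_nonneg_left ?_ (abs_nonneg _)
    refine mul_le_mul (hB _ (h2 hm) h1 _) ?_ (abs_nonneg _) hB0
    exact (abs_prod_softMoment_le u w t e.2.2).trans_eq (by rw [h3])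

/-- The numerator grows by at most a factor e, and the normalising sum shrinks by at most a factor
e. -/
lemma softWeight_add_le {d : ℕ} [NeZero d] (u z : Fin d → ℝ) (hz : ∀ k, |z k| ≤ 1) (j : Fin d) :
    softWeight (fun k ↦ u k + z k) j ≤ Real.exp 2 * softWeight u j := by
  unfold softWeight
  rw [div_le_iff₀ (sum_exp_pos _)]
  have h1 : Real.exp (-1) * ∑ k, Real.exp (u k) ≤ ∑ k, Real.exp (u k + z k) := by
    rw [Finset.mul_sum]
    refine Finset.sum_le_sum fun k _ ↦ ?_
    rw [← Real.exp_add]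
    exact Real.exp_le_exp.2 (by linarith [(abs_le.1 (hz k)).1])
  have h2 : Real.exp (u j + z j) ≤ Real.exp 1 * Real.exp (u j) := by
    rw [← Real.exp_add]
    exact Real.exp_le_exp.2 (by linarith [(abs_le.1 (hz j)).2])
  refine h2.trans ?_
  have h3 : Real.exp 1 * Real.exp (u j) = Real.exp 2 * (Real.exp (u j) / ∑ k, Real.exp (u k)) *
      (Real.exp (-1) * ∑ k, Real.exp (u k)) := by
    have := (sum_exp_pos u).ne'
    have e : Real.exp 2 * Real.exp (-1) = Real.exp 1 := by rw [← Real.exp_add]; norm_num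
    rw [← e]
    field_simp
  rw [h3]
  exact mul_le_mul_of_nonneg_left h1
    (mul_nonneg (Real.exp_pos _).le (softWeight_nonneg u j))

lemma softAbs_add_le {d : ℕ} [NeZero d] (u z v : Fin d → ℝ) (hz : ∀ k, |z k| ≤ 1) (r : ℕ) :
    softAbs (fun k ↦ u k + z k) v r ≤ Real.exp 2 * softAbs u v r := by
  unfold softAbs
  rw [Finset.mul_sum]
  refine Finset.sum_le_sum fun j _ ↦ ?_
  rw [← mul_assoc]
  exact mul_le_mul_of_nonneg_right (softWeight_add_le u z hz j) (by positivity)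

lemma softAbs_le_norm {d : ℕ} [NeZero d] (u v : Fin d → ℝ) (r : ℕ) : softAbs u v r ≤ ‖v‖ ^ r := by
  calc softAbs u v r ≤ ∑ j, softWeight u j * ‖v‖ ^ r := Finset.sum_le_sum fun j _ ↦
        mul_le_mul_of_nonneg_left (pow_le_pow_left₀ (abs_nonneg _) (norm_le_pi_norm v j) r)
          (softWeight_nonneg _ _)
    _ = ‖v‖ ^ r := by rw [← Finset.sum_mul, sum_softWeight, one_mul]

/-! ### Taylor expansion of h composed with the smooth maximum -/

lemma bddAbove_derivs {m : ℕ} {h : ℝ → ℝ} (hh : IsCmb m h) {j : ℕ} (h1 : 1 ≤ j) (hj : j ≤ m) :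
    BddAbove (Set.range fun x ↦ |iteratedDeriv j h x|) := by
  obtain ⟨B, hB⟩ := hh.2 j (Finset.mem_Icc.2 ⟨h1, hj⟩)
  exact ⟨B, by rintro _ ⟨x, rfl⟩; exact hB x⟩

lemma pow_mul_abs_iteratedDeriv_le_derivBound {m : ℕ} {h : ℝ → ℝ} (hh : IsCmb m h) {β : ℝ}
    (hβ : 0 < β) {j : ℕ} (h1 : 1 ≤ j) (hj : j ≤ m) (x : ℝ) :
    β ^ (m - j) * |iteratedDeriv j h x| ≤ derivBound m β h := by
  refine le_trans ?_ (le_ciSup (f := fun j : Finset.Icc 1 m ↦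
    β ^ (m - (j : ℕ)) * ⨆ x : ℝ, |iteratedDeriv (j : ℕ) h x|) (Set.finite_range _).bddAbove
    ⟨j, Finset.mem_Icc.2 ⟨h1, hj⟩⟩)
  exact mul_le_mul_of_nonneg_left (le_ciSup (bddAbove_derivs hh h1 hj) x) (by positivity)

lemma derivBound_nonneg (m : ℕ) {β : ℝ} (hβ : 0 < β) (h : ℝ → ℝ) : 0 ≤ derivBound m β h :=
  Real.iSup_nonneg fun _ ↦ mul_nonneg (by positivity) (Real.iSup_nonneg fun _ ↦ abs_nonneg _)

/-- Lagrange's remainder with the factorial discarded. The coefficients are fixed before t, so the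
polynomial can be integrated against two laws with equal moments. Only the intermediate point
depends on t. -/
lemma exists_taylor_sum_eq {g : ℝ → ℝ} {n : ℕ} (hg : ContDiff ℝ (n + 1 : ℕ) g) :
    ∃ c : ℕ → ℝ, ∀ t : ℝ, ∃ x : ℝ, |x| ≤ |t| ∧
      |g t - ∑ r ∈ Finset.range (n + 1), c r * t ^ r| ≤ |iteratedDeriv (n + 1) g x| * |t| ^ (n + 1) := by
  refine ⟨fun r ↦ ((r.factorial : ℝ))⁻¹ * iteratedDeriv r g 0, fun t ↦ ?_⟩
  rcases eq_or_ne 0 t with rfl | ht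
  · refine ⟨0, le_rfl, ?_⟩
    rw [Finset.sum_range_succ']
    simp
  · obtain ⟨x, hx, h⟩ := taylor_mean_remainder_lagrange_iteratedDeriv (n := n) ht
      (hg.contDiffOn (s := Set.uIcc 0 t))
    refine ⟨x, ?_, ?_⟩
    · have := Set.abs_sub_left_of_mem_uIcc (Set.uIoo_subset_uIcc_self hx)
      simpa using this
    · rw [taylor_within_apply, sub_zero] at h
      have e : ∀ r ∈ Finset.range (n + 1), ((r.factorial : ℝ)⁻¹ * t ^ r) •
          iteratedDerivWithin r g (Set.uIcc 0 t) 0 =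
          ((r.factorial : ℝ))⁻¹ * iteratedDeriv r g 0 * t ^ r := by
        intro r hr
        rw [iteratedDerivWithin_eq_iteratedDeriv (uniqueDiffOn_uIcc ht)
          (hg.contDiffAt.of_le (by exact_mod_cast (Finset.mem_range.1 hr).le)) Set.left_mem_uIcc,
          smul_eq_mul]
        ring
      rw [Finset.sum_congr rfl e] at h
      rw [h, abs_div, abs_mul, abs_pow]
      refine div_le_self (by positivity) ?_
      rw [Nat.abs_cast]
      exact_mod_cast Nat.one_le_iff_ne_zero.2 (Nat.factorial_ne_zero _)

lemma contDiff_logSumLine {d : ℕ} [NeZero d] (u w : Fin d → ℝ) (n : WithTop ℕ∞) :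
    ContDiff ℝ n (logSumLine u w) := by
  unfold logSumLine
  refine ContDiff.log ?_ fun t ↦ (sum_exp_pos _).ne'
  fun_prop

/-- Taylor expansion of `h ∘ Φ_β` along a line, with a remainder controlled by softmax weights. -/
lemma exists_taylor_smoothMax (m : ℕ) (hm : 1 ≤ m) :
    ∃ C : ℝ, 0 < C ∧ ∀ (d : ℕ) [NeZero d] (h : ℝ → ℝ) (β : ℝ), IsCmb m h → 0 < β →
      ∀ u v : Fin d → ℝ, ∃ c : ℕ → ℝ, ∀ t : ℝ,
        (|t| * ‖v‖ ≤ β⁻¹ →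
          |h (smoothMax β fun k ↦ u k + t * v k) - ∑ r ∈ Finset.range m, c r * t ^ r| ≤
            C * derivBound m β h * (|t| ^ m * softAbs (fun k ↦ β * u k) v m)) ∧
        |h (smoothMax β fun k ↦ u k + t * v k) - ∑ r ∈ Finset.range m, c r * t ^ r| ≤
            C * derivBound m β h * (|t| ^ m * ‖v‖ ^ m) := by
  obtain ⟨C, hC, hd⟩ := exists_abs_iteratedDeriv_comp_logSumLine_le m hm
  -- The factor exp 2 pays for moving the softmax weights from the intermediate Taylor point back to
  -- t = 0. The unconditional bound does not need it, but shares the constant.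
  refine ⟨C * Real.exp 2, by positivity, ?_⟩
  intro d _ h β hh hβ u v
  obtain ⟨n, rfl⟩ : ∃ n, m = n + 1 := ⟨m - 1, by omega⟩
  set H : ℝ → ℝ := fun s ↦ h (β⁻¹ * s) with hHdef
  have hH : ContDiff ℝ (n + 1 : ℕ) H := hh.1.comp (contDiff_const.mul contDiff_id)
  set D := derivBound (n + 1) β h
  have hD0 : 0 ≤ D := derivBound_nonneg _ hβ _
  -- Here β^{-j} = β^{-m} β^{m-j}. The factor β^{m-j} is the one in `derivBound`, and β^{-m} cancels
  -- below against the β^m coming from the direction βv.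
  have hB : ∀ j, 1 ≤ j → j ≤ n + 1 → ∀ x, |iteratedDeriv j H x| ≤ (β ^ (n + 1))⁻¹ * D := by
    intro j h1 hj x
    have e : iteratedDeriv j H x = (β⁻¹) ^ j * iteratedDeriv j h (β⁻¹ * x) :=
      congrFun (iteratedDeriv_comp_const_mul (hh.1.of_le (by exact_mod_cast hj)) β⁻¹) x
    rw [e, abs_mul, abs_of_pos (by positivity : 0 < (β⁻¹) ^ j)]
    have h2 := pow_mul_abs_iteratedDeriv_le_derivBound hh hβ h1 hj (β⁻¹ * x)
    have e2 : (β⁻¹) ^ j = (β ^ (n + 1))⁻¹ * β ^ (n + 1 - j) := by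
      rw [inv_pow, ← pow_sub_mul_pow β hj]
      field_simp
    rw [e2, mul_assoc]
    exact mul_le_mul_of_nonneg_left h2 (by positivity)
  set g : ℝ → ℝ := fun t ↦ H (logSumLine (fun k ↦ β * u k) (fun k ↦ β * v k) t) with hg
  have hgC : ContDiff ℝ (n + 1 : ℕ) g := hH.comp (contDiff_logSumLine _ _ _)
  have hge : ∀ t, h (smoothMax β fun k ↦ u k + t * v k) = g t := by
    intro t
    simp only [hg, hHdef, smoothMax, logSumLine]
    congr 3
    exact Finset.sum_congr rfl fun k _ ↦ by ring_nf
  obtain ⟨c, hc⟩ := exists_taylor_sum_eq hgC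
  have hbase : ∀ x, |iteratedDeriv (n + 1) g x| ≤ C * D * softAbs (fun k ↦ β * u k + x * (β * v k)) v (n + 1) := by
    intro x
    refine (hd d (fun k ↦ β * u k) (fun k ↦ β * v k) H _ hH hB x).trans_eq ?_
    have e : softAbs (fun k ↦ β * u k + x * (β * v k)) (fun k ↦ β * v k) (n + 1) =
        β ^ (n + 1) * softAbs (fun k ↦ β * u k + x * (β * v k)) v (n + 1) := by
      unfold softAbs
      rw [Finset.mul_sum]
      refine Finset.sum_congr rfl fun j _ ↦ ?_
      rw [abs_mul, mul_pow, abs_of_pos hβ]; ring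
    rw [e]
    field_simp
  have he2 : (1 : ℝ) ≤ Real.exp 2 := Real.one_le_exp (by norm_num)
  refine ⟨c, fun t ↦ ?_⟩
  obtain ⟨x, hx, hxt⟩ := hc t
  rw [hge t]
  refine ⟨fun ht ↦ hxt.trans ?_, hxt.trans ?_⟩
  · have h1 : softAbs (fun k ↦ β * u k + x * (β * v k)) v (n + 1) ≤
        Real.exp 2 * softAbs (fun k ↦ β * u k) v (n + 1) := by
      refine softAbs_add_le _ _ _ (fun k ↦ ?_) _
      rw [abs_mul, abs_mul, abs_of_pos hβ]
      calc |x| * (β * |v k|) ≤ |t| * (β * ‖v‖) := by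
            gcongr
            exact norm_le_pi_norm v k
        _ = β * (|t| * ‖v‖) := by ring
        _ ≤ β * β⁻¹ := by gcongr
        _ = 1 := mul_inv_cancel₀ hβ.ne'
    calc |iteratedDeriv (n + 1) g x| * |t| ^ (n + 1)
        ≤ (C * D * (Real.exp 2 * softAbs (fun k ↦ β * u k) v (n + 1))) * |t| ^ (n + 1) := by
          gcongr
          exact (hbase x).trans (by gcongr)
      _ = _ := by ring
  · calc |iteratedDeriv (n + 1) g x| * |t| ^ (n + 1)
        ≤ (C * D * ‖v‖ ^ (n + 1)) * |t| ^ (n + 1) := by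
          gcongr
          exact (hbase x).trans (by gcongr; exact softAbs_le_norm _ _ _)
      _ = C * 1 * D * (|t| ^ (n + 1) * ‖v‖ ^ (n + 1)) := by ring
      _ ≤ _ := by gcongr

/-! ### Growth of moments -/

section Moments

variable {Ω : Type*} [MeasurableSpace Ω] {μ : Measure Ω}

lemma lintegral_add_pow_le {f g : Ω → ℝ≥0∞} (hf : AEMeasurable f μ) (hg : AEMeasurable g μ)
    {p : ℕ} (hp : 1 ≤ p) {a b : ℝ≥0∞} (ha : ∫⁻ ω, f ω ^ p ∂μ ≤ a ^ p)
    (hb : ∫⁻ ω, g ω ^ p ∂μ ≤ b ^ p) : ∫⁻ ω, (f ω + g ω) ^ p ∂μ ≤ (a + b) ^ p := by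
  have hp0 : (p : ℝ) ≠ 0 := by positivity
  have h := ENNReal.lintegral_Lp_add_le hf hg (p := (p : ℝ)) (by exact_mod_cast hp)
  simp only [ENNReal.rpow_natCast, Pi.add_apply] at h
  have key : ∀ {x c : ℝ≥0∞}, x ≤ c ^ p → x ^ (1 / (p : ℝ)) ≤ c := by
    intro x c hx
    calc x ^ (1 / (p : ℝ)) ≤ (c ^ p) ^ (1 / (p : ℝ)) := ENNReal.rpow_le_rpow hx (by positivity)
      _ = c := by rw [← ENNReal.rpow_natCast, ← ENNReal.rpow_mul, mul_one_div_cancel hp0,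
                    ENNReal.rpow_one]
  have h2 := h.trans (add_le_add (key ha) (key hb))
  calc ∫⁻ ω, (f ω + g ω) ^ p ∂μ = ((∫⁻ ω, (f ω + g ω) ^ p ∂μ) ^ (1 / (p : ℝ))) ^ p := by
        rw [← ENNReal.rpow_natCast (_ ^ (1 / (p : ℝ))), ← ENNReal.rpow_mul, one_div_mul_cancel hp0,
          ENNReal.rpow_one]
    _ ≤ (a + b) ^ p := by gcongr

lemma lintegral_sum_pow_le {ι : Type*} (s : Finset ι) {f : ι → Ω → ℝ≥0∞}
    (hf : ∀ i, AEMeasurable (f i) μ) {p : ℕ} (hp : 1 ≤ p) {a : ι → ℝ≥0∞}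
    (ha : ∀ i, ∫⁻ ω, f i ω ^ p ∂μ ≤ a i ^ p) :
    ∫⁻ ω, (∑ i ∈ s, f i ω) ^ p ∂μ ≤ (∑ i ∈ s, a i) ^ p := by
  classical
  induction s using Finset.induction_on with
  | empty => simp [zero_pow (by omega : p ≠ 0)]
  | insert i s hi ih =>
    simp only [Finset.sum_insert hi]
    exact lintegral_add_pow_le (hf i) (Finset.aemeasurable_fun_sum s fun i _ ↦ hf i) hp (ha i) ih

lemma lintegral_pow_le_of_le [IsProbabilityMeasure μ] {f : Ω → ℝ≥0∞} (hf : AEMeasurable f μ)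
    {p q : ℕ} (hp : 1 ≤ p) (hpq : p ≤ q) {a : ℝ≥0∞} (ha : ∫⁻ ω, f ω ^ q ∂μ ≤ a ^ q) :
    ∫⁻ ω, f ω ^ p ∂μ ≤ a ^ p := by
  have hp0 : (p : ℝ) ≠ 0 := by positivity
  have hq0 : (q : ℝ) ≠ 0 := by have : 1 ≤ q := hp.trans hpq; positivity
  rcases hpq.eq_or_lt with rfl | hlt
  · exact ha
  have hr : (p : ℝ) < q := by exact_mod_cast hlt
  have hc : (q / p : ℝ).HolderConjugate (q / (q - p) : ℝ) := by
    rw [Real.holderConjugate_iff]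
    refine ⟨(one_lt_div (by positivity)).2 hr, ?_⟩
    have : (q : ℝ) - p ≠ 0 := by linarith
    field_simp
    ring
  have h := ENNReal.lintegral_mul_le_Lp_mul_Lq μ hc (hf.pow_const p) (g := fun _ ↦ 1)
    aemeasurable_const
  simp only [Pi.mul_apply, mul_one, ENNReal.one_rpow, lintegral_const, measure_univ] at h
  have e : ∀ ω, (f ω ^ p) ^ (q / p : ℝ) = f ω ^ q := by
    intro ω
    rw [← ENNReal.rpow_natCast, ← ENNReal.rpow_natCast, ← ENNReal.rpow_mul]
    congr 1
    field_simp
  simp only [e] at h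
  refine h.trans ?_
  calc (∫⁻ ω, f ω ^ q ∂μ) ^ (1 / (q / p : ℝ)) ≤ (a ^ q) ^ (1 / (q / p : ℝ)) :=
        ENNReal.rpow_le_rpow ha (by positivity)
    _ = a ^ p := by
        rw [← ENNReal.rpow_natCast, ← ENNReal.rpow_natCast, ← ENNReal.rpow_mul]
        congr 1
        field_simp

/-- The `p`-th moment of `f` is at most `(A pˢ)ᵖ` for all integers `p ≥ 1`. -/
def MomGrowth (μ : Measure Ω) (f : Ω → ℝ≥0∞) (A s : ℝ) : Prop :=
  ∀ p : ℕ, 1 ≤ p → ∫⁻ ω, f ω ^ p ∂μ ≤ ENNReal.ofReal (A * (p : ℝ) ^ s) ^ p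

lemma MomGrowth.mono {f : Ω → ℝ≥0∞} {A B s t : ℝ} (h : MomGrowth μ f A s) (hA : 0 ≤ A)
    (hAB : A ≤ B) (hst : s ≤ t) : MomGrowth μ f B t := by
  intro p hp
  refine (h p hp).trans ?_
  have : (1 : ℝ) ≤ p := by exact_mod_cast hp
  have hB : 0 ≤ B := hA.trans hAB
  gcongr

lemma MomGrowth.lintegral_pow_le [IsProbabilityMeasure μ] {f : Ω → ℝ≥0∞} {A s : ℝ}
    (h : MomGrowth μ f A s) (p : ℕ) :
    ∫⁻ ω, f ω ^ p ∂μ ≤ ENNReal.ofReal (A * (p : ℝ) ^ s) ^ p := by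
  rcases Nat.eq_zero_or_pos p with rfl | hp
  · simp
  · exact h p hp

lemma MomGrowth.prod {Ω' : Type*} [MeasurableSpace Ω'] {ν : Measure Ω'} [SFinite ν] [SFinite μ]
    {f : Ω → ℝ≥0∞} {g : Ω' → ℝ≥0∞} (hfm : Measurable f) (hgm : Measurable g) {A B s t : ℝ}
    (hA : 0 ≤ A) (hf : MomGrowth μ f A s) (hg : MomGrowth ν g B t) :
    MomGrowth (μ.prod ν) (fun z ↦ f z.1 * g z.2) (A * B) (s + t) := by
  intro p hp
  have hp' : (0 : ℝ) < p := by exact_mod_cast hp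
  simp only [mul_pow]
  rw [lintegral_prod_mul (hfm.pow_const p).aemeasurable (hgm.pow_const p).aemeasurable]
  refine (mul_le_mul' (hf p hp) (hg p hp)).trans_eq ?_
  rw [← mul_pow, ← ENNReal.ofReal_mul (by positivity), Real.rpow_add hp']
  ring_nf

lemma MomGrowth.sum_pow {ι : Type*} (s : Finset ι) {f : ι → Ω → ℝ≥0∞}
    (hf : ∀ i, AEMeasurable (f i) μ) {A : ι → ℝ} (hA : ∀ i, 0 ≤ A i) {r : ℝ}
    (h : ∀ i, MomGrowth μ (f i) (A i) r) {m : ℕ} (hm : 1 ≤ m) :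
    MomGrowth μ (fun ω ↦ ∑ i ∈ s, f i ω ^ m) (((m : ℝ) ^ r) ^ m * ∑ i ∈ s, A i ^ m) (m * r) := by
  intro p hp
  have hp' : (0 : ℝ) < p := by exact_mod_cast hp
  refine (lintegral_sum_pow_le s (fun i ↦ (hf i).pow_const m) hp
    (a := fun i ↦ ENNReal.ofReal (A i * ((p * m : ℕ) : ℝ) ^ r) ^ m) fun i ↦ ?_).trans_eq ?_
  · have := h i (p * m) (Nat.mul_pos hp hm)
    simpa only [← pow_mul, mul_comm p m] using this
  · congr 1
    have e : ∀ i ∈ s, ENNReal.ofReal (A i * ((p * m : ℕ) : ℝ) ^ r) ^ m =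
        ENNReal.ofReal (((m : ℝ) ^ r) ^ m * A i ^ m * (p : ℝ) ^ (m * r)) := by
      intro i _
      rw [← ENNReal.ofReal_pow (mul_nonneg (hA i) (by positivity))]
      congr 1
      push_cast
      rw [Real.mul_rpow (by positivity) (by positivity), mul_comm (m : ℝ) r,
        Real.rpow_mul (by positivity), Real.rpow_natCast]
      ring
    rw [Finset.sum_congr rfl e, ← ENNReal.ofReal_sum_of_nonneg, Finset.mul_sum, Finset.sum_mul]
    exact fun i _ ↦ mul_nonneg (mul_nonneg (by positivity) (pow_nonneg (hA i) m)) (by positivity)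

/-- The maximum over `d` functions costs a factor of order `(log d)ˢ`. -/
lemma MomGrowth.sup [IsProbabilityMeasure μ] {d : ℕ} {f : Fin d → Ω → ℝ≥0∞} {T : Ω → ℝ≥0∞}
    (hT : AEMeasurable T μ) {A s : ℝ} (hA : 0 ≤ A) (hs : 0 ≤ s)
    (hd : 2 ≤ d ∨ (d = 1 ∧ s = 0))
    (hTf : ∀ p : ℕ, 1 ≤ p → ∀ ω, T ω ^ p ≤ ∑ k, f k ω ^ p) (hfm : ∀ k, AEMeasurable (f k) μ)
    (hf : ∀ k, MomGrowth μ (f k) A s) :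
    MomGrowth μ T (Real.exp 1 * 3 ^ s * A * Real.log d ^ s) s := by
  have hbase : ∀ p : ℕ, 1 ≤ p → ∫⁻ ω, T ω ^ p ∂μ ≤ d * ENNReal.ofReal (A * (p : ℝ) ^ s) ^ p := by
    intro p hp
    calc ∫⁻ ω, T ω ^ p ∂μ ≤ ∫⁻ ω, ∑ k, f k ω ^ p ∂μ := lintegral_mono fun ω ↦ hTf p hp ω
      _ = ∑ k, ∫⁻ ω, f k ω ^ p ∂μ := lintegral_finsetSum' _ fun k _ ↦ (hfm k).pow_const p
      _ ≤ ∑ k : Fin d, ENNReal.ofReal (A * (p : ℝ) ^ s) ^ p :=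
        Finset.sum_le_sum fun k _ ↦ hf k p hp
      _ = _ := by simp
  have he1 : (1 : ℝ) ≤ Real.exp 1 := Real.one_le_exp zero_le_one
  rcases hd with hd | ⟨rfl, rfl⟩
  swap
  -- For d = 1 the logarithm is 0, but s = 0 makes its power equal to 1.
  · intro p hp
    refine (hbase p hp).trans ?_
    simp only [Nat.cast_one, one_mul, Real.rpow_zero, mul_one]
    gcongr
    nlinarith
  have hd' : (2 : ℝ) ≤ d := by exact_mod_cast hd
  set l := Real.log d with hl
  have hl2 : 1 / 2 < l := by
    have h1 : Real.log 2 ≤ l := Real.log_le_log (by norm_num) hd'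
    linarith [Real.log_two_gt_d9]
  -- Once p ≥ log d, the union factor satisfies d^{1/p} ≤ e.
  have hbase2 : ∀ p : ℕ, 1 ≤ p → l ≤ p →
      ∫⁻ ω, T ω ^ p ∂μ ≤ ENNReal.ofReal (Real.exp 1 * A * (p : ℝ) ^ s) ^ p := by
    intro p hp hlp
    refine (hbase p hp).trans ?_
    have h1 : (d : ℝ) ≤ Real.exp 1 ^ p := by
      rw [← Real.exp_nat_mul, mul_one]
      exact (Real.le_exp_log _).trans (Real.exp_le_exp.2 hlp)
    have h2 : (d : ℝ≥0∞) ≤ ENNReal.ofReal (Real.exp 1) ^ p := by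
      rw [← ENNReal.ofReal_pow (Real.exp_pos _).le, ← ENNReal.ofReal_natCast]
      exact ENNReal.ofReal_le_ofReal h1
    refine (mul_le_mul_left h2 _).trans_eq ?_
    rw [← mul_pow, ← ENNReal.ofReal_mul (Real.exp_pos _).le, mul_assoc]
  intro p hp
  have hp1 : (1 : ℝ) ≤ p := by exact_mod_cast hp
  rcases le_total l p with hlp | hlp
  · refine (hbase2 p hp hlp).trans ?_
    have h1 : (p : ℝ) ^ s ≤ 3 ^ s * l ^ s * (p : ℝ) ^ s := by
      have : (1 : ℝ) ≤ 3 ^ s * l ^ s := by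
        rw [← Real.mul_rpow (by norm_num) (by linarith)]
        exact Real.one_le_rpow (by linarith) hs
      nlinarith [Real.rpow_nonneg (by linarith : (0 : ℝ) ≤ p) s]
    gcongr ENNReal.ofReal ?_ ^ p
    calc Real.exp 1 * A * (p : ℝ) ^ s ≤ Real.exp 1 * A * (3 ^ s * l ^ s * (p : ℝ) ^ s) := by gcongr
      _ = _ := by ring
  -- Below log d, the L^p norm is bounded by the norm at p' = ⌈log d⌉. Since log d > 1/2, p' ≤ 3 log
  -- d; this is the origin of the factor 3^s.
  · set p' := ⌈l⌉₊ with hp'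
    have hlp' : l ≤ p' := Nat.le_ceil l
    have hp'3 : (p' : ℝ) ≤ 3 * l := by
      have := Nat.ceil_lt_add_one (by linarith : 0 ≤ l)
      linarith
    have hpp' : p ≤ p' := by exact_mod_cast hlp.trans hlp'
    refine lintegral_pow_le_of_le hT hp hpp' ((hbase2 p' (hp.trans hpp') hlp').trans ?_)
    gcongr ENNReal.ofReal ?_ ^ p'
    calc Real.exp 1 * A * (p' : ℝ) ^ s ≤ Real.exp 1 * A * ((3 * l) ^ s * 1) := by
          rw [mul_one]
          gcongr
      _ ≤ Real.exp 1 * A * ((3 * l) ^ s * (p : ℝ) ^ s) := by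
          gcongr
          exact Real.one_le_rpow hp1 hs
      _ = _ := by
          rw [Real.mul_rpow (by norm_num) (by linarith)]
          ring

lemma ennreal_le_mul_sq_add_inv (y ε : ℝ≥0∞) (h0 : ε ≠ 0) (h1 : ε ≠ ∞) : y ≤ ε * y ^ 2 + ε⁻¹ := by
  rcases le_total y ε⁻¹ with h | h
  · exact h.trans le_add_self
  · refine le_trans ?_ le_self_add
    have : 1 ≤ ε * y := by
      rw [← ENNReal.mul_inv_cancel h0 h1]
      gcongr
    calc y = 1 * y := (one_mul y).symm
      _ ≤ ε * y * y := by gcongr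
      _ = ε * y ^ 2 := by ring

lemma measure_lt_le_of_momGrowth {f : Ω → ℝ≥0∞} (hf : Measurable f) {L Λ s : ℝ}
    (hL : 0 < L) (hΛ : 0 < Λ) (h : MomGrowth μ f (L * Λ) s) {ρ : ℝ} (hρ : 0 < ρ) {n : ℕ}
    (hn : 1 ≤ n) : μ {ω | ENNReal.ofReal (ρ * Λ) < f ω} ≤
      ENNReal.ofReal (L * (n : ℝ) ^ s / ρ) ^ n := by
  have h1 := mul_meas_ge_le_lintegral (μ := μ) (hf.pow_const n) (ENNReal.ofReal (ρ * Λ) ^ n)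
  have h2 := h1.trans (h n hn)
  have h3 : μ {ω | ENNReal.ofReal (ρ * Λ) < f ω} ≤
      μ {ω | ENNReal.ofReal (ρ * Λ) ^ n ≤ f ω ^ n} := by
    refine measure_mono fun ω hω ↦ ?_
    have := le_of_lt (show ENNReal.ofReal (ρ * Λ) < f ω from hω)
    simp only [Set.mem_ofPred_eq]
    gcongr
  refine h3.trans ?_
  have hpos : 0 < ρ * Λ := mul_pos hρ hΛ
  have e : ENNReal.ofReal (L * Λ * (n : ℝ) ^ s) ^ n =
      ENNReal.ofReal (ρ * Λ) ^ n * ENNReal.ofReal (L * (n : ℝ) ^ s / ρ) ^ n := by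
    rw [← mul_pow, ← ENNReal.ofReal_mul hpos.le]
    congr 2
    field_simp
  rw [e] at h2
  refine (ENNReal.mul_le_mul_iff_right ?_ ?_).1 h2
  · exact pow_ne_zero _ (by simpa using hpos)
  · exact ENNReal.pow_ne_top ENNReal.ofReal_ne_top

lemma chi_nonneg (w x : ℝ) : 0 ≤ chi w x := by
  unfold chi
  split_ifs
  · positivity
  · exact Set.indicator_nonneg (fun _ _ ↦ zero_le_one) _

/-- Truncated moments of functions with controlled moment growth. -/
lemma exists_lintegral_tail_le (s : ℝ) (hs : 0 ≤ s) (L : ℝ) (hL : 0 < L) :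
    ∃ K : ℝ, 0 < K ∧ ∀ m : ℕ, ∃ C : ℝ, 0 < C ∧
      ∀ {Ω : Type*} [MeasurableSpace Ω] (μ : Measure Ω) [IsProbabilityMeasure μ]
        (f : Ω → ℝ≥0∞) (Λ ρ : ℝ), Measurable f → 0 ≤ Λ → 0 ≤ ρ → MomGrowth μ f (L * Λ) s →
        ∫⁻ ω in {ω | ENNReal.ofReal (ρ * Λ) < f ω}, f ω ^ m ∂μ ≤
          ENNReal.ofReal (C * Λ ^ m * chi s (ρ / K)) := by
  have hzero : ∀ {Ω : Type _} [MeasurableSpace Ω] (μ : Measure Ω) [IsProbabilityMeasure μ]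
        (f : Ω → ℝ≥0∞) (ρ : ℝ), Measurable f → MomGrowth μ f (L * 0) s →
        μ {ω | ENNReal.ofReal (ρ * 0) < f ω} = 0 := by
    intro Ω _ μ _ f ρ hf h
    have h1 := h 1 le_rfl
    simp only [pow_one, mul_zero, zero_mul, ENNReal.ofReal_zero, nonpos_iff_eq_zero] at h1
    rw [lintegral_eq_zero_iff hf] at h1
    simp only [mul_zero, ENNReal.ofReal_zero, pos_iff_ne_zero]
    exact h1
  rcases hs.eq_or_lt with rfl | hs0
  -- For s = 0 all moments are at most LΛ, so f is essentially bounded. Beyond ρ = 2L, Markov's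
  -- inequality gives at most 2^{-n} for every n ≥ 1, so the set is null and the indicator form of
  -- `chi 0` suffices.
  · refine ⟨2 * L, by positivity, fun m ↦ ⟨L ^ m, by positivity, ?_⟩⟩
    intro Ω _ μ _ f Λ ρ hf hΛ hρ h
    rcases lt_or_ge (ρ / (2 * L)) 1 with h1 | h1
    · have : chi 0 (ρ / (2 * L)) = 1 := by
        rw [chi, if_neg (lt_irrefl _), Set.indicator_of_mem (Set.mem_Ico.2 ⟨by positivity, h1⟩)]
        rfl
      rw [this, mul_one]
      refine (setLIntegral_le_lintegral _ _).trans ((h.lintegral_pow_le m).trans_eq ?_)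
      rw [Real.rpow_zero, mul_one, ← ENNReal.ofReal_pow (by positivity), mul_pow]
    · suffices h0 : μ {ω | ENNReal.ofReal (ρ * Λ) < f ω} = 0 by
        rw [Measure.restrict_eq_zero.2 h0]; simp
      rcases hΛ.eq_or_lt with rfl | hΛ0
      · exact hzero μ f ρ hf h
      rw [le_div_iff₀ (by positivity), one_mul] at h1
      have hρ0 : 0 < ρ := lt_of_lt_of_le (by positivity) h1
      have h2 : ∀ n : ℕ, μ {ω | ENNReal.ofReal (ρ * Λ) < f ω} ≤ ENNReal.ofReal (1 / 2) ^ (n + 1) := by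
        intro n
        refine (measure_lt_le_of_momGrowth hf hL hΛ0 h hρ0 (Nat.le_add_left 1 n)).trans ?_
        rw [Real.rpow_zero, mul_one]
        refine pow_le_pow_left₀ (zero_le) (ENNReal.ofReal_le_ofReal ?_) _
        rw [div_le_div_iff₀ hρ0 (by norm_num)]
        linarith
      have h3 : Filter.Tendsto (fun n : ℕ ↦ ENNReal.ofReal (1 / 2) ^ (n + 1)) Filter.atTop
          (nhds 0) :=
        (ENNReal.tendsto_pow_atTop_nhds_zero_of_lt_one
          (by rw [ENNReal.ofReal_lt_one]; norm_num)).comp (Filter.tendsto_add_atTop_nat 1)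
      exact le_antisymm (ge_of_tendsto' h3 h2) (zero_le)
  · have he := Real.exp_pos 1
    -- With K = eL, Markov's inequality at the power ⌊x⌋, x = (ρ/(eL))^{1/s}, gives probability at
    -- most e · e^{-x}. The extra 2^s turns x into x/2, the rate left after the second-moment trade
    -- below. None of this depends on m.
    refine ⟨Real.exp 1 * L * 2 ^ s, by positivity, fun m ↦
      ⟨(L * (2 * m : ℕ) ^ s) ^ (2 * m) + Real.exp 1, by positivity, ?_⟩⟩
    intro Ω _ μ _ f Λ ρ hf hΛ hρ h
    rcases hΛ.eq_or_lt with rfl | hΛ0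
    · rw [Measure.restrict_eq_zero.2 (hzero μ f ρ hf h)]; simp
    set x := (ρ / (Real.exp 1 * L)) ^ (1 / s) with hx
    have hx0 : 0 ≤ x := by positivity
    have hchi : chi s (ρ / (Real.exp 1 * L * 2 ^ s)) = Real.exp (-(x / 2)) := by
      rw [chi, if_pos hs0]
      congr 2
      rw [← div_div, Real.div_rpow (by positivity) (by positivity), ← Real.rpow_mul (by norm_num),
        mul_one_div_cancel hs0.ne', Real.rpow_one]
    have hμ : μ {ω | ENNReal.ofReal (ρ * Λ) < f ω} ≤
        ENNReal.ofReal (Real.exp 1 * Real.exp (-x)) := by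
      rw [← Real.exp_add]
      rcases Nat.eq_zero_or_pos ⌊x⌋₊ with hn | hn
      · have hx1 : x < 1 := Nat.floor_eq_zero.1 hn
        refine prob_le_one.trans ?_
        rw [ENNReal.one_le_ofReal]
        exact Real.one_le_exp (by linarith)
      · have hxn : (⌊x⌋₊ : ℝ) ≤ x := Nat.floor_le hx0
        have hxn1 := Nat.lt_floor_add_one x
        have hns : (⌊x⌋₊ : ℝ) ^ s ≤ ρ / (Real.exp 1 * L) := by
          calc (⌊x⌋₊ : ℝ) ^ s ≤ x ^ s := by gcongr
            _ = _ := by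
              rw [hx, ← Real.rpow_mul (by positivity), one_div_mul_cancel hs0.ne', Real.rpow_one]
        have hρ0 : 0 < ρ := by
          rcases hρ.eq_or_lt with h0 | h0
          · rw [← h0, zero_div] at hns
            have : (0 : ℝ) < (⌊x⌋₊ : ℝ) ^ s := Real.rpow_pos_of_pos (by exact_mod_cast hn) _
            linarith
          · exact h0
        refine (measure_lt_le_of_momGrowth hf hL hΛ0 h hρ0 hn).trans ?_
        rw [← ENNReal.ofReal_pow (by positivity)]
        refine ENNReal.ofReal_le_ofReal ?_
        have h1 : L * (⌊x⌋₊ : ℝ) ^ s / ρ ≤ Real.exp (-1) := by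
          rw [div_le_iff₀ hρ0, Real.exp_neg]
          calc L * (⌊x⌋₊ : ℝ) ^ s ≤ L * (ρ / (Real.exp 1 * L)) := by gcongr
            _ = _ := by field_simp
        calc (L * (⌊x⌋₊ : ℝ) ^ s / ρ) ^ ⌊x⌋₊ ≤ Real.exp (-1) ^ ⌊x⌋₊ := by gcongr
          _ = Real.exp (-(⌊x⌋₊ : ℝ)) := by rw [← Real.exp_nat_mul]; ring_nf
          _ ≤ _ := Real.exp_le_exp.2 (by linarith)
    rw [hchi]
    -- This choice balances the two sides of y ≤ ε y² + 1/ε with y = f^m: the 2m-th moment is of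
    -- order Λ^{2m} and the probability of order e^{-x}, so both terms become of order Λ^m e^{-x/2}.
    set ε : ℝ := Real.exp (-(x / 2)) / Λ ^ m with hε
    have hε0 : 0 < ε := by positivity
    have hε1 : ENNReal.ofReal ε ≠ 0 := by simpa using hε0
    set S := {ω | ENNReal.ofReal (ρ * Λ) < f ω}
    have hint : ∫⁻ ω, f ω ^ (2 * m) ∂μ ≤
        ENNReal.ofReal ((L * (2 * m : ℕ) ^ s) ^ (2 * m) * (Λ ^ m) ^ 2) := by
      refine (h.lintegral_pow_le (2 * m)).trans_eq ?_
      rw [← ENNReal.ofReal_pow (by positivity)]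
      congr 1
      rw [← pow_mul, mul_comm m 2, ← mul_pow]
      ring
    calc ∫⁻ ω in S, f ω ^ m ∂μ
        ≤ ∫⁻ ω in S, (ENNReal.ofReal ε * f ω ^ (2 * m) + (ENNReal.ofReal ε)⁻¹) ∂μ := by
          refine lintegral_mono fun ω ↦ ?_
          refine (ennreal_le_mul_sq_add_inv _ _ hε1 ENNReal.ofReal_ne_top).trans_eq ?_
          rw [← pow_mul, mul_comm m 2]
      _ = ENNReal.ofReal ε * ∫⁻ ω in S, f ω ^ (2 * m) ∂μ + (ENNReal.ofReal ε)⁻¹ * μ S := by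
          rw [lintegral_add_right _ measurable_const,
            lintegral_const_mul _ (hf.pow_const _), setLIntegral_const]
      _ ≤ ENNReal.ofReal ε * ENNReal.ofReal ((L * (2 * m : ℕ) ^ s) ^ (2 * m) * (Λ ^ m) ^ 2) +
          ENNReal.ofReal ε⁻¹ * ENNReal.ofReal (Real.exp 1 * Real.exp (-x)) := by
          rw [ENNReal.ofReal_inv_of_pos hε0]
          gcongr
          exact (setLIntegral_le_lintegral _ _).trans hint
      _ = _ := by
          rw [← ENNReal.ofReal_mul hε0.le, ← ENNReal.ofReal_mul (by positivity),
            ← ENNReal.ofReal_add (by positivity) (by positivity)]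
          congr 1
          have e : Real.exp (-x) = Real.exp (-(x / 2)) * Real.exp (-(x / 2)) := by
            rw [← Real.exp_add]; ring_nf
          rw [hε, e]
          field_simp

end Moments

/-! ### Moments of sub-Weibull variables and hypercontractivity -/

/-- The inequality z ≤ e^z at z = y/r, raised to the power r. Used with r = p/α, it turns an
exponential moment into growth of order p^{1/α}. -/
lemma rpow_le_rpow_self_mul_exp {y r : ℝ} (hy : 0 ≤ y) (hr : 0 < r) :
    y ^ r ≤ r ^ r * Real.exp y := by
  have h1 : y / r ≤ Real.exp (y / r) := by linarith [Real.add_one_le_exp (y / r)]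
  calc y ^ r = r ^ r * (y / r) ^ r := by
        rw [← Real.mul_rpow hr.le (by positivity), mul_div_cancel₀ _ hr.ne']
    _ ≤ r ^ r * Real.exp (y / r) ^ r := by gcongr
    _ = r ^ r * Real.exp y := by rw [← Real.exp_mul, div_mul_cancel₀ _ hr.ne']

/-- Moment growth of a law with finite `ψ_α`-norm. -/
lemma momGrowth_of_lintegral_exp_le {Ω : Type*} [MeasurableSpace Ω] {μ : Measure Ω}
    [IsProbabilityMeasure μ] {X : Ω → ℝ} (hX : Measurable X) {α M : ℝ} (hα : 0 < α) (hM : 0 < M)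
    (h : ∫⁻ x, ENNReal.ofReal (Real.exp ((|X x| / M) ^ α) - 1) ∂μ ≤ 1) :
    MomGrowth μ (fun x ↦ ‖X x‖ₑ) (2 * (1 / α) ^ (1 / α) * M) (1 / α) := by
  intro p hp
  have hp' : (0 : ℝ) < p := by exact_mod_cast hp
  have hr : 0 < p / α := by positivity
  have hexp : ∫⁻ x, ENNReal.ofReal (Real.exp ((|X x| / M) ^ α)) ∂μ ≤ 2 := by
    calc ∫⁻ x, ENNReal.ofReal (Real.exp ((|X x| / M) ^ α)) ∂μ
        = ∫⁻ x, (ENNReal.ofReal (Real.exp ((|X x| / M) ^ α) - 1) + 1) ∂μ := by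
          refine lintegral_congr fun x ↦ ?_
          rw [← ENNReal.ofReal_one, ← ENNReal.ofReal_add _ zero_le_one, sub_add_cancel]
          exact sub_nonneg.2 (Real.one_le_exp (by positivity))
      _ = ∫⁻ x, ENNReal.ofReal (Real.exp ((|X x| / M) ^ α) - 1) ∂μ + 1 := by
          rw [lintegral_add_right _ measurable_const]; simp
      _ ≤ 1 + 1 := by gcongr
      _ = 2 := one_add_one_eq_two
  have hpt : ∀ x, ‖X x‖ₑ ^ p ≤ ENNReal.ofReal (M ^ p * (p / α) ^ (p / α)) *
      ENNReal.ofReal (Real.exp ((|X x| / M) ^ α)) := by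
    intro x
    rw [← ENNReal.ofReal_mul (by positivity), Real.enorm_eq_ofReal_abs,
      ← ENNReal.ofReal_pow (abs_nonneg _)]
    refine ENNReal.ofReal_le_ofReal ?_
    have h1 := rpow_le_rpow_self_mul_exp (y := (|X x| / M) ^ α) (by positivity) hr
    rw [← Real.rpow_mul (by positivity), mul_div_cancel₀ _ hα.ne', Real.rpow_natCast, div_pow,
      div_le_iff₀ (by positivity)] at h1
    linarith
  calc ∫⁻ x, ‖X x‖ₑ ^ p ∂μ ≤ ∫⁻ x, ENNReal.ofReal (M ^ p * (p / α) ^ (p / α)) *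
      ENNReal.ofReal (Real.exp ((|X x| / M) ^ α)) ∂μ := lintegral_mono hpt
    _ = ENNReal.ofReal (M ^ p * (p / α) ^ (p / α)) *
        ∫⁻ x, ENNReal.ofReal (Real.exp ((|X x| / M) ^ α)) ∂μ := by
        rw [lintegral_const_mul]
        fun_prop
    _ ≤ ENNReal.ofReal (M ^ p * (p / α) ^ (p / α)) * ENNReal.ofReal (2 ^ p) := by
        gcongr
        refine hexp.trans ?_
        rw [← ENNReal.ofReal_ofNat]
        refine ENNReal.ofReal_le_ofReal ?_
        calc (2 : ℝ) = 2 ^ 1 := (pow_one _).symm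
          _ ≤ 2 ^ p := pow_le_pow_right₀ (by norm_num) hp
    _ = ENNReal.ofReal (2 * (1 / α) ^ (1 / α) * M * (p : ℝ) ^ (1 / α)) ^ p := by
        rw [← ENNReal.ofReal_mul (by positivity), ← ENNReal.ofReal_pow (by positivity)]
        congr 1
        have e : ((p : ℝ) / α) ^ (p / α) = ((1 / α) ^ (1 / α) * (p : ℝ) ^ (1 / α)) ^ p := by
          rw [← Real.mul_rpow (by positivity) hp'.le, ← Real.rpow_natCast, ← Real.rpow_mul (by positivity)]
          congr 1 <;> ring
        rw [e]
        ring

/-- Let G = (X+Y)^k - X^k, so that G ≥ k X^{k-1} Y. If kY ≤ X, then C(2k,i) ≤ 2 k^i, and trading i -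
2 factors kY for X leaves 2(k X^{k-1} Y)². If kY ≥ X, the term is at most (X+Y)^{2k}, while X^k ≤ G
forces (X+Y)^k ≤ 2G. The square on the right is why i ≥ 2 is needed. The lemma bounds the terms of
order at least two in the expansion of a moment of a + bx. -/
lemma choose_mul_pow_le (k i : ℕ) (hi : 2 ≤ i) (hik : i ≤ 2 * k) {X Y : ℝ} (hX : 0 ≤ X)
    (hY : 0 ≤ Y) :
    ((2 * k).choose i : ℝ) * (X ^ (2 * k - i) * Y ^ i) ≤ (2 * ((X + Y) ^ k - X ^ k)) ^ 2 := by
  obtain ⟨n, rfl⟩ : ∃ n, k = n + 1 := ⟨k - 1, by omega⟩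
  have hbern : X ^ (n + 1) + (n + 1 : ℕ) * X ^ n * Y ≤ (X + Y) ^ (n + 1) := by
    rw [add_comm X Y, add_pow, Finset.sum_range_succ', Finset.sum_range_succ']
    have : 0 ≤ ∑ j ∈ Finset.range n, Y ^ (j + 1 + 1) * X ^ (n + 1 - (j + 1 + 1)) *
        ((n + 1).choose (j + 1 + 1) : ℝ) := Finset.sum_nonneg fun _ _ ↦ by positivity
    simp only [zero_add, pow_one, pow_zero, Nat.sub_zero, Nat.choose_zero_right, Nat.cast_one,
      mul_one, one_mul, Nat.choose_one_right, Nat.add_sub_cancel]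
    linarith
  set G := (X + Y) ^ (n + 1) - X ^ (n + 1) with hG
  have hG1 : (n + 1 : ℕ) * X ^ n * Y ≤ G := by linarith
  rcases le_total ((n + 1 : ℕ) * Y) X with h | h
  · have hc : ((2 * (n + 1)).choose i : ℝ) ≤ 2 * ((n + 1 : ℕ) : ℝ) ^ i := by
      have h1 := Nat.choose_le_pow_div (α := ℝ) i (2 * (n + 1))
      refine h1.trans ?_
      rw [div_le_iff₀ (by positivity)]
      push_cast
      rw [mul_pow]
      have h2 : (2 : ℝ) ^ i ≤ 2 * i.factorial := by
        obtain ⟨l, rfl⟩ : ∃ l, i = l + 1 := ⟨i - 1, by omega⟩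
        have := Nat.factorial_mul_pow_le_factorial (n := l) (m := 1)
        simp only [Nat.factorial_one, one_mul] at this
        have h3 : (2 : ℝ) ^ l ≤ ((1 + l).factorial : ℝ) := by exact_mod_cast this
        rw [add_comm l 1, pow_add]
        linarith
      nlinarith [pow_nonneg (by positivity : (0 : ℝ) ≤ (n : ℝ) + 1) i]
    obtain ⟨l, rfl⟩ : ∃ l, i = l + 2 := ⟨i - 2, by omega⟩
    calc ((2 * (n + 1)).choose (l + 2) : ℝ) * (X ^ (2 * (n + 1) - (l + 2)) * Y ^ (l + 2))
        ≤ (2 * ((n + 1 : ℕ) : ℝ) ^ (l + 2)) * (X ^ (2 * (n + 1) - (l + 2)) * Y ^ (l + 2)) := by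
          gcongr
      _ = 2 * ((n + 1 : ℕ) * Y) ^ 2 * (((n + 1 : ℕ) * Y) ^ l * X ^ (2 * n - l)) := by
          rw [show 2 * (n + 1) - (l + 2) = 2 * n - l by omega]; ring
      _ ≤ 2 * ((n + 1 : ℕ) * Y) ^ 2 * (X ^ l * X ^ (2 * n - l)) := by gcongr
      _ = 2 * ((n + 1 : ℕ) * X ^ n * Y) ^ 2 := by
          rw [← pow_add, show l + (2 * n - l) = 2 * n by omega]; ring
      _ ≤ 2 * G ^ 2 := by gcongr
      _ ≤ (2 * G) ^ 2 := by nlinarith [sq_nonneg G]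
  · have h1 : ((2 * (n + 1)).choose i : ℝ) * (X ^ (2 * (n + 1) - i) * Y ^ i) ≤
        ((X + Y) ^ (n + 1)) ^ 2 := by
      rw [← pow_mul, mul_comm (n + 1) 2, add_comm X Y, add_pow]
      refine le_trans (le_of_eq (by ring)) (Finset.single_le_sum (f := fun j ↦ Y ^ j *
        X ^ (2 * (n + 1) - j) * ((2 * (n + 1)).choose j : ℝ)) (fun _ _ ↦ by positivity)
        (Finset.mem_range.2 (Nat.lt_succ_of_le hik)))
    have h2 : X ^ (n + 1) ≤ G := by
      refine le_trans ?_ hG1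
      calc X ^ (n + 1) = X ^ n * X := pow_succ _ _
        _ ≤ X ^ n * ((n + 1 : ℕ) * Y) := by gcongr
        _ = _ := by ring
    refine h1.trans (pow_le_pow_left₀ (by positivity) ?_ 2)
    linarith

lemma choose_le_exp_pow {n i : ℕ} (hi : 1 ≤ i) :
    (n.choose i : ℝ) ≤ (Real.exp 1 * n / i) ^ i := by
  refine (Nat.choose_le_pow_div i n).trans ?_
  have h1 := Real.pow_div_factorial_le_exp (i : ℝ) (by positivity) i
  have hi' : (0 : ℝ) < i := by exact_mod_cast hi
  rw [div_le_iff₀ (by positivity)] at h1 ⊢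
  rw [div_pow, mul_pow, ← Real.exp_nat_mul, mul_one]
  rw [div_mul_eq_mul_div, le_div_iff₀ (by positivity)]
  calc (n : ℝ) ^ i * (i : ℝ) ^ i ≤ (n : ℝ) ^ i * (Real.exp i * i.factorial) := by gcongr
    _ = _ := by ring

lemma lintegral_enorm_pow_lt_top {Ω : Type*} [MeasurableSpace Ω] {μ : Measure Ω}
    [IsProbabilityMeasure μ] {X : Ω → ℝ} {A s : ℝ} (h : MomGrowth μ (fun x ↦ ‖X x‖ₑ) A s) (p : ℕ) :
    ∫⁻ x, ‖X x‖ₑ ^ p ∂μ < ∞ :=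
  (h.lintegral_pow_le p).trans_lt (ENNReal.pow_lt_top ENNReal.ofReal_lt_top)

lemma integrable_pow_of_momGrowth {Ω : Type*} [MeasurableSpace Ω] {μ : Measure Ω}
    [IsProbabilityMeasure μ] {X : Ω → ℝ} (hX : Measurable X) {A s : ℝ}
    (h : MomGrowth μ (fun x ↦ ‖X x‖ₑ) A s) (p : ℕ) : Integrable (fun x ↦ X x ^ p) μ := by
  refine ⟨(hX.pow_const p).aestronglyMeasurable, ?_⟩
  have := lintegral_enorm_pow_lt_top h p
  simpa only [HasFiniteIntegral, enorm_pow] using this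

lemma abs_integral_pow_le_of_momGrowth {Ω : Type*} [MeasurableSpace Ω] {μ : Measure Ω}
    {X : Ω → ℝ} {A s : ℝ} (hA : 0 ≤ A)
    (h : MomGrowth μ (fun x ↦ ‖X x‖ₑ) A s) {p : ℕ} (hp : 1 ≤ p) :
    |∫ x, X x ^ p ∂μ| ≤ (A * (p : ℝ) ^ s) ^ p := by
  have h1 := enorm_integral_le_lintegral_enorm (μ := μ) fun x ↦ X x ^ p
  simp only [enorm_pow] at h1
  have h2 := h1.trans (h p hp)
  rw [← ENNReal.ofReal_pow (by positivity), Real.enorm_eq_ofReal_abs,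
    ENNReal.ofReal_le_ofReal_iff (by positivity)] at h2
  exact h2

lemma sum_two_mul_half_pow_le (n : ℕ) :
    ∑ i ∈ Finset.range n, 2 * (1 / 2 : ℝ) ^ (i + 2) ≤ 1 := by
  have h := sum_geometric_two_le n
  calc ∑ i ∈ Finset.range n, 2 * (1 / 2 : ℝ) ^ (i + 2) =
      1 / 2 * ∑ i ∈ Finset.range n, (1 / 2 : ℝ) ^ i := by
        rw [Finset.mul_sum]
        exact Finset.sum_congr rfl fun i _ ↦ by ring
    _ ≤ 1 := by linarith

/-- The two-point hypercontractive inequality for centered variables with sub-Weibull moments. -/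
lemma lintegral_add_mul_pow_le {μ : Measure ℝ} [IsProbabilityMeasure μ] {A s : ℝ} (hA : 0 ≤ A)
    (hs : 1 / 2 ≤ s) (h : MomGrowth μ (fun x ↦ ‖x‖ₑ) A s) (h0 : ∫ x, x ∂μ = 0) {k : ℕ}
    (a b : ℝ) :
    ∫⁻ x, ‖a + b * x‖ₑ ^ (2 * k) ∂μ ≤
      ENNReal.ofReal (a ^ 2 + (4 * A * (2 * k : ℕ) ^ s) ^ 2 * b ^ 2) ^ k := by
  set c : ℝ := 4 * A * (2 * k : ℕ) ^ s with hc
  have hc0 : 0 ≤ c := by positivity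
  have hint : ∀ i : ℕ, Integrable (fun x : ℝ ↦ x ^ i) μ :=
    integrable_pow_of_momGrowth measurable_id h
  have hexpand : ∀ x : ℝ, (a + b * x) ^ (2 * k) = ∑ i ∈ Finset.range (2 * k + 1),
      ((2 * k).choose i * a ^ (2 * k - i) * b ^ i) * x ^ i := by
    intro x
    rw [add_comm, add_pow]
    exact Finset.sum_congr rfl fun i _ ↦ by ring
  have hI : Integrable (fun x ↦ (a + b * x) ^ (2 * k)) μ := by
    simp only [hexpand]
    exact integrable_finsetSum _ fun i _ ↦ (hint i).const_mul _
  have hIe : ∫ x, (a + b * x) ^ (2 * k) ∂μ = ∑ i ∈ Finset.range (2 * k + 1),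
      ((2 * k).choose i * a ^ (2 * k - i) * b ^ i) * ∫ x, x ^ i ∂μ := by
    simp only [hexpand]
    rw [integral_finsetSum _ fun i _ ↦ (hint i).const_mul _]
    exact Finset.sum_congr rfl fun i _ ↦ integral_const_mul _ _
  have hmain : ∫ x, (a + b * x) ^ (2 * k) ∂μ ≤ (a ^ 2 + c ^ 2 * b ^ 2) ^ k := by
    rw [hIe]
    rcases Nat.eq_zero_or_pos k with rfl | hk
    · simp
    set G := (a ^ 2 + c ^ 2 * b ^ 2) ^ k - (a ^ 2) ^ k with hG
    have hG0 : 0 ≤ G := sub_nonneg.2 (pow_le_pow_left₀ (by positivity) (by nlinarith [mul_nonneg (sq_nonneg c) (sq_nonneg b)]) k)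
    -- The square of the i-th term contains the binomial coefficient twice. One copy goes to
    -- `choose_mul_pow_le` with X = a² and Y = c²b², the other is absorbed by the squared moment.
    -- The remaining factor 4^{-i} makes the terms summable.
    have hterm : ∀ i, 2 ≤ i → i ≤ 2 * k →
        ((2 * k).choose i * a ^ (2 * k - i) * b ^ i) * ∫ x, x ^ i ∂μ ≤
          G * (2 * (1 / 2) ^ i) := by
      intro i hi hik
      refine abs_le_of_sq_le_sq' ?_ (by positivity) |>.2
      have hi' : (0 : ℝ) < i := by positivity
      have hm := abs_integral_pow_le_of_momGrowth hA h (p := i) (by omega)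
      have hm2 : ((2 * k).choose i : ℝ) * (∫ x, x ^ i ∂μ) ^ 2 ≤ (c ^ 2 / 4) ^ i := by
        have h1 : (∫ x, x ^ i ∂μ) ^ 2 ≤ ((A * (i : ℝ) ^ s) ^ 2) ^ i := by
          rw [← sq_abs, ← pow_mul, mul_comm 2 i, pow_mul]
          gcongr
        -- This is where s ≥ 1/2 enters: 2k/i ≥ 1 may be replaced by (2k/i)^{2s}, which cancels
        -- i^{2s}. The 4 in c supplies c²/4 = 4A²(2k)^{2s}, and e ≤ 4.
        have h2 : Real.exp 1 * (2 * k : ℕ) / i * (A * (i : ℝ) ^ s) ^ 2 ≤ c ^ 2 / 4 := by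
          have he : Real.exp 1 ≤ 4 := by linarith [Real.exp_one_lt_d9]
          have h3 : ((2 * k : ℕ) : ℝ) / i * (i : ℝ) ^ (2 * s) ≤ ((2 * k : ℕ) : ℝ) ^ (2 * s) := by
            have e : ((2 * k : ℕ) : ℝ) / i ≤ (((2 * k : ℕ) : ℝ) / i) ^ (2 * s) := by
              refine Real.self_le_rpow_of_one_le ?_ (by linarith)
              rw [le_div_iff₀ hi', one_mul]
              exact_mod_cast hik
            calc ((2 * k : ℕ) : ℝ) / i * (i : ℝ) ^ (2 * s)
                ≤ (((2 * k : ℕ) : ℝ) / i) ^ (2 * s) * (i : ℝ) ^ (2 * s) := by gcongr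
              _ = _ := by
                rw [← Real.mul_rpow (by positivity) hi'.le, div_mul_cancel₀ _ hi'.ne']
          have e1 : ((i : ℝ) ^ s) ^ 2 = (i : ℝ) ^ (2 * s) := by
            rw [mul_comm 2 s, Real.rpow_mul (by positivity), Real.rpow_ofNat]
          have e2 : (((2 * k : ℕ) : ℝ) ^ s) ^ 2 = ((2 * k : ℕ) : ℝ) ^ (2 * s) := by
            rw [mul_comm 2 s, Real.rpow_mul (by positivity), Real.rpow_ofNat]
          calc Real.exp 1 * (2 * k : ℕ) / i * (A * (i : ℝ) ^ s) ^ 2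
              = Real.exp 1 * A ^ 2 * (((2 * k : ℕ) : ℝ) / i * (i : ℝ) ^ (2 * s)) := by
                rw [mul_pow, e1]; ring
            _ ≤ 4 * A ^ 2 * ((2 * k : ℕ) : ℝ) ^ (2 * s) := by gcongr
            _ = c ^ 2 / 4 := by rw [hc, mul_pow, e2]; ring
        calc ((2 * k).choose i : ℝ) * (∫ x, x ^ i ∂μ) ^ 2
            ≤ (Real.exp 1 * (2 * k : ℕ) / i) ^ i * ((A * (i : ℝ) ^ s) ^ 2) ^ i := by
              gcongr
              exact choose_le_exp_pow (by omega)
          _ = (Real.exp 1 * (2 * k : ℕ) / i * (A * (i : ℝ) ^ s) ^ 2) ^ i := (mul_pow _ _ _).symm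
          _ ≤ _ := by gcongr
      have hch := choose_mul_pow_le k i hi hik (sq_nonneg a)
        (by positivity : 0 ≤ c ^ 2 * b ^ 2)
      rw [← hG] at hch
      calc (((2 * k).choose i * a ^ (2 * k - i) * b ^ i) * ∫ x, x ^ i ∂μ) ^ 2
          = ((2 * k).choose i : ℝ) * (a ^ 2) ^ (2 * k - i) * (b ^ 2) ^ i *
            (((2 * k).choose i : ℝ) * (∫ x, x ^ i ∂μ) ^ 2) := by ring
        _ ≤ ((2 * k).choose i : ℝ) * (a ^ 2) ^ (2 * k - i) * (b ^ 2) ^ i * (c ^ 2 / 4) ^ i := by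
            gcongr
        _ = ((2 * k).choose i * ((a ^ 2) ^ (2 * k - i) * (c ^ 2 * b ^ 2) ^ i)) * (1 / 4) ^ i := by
            rw [div_eq_mul_one_div, mul_pow, mul_pow (c ^ 2)]; ring
        _ ≤ (2 * G) ^ 2 * (1 / 4) ^ i := by gcongr
        _ = (G * (2 * (1 / 2) ^ i)) ^ 2 := by
            rw [show (1 / 4 : ℝ) = (1 / 2) ^ 2 by norm_num, ← pow_mul]; ring
    -- The terms i = 0 and i = 1 are split off: the first is a^{2k}, the second vanishes by
    -- centering.
    obtain ⟨l, hl⟩ : ∃ l, 2 * k + 1 = l + 2 := ⟨2 * k - 1, by omega⟩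
    rw [hl, Finset.sum_range_succ', Finset.sum_range_succ']
    simp only [zero_add, pow_one, h0, mul_zero, add_zero, pow_zero, integral_const, probReal_univ,
      smul_eq_mul, mul_one, Nat.choose_zero_right, Nat.cast_one, one_mul, Nat.sub_zero]
    have hsum : ∑ i ∈ Finset.range l, ((2 * k).choose (i + 1 + 1) * a ^ (2 * k - (i + 1 + 1)) *
        b ^ (i + 1 + 1)) * ∫ x, x ^ (i + 1 + 1) ∂μ ≤ G := by
      calc _ ≤ ∑ i ∈ Finset.range l, G * (2 * (1 / 2) ^ (i + 2)) := by
            refine Finset.sum_le_sum fun i hi ↦ hterm (i + 2) (by omega) ?_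
            have := Finset.mem_range.1 hi
            omega
        _ = G * ∑ i ∈ Finset.range l, 2 * (1 / 2) ^ (i + 2) := by rw [Finset.mul_sum]
        _ ≤ G * 1 := by gcongr; exact sum_two_mul_half_pow_le l
        _ = G := mul_one G
    rw [pow_mul a 2 k]
    linarith
  rw [← ENNReal.ofReal_pow (by positivity)]
  have hconv : ∫⁻ x, ‖a + b * x‖ₑ ^ (2 * k) ∂μ = ENNReal.ofReal (∫ x, (a + b * x) ^ (2 * k) ∂μ) := by
    rw [ofReal_integral_eq_lintegral_ofReal hI
      (Filter.Eventually.of_forall fun x ↦ (even_two_mul k).pow_nonneg _)]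
    refine lintegral_congr fun x ↦ ?_
    rw [Real.enorm_eq_ofReal_abs, ← ENNReal.ofReal_pow (abs_nonneg _),
      (even_two_mul k).pow_abs]
  rw [hconv]
  exact ENNReal.ofReal_le_ofReal hmain

/-! ### Multilinear polynomials on product measures -/

/-- The multilinear polynomial `∑_{S ⊆ s} a_S ∏_{i ∈ S} x_i`. -/
def multilin {ι : Type*} (s : Finset ι) (a : Finset ι → ℝ) (x : ι → ℝ) : ℝ :=
  ∑ S ∈ s.powerset, a S * ∏ i ∈ S, x i

lemma measurable_multilin {ι : Type*} (s : Finset ι) (a : Finset ι → ℝ) : Measurable (multilin s a) := by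
  unfold multilin
  fun_prop

lemma multilin_insert {ι : Type*} [DecidableEq ι] {s : Finset ι} {i : ι} (hi : i ∉ s) (a : Finset ι → ℝ) (x : ι → ℝ) :
    multilin (insert i s) a x =
      multilin s a x + x i * multilin s (fun S ↦ a (insert i S)) x := by
  unfold multilin
  rw [Finset.sum_powerset_insert hi, Finset.mul_sum]
  congr 1
  refine Finset.sum_congr rfl fun S hS ↦ ?_
  rw [Finset.prod_insert fun h ↦ hi (Finset.mem_powerset.1 hS h)]
  ring

lemma multilin_update {ι : Type*} [DecidableEq ι] {s : Finset ι} {i : ι} (hi : i ∉ s)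
    (a : Finset ι → ℝ) (x : ι → ℝ) (t : ℝ) :
    multilin s a (Function.update x i t) = multilin s a x := by
  unfold multilin
  refine Finset.sum_congr rfl fun S hS ↦ ?_
  congr 1
  refine Finset.prod_congr rfl fun j hj ↦ ?_
  rw [Function.update_of_ne]
  rintro rfl
  exact hi (Finset.mem_powerset.1 hS hj)

lemma measurable_update_prod {ι : Type*} [DecidableEq ι] (i : ι) :
    Measurable fun z : (ι → ℝ) × ℝ ↦ Function.update z.1 i z.2 := by
  refine measurable_pi_iff.2 fun j ↦ ?_
  rcases eq_or_ne j i with rfl | hj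
  · simpa using measurable_snd
  · simp only [Function.update_of_ne hj]
    fun_prop

section Pi

variable {ι : Type*} [Fintype ι] [DecidableEq ι]

/-- Replacing one coordinate of a product measure. -/
lemma map_update_prod (μ : ι → Measure ℝ) [∀ i, IsProbabilityMeasure (μ i)] (i : ι)
    (ν : Measure ℝ) [IsProbabilityMeasure ν] :
    ((Measure.pi μ).prod ν).map (fun z : (ι → ℝ) × ℝ ↦ Function.update z.1 i z.2) =
      Measure.pi (Function.update μ i ν) := by
  have hprob : ∀ j, IsProbabilityMeasure (Function.update μ i ν j) := by
    intro j
    rcases eq_or_ne j i with rfl | hj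
    · simpa
    · simpa [hj] using inferInstanceAs (IsProbabilityMeasure (μ j))
  symm
  apply Measure.pi_eq
  intro s hs
  rw [Measure.map_apply (measurable_update_prod i) (MeasurableSet.univ_pi hs)]
  have e : (fun z : (ι → ℝ) × ℝ ↦ Function.update z.1 i z.2) ⁻¹' Set.univ.pi s =
      (Set.univ.pi (Function.update s i Set.univ)) ×ˢ s i := by
    ext z
    simp only [Set.mem_preimage, Set.mem_univ_pi, Set.mem_prod]
    constructor
    · intro h
      refine ⟨fun j ↦ ?_, by simpa using h i⟩
      rcases eq_or_ne j i with rfl | hj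
      · simp
      · simpa [hj] using h j
    · rintro ⟨h1, h2⟩ j
      rcases eq_or_ne j i with rfl | hj
      · simpa
      · simpa [hj] using h1 j
  rw [e, Measure.prod_prod, Measure.pi_pi, ← Finset.mul_prod_erase _ _ (Finset.mem_univ i),
    ← Finset.mul_prod_erase _ (fun j ↦ Function.update μ i ν j (s j)) (Finset.mem_univ i)]
  simp only [Function.update_self, measure_univ, one_mul]
  rw [mul_comm]
  congr 1
  refine Finset.prod_congr rfl fun j hj ↦ ?_
  rw [Function.update_of_ne (Finset.ne_of_mem_erase hj),
    Function.update_of_ne (Finset.ne_of_mem_erase hj)]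

lemma lintegral_pi_update (μ : ι → Measure ℝ) [∀ i, IsProbabilityMeasure (μ i)] (i : ι)
    (ν : Measure ℝ) [IsProbabilityMeasure ν] {F : (ι → ℝ) → ℝ≥0∞} (hF : Measurable F) :
    ∫⁻ x, F x ∂(Measure.pi (Function.update μ i ν)) =
      ∫⁻ x, ∫⁻ t, F (Function.update x i t) ∂ν ∂(Measure.pi μ) := by
  rw [← map_update_prod μ i ν, lintegral_map hF (measurable_update_prod i)]
  exact lintegral_prod _ (hF.comp (measurable_update_prod i)).aemeasurable

lemma lintegral_pi_eq_lintegral_update (μ : ι → Measure ℝ) [∀ i, IsProbabilityMeasure (μ i)] (i : ι)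
    {F : (ι → ℝ) → ℝ≥0∞} (hF : Measurable F) :
    ∫⁻ x, F x ∂(Measure.pi μ) =
      ∫⁻ x, ∫⁻ t, F (Function.update x i t) ∂(μ i) ∂(Measure.pi μ) := by
  conv_lhs => rw [← Function.update_eq_self i μ]
  exact lintegral_pi_update μ i (μ i) hF

/-- Hypercontractivity for multilinear polynomials in independent variables. -/
lemma lintegral_multilin_pow_le (μ : ι → Measure ℝ) [∀ i, IsProbabilityMeasure (μ i)] {c : ℝ}
    {k : ℕ} (hk : 1 ≤ k)
    (h : ∀ i, ∀ a b : ℝ, ∫⁻ x, ‖a + b * x‖ₑ ^ (2 * k) ∂(μ i) ≤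
      ENNReal.ofReal (a ^ 2 + c ^ 2 * b ^ 2) ^ k) (s : Finset ι) :
    ∀ a : Finset ι → ℝ, ∫⁻ x, ‖multilin s a x‖ₑ ^ (2 * k) ∂(Measure.pi μ) ≤
      ENNReal.ofReal (∑ S ∈ s.powerset, (c ^ 2) ^ S.card * a S ^ 2) ^ k := by
  have hsq : ∀ r : ℝ, ENNReal.ofReal (r ^ 2) ^ k = ‖r‖ₑ ^ (2 * k) := by
    intro r
    rw [pow_mul, Real.enorm_eq_ofReal_abs, ← ENNReal.ofReal_pow (abs_nonneg _), sq_abs]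
  induction s using Finset.induction_on with
  | empty =>
    intro a
    simp [multilin, hsq]
  | insert i s hi ih =>
    intro a
    rw [lintegral_pi_eq_lintegral_update μ i ((measurable_multilin _ _).enorm.pow_const _)]
    set B : Finset ι → ℝ := fun S ↦ a (insert i S)
    have h1 : ∀ x : ι → ℝ, ∫⁻ t, ‖multilin (insert i s) a (Function.update x i t)‖ₑ ^ (2 * k) ∂(μ i) ≤
        (ENNReal.ofReal (multilin s a x ^ 2) + ENNReal.ofReal (c ^ 2 * multilin s B x ^ 2)) ^ k := by
      intro x
      rw [← ENNReal.ofReal_add (by positivity) (by positivity)]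
      refine le_trans (le_of_eq ?_) (h i (multilin s a x) (multilin s B x))
      refine lintegral_congr fun t ↦ ?_
      rw [multilin_insert hi, multilin_update hi, multilin_update hi, Function.update_self, mul_comm]
    have h2 : ∫⁻ x, ENNReal.ofReal (c ^ 2 * multilin s B x ^ 2) ^ k ∂(Measure.pi μ) ≤
        ENNReal.ofReal (c ^ 2 * ∑ S ∈ s.powerset, (c ^ 2) ^ S.card * B S ^ 2) ^ k := by
      simp only [ENNReal.ofReal_mul (sq_nonneg c), mul_pow _ _ k, hsq]
      rw [lintegral_const_mul _ ((measurable_multilin _ _).enorm.pow_const _)]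
      gcongr
      exact ih B
    have h3 : ∫⁻ x, ENNReal.ofReal (multilin s a x ^ 2) ^ k ∂(Measure.pi μ) ≤
        ENNReal.ofReal (∑ S ∈ s.powerset, (c ^ 2) ^ S.card * a S ^ 2) ^ k := by
      simp only [hsq]
      exact ih a
    -- The polynomial is P + x_i Q with P and Q free of x_i. The one-variable inequality with the
    -- other coordinates frozen leaves the k-th moment of P² + c²Q², and Minkowski's inequality in
    -- L^k separates the two for the induction.
    refine (lintegral_mono h1).trans ((lintegral_add_pow_le ?_ ?_ hk h3 h2).trans_eq ?_)
    · exact ((measurable_multilin _ _).pow_const 2).ennreal_ofReal.aemeasurable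
    · exact (((measurable_multilin _ _).pow_const 2).const_mul _).ennreal_ofReal.aemeasurable
    · have hn : ∀ D : Finset ι → ℝ, 0 ≤ ∑ S ∈ s.powerset, (c ^ 2) ^ S.card * D S ^ 2 :=
        fun D ↦ Finset.sum_nonneg fun _ _ ↦ by positivity
      rw [← ENNReal.ofReal_add (hn a) (mul_nonneg (sq_nonneg c) (hn B))]
      congr 2
      rw [Finset.sum_powerset_insert hi, Finset.mul_sum]
      congr 1
      refine Finset.sum_congr rfl fun S hS ↦ ?_
      rw [Finset.card_insert_of_notMem fun h ↦ hi (Finset.mem_powerset.1 hS h)]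
      ring

/-- Moment growth of homogeneous multilinear polynomials in independent centered variables. -/
lemma momGrowth_multilin (μ : ι → Measure ℝ) [∀ i, IsProbabilityMeasure (μ i)] {A s : ℝ}
    (hA : 0 ≤ A) (hs : 1 / 2 ≤ s) (h : ∀ i, MomGrowth (μ i) (fun x ↦ ‖x‖ₑ) A s)
    (h0 : ∀ i, ∫ x, x ∂(μ i) = 0) (T : Finset ι) (a : Finset ι → ℝ) (n : ℕ)
    (ha : ∀ S ∈ T.powerset, a S ≠ 0 → S.card = n) :
    MomGrowth (Measure.pi μ) (fun x ↦ ‖multilin T a x‖ₑ)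
      ((4 * A * 2 ^ s) ^ n * √(∑ S ∈ T.powerset, a S ^ 2)) (n * s) := by
  intro p hp
  -- Hypercontractivity is available only for even exponents, so the p-th moment is bounded through
  -- the 2p-th. This costs the factor 2^s in the constant.
  refine lintegral_pow_le_of_le (measurable_multilin _ _).enorm.aemeasurable hp
    (by omega : p ≤ 2 * p) ?_
  refine (lintegral_multilin_pow_le μ hp (fun i ↦
    lintegral_add_mul_pow_le hA hs (h i) (h0 i)) T a).trans_eq ?_
  rw [pow_mul, ← ENNReal.ofReal_pow (n := 2) (by positivity)]
  congr 2
  rw [mul_pow (_ * √_) _ 2, mul_pow _ (√_) 2,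
    Real.sq_sqrt (Finset.sum_nonneg fun _ _ ↦ sq_nonneg _)]
  have e : ((p : ℝ) ^ (n * s)) = ((p : ℝ) ^ s) ^ n := by
    rw [mul_comm, Real.rpow_mul (by positivity), Real.rpow_natCast]
  rw [e, Finset.mul_sum, Finset.sum_mul]
  refine Finset.sum_congr rfl fun S hS ↦ ?_
  by_cases hS0 : a S = 0
  · simp [hS0]
  · rw [ha S hS hS0]
    push_cast
    rw [Real.mul_rpow (by norm_num) (by positivity)]
    generalize (4 : ℝ) = z
    ring

end Pi

/-! ### Homogeneous sums as multilinear polynomials -/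

section Coeff

variable {N q : ℕ}

/-- The coefficient of `∏_{i ∈ S} x_i` in `Q(f; x)`. -/
def homCoeff (f : (Fin q → Fin N) → ℝ) (S : Finset (Fin N)) : ℝ :=
  ∑ j : Fin q → Fin N with Finset.univ.image j = S, f j

lemma card_of_homCoeff_ne_zero {f : (Fin q → Fin N) → ℝ} (hf : VanishesOnDiagonals f)
    {S : Finset (Fin N)} (h : homCoeff f S ≠ 0) : S.card = q := by
  obtain ⟨j, hj, hfj⟩ := Finset.exists_ne_zero_of_sum_ne_zero h
  have hinj : Function.Injective j := by
    by_contra hn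
    exact hfj (hf j hn)
  rw [← (Finset.mem_filter.1 hj).2, Finset.card_image_of_injective _ hinj, Finset.card_univ,
    Fintype.card_fin]

lemma homSum_eq_multilin {f : (Fin q → Fin N) → ℝ} (hf : VanishesOnDiagonals f) (x : Fin N → ℝ) :
    homSum f x = multilin Finset.univ (homCoeff f) x := by
  unfold homSum multilin homCoeff
  rw [Finset.powerset_univ, ← Finset.sum_fiberwise _ fun j : Fin q → Fin N ↦ Finset.univ.image j]
  refine Finset.sum_congr rfl fun S _ ↦ ?_
  rw [Finset.sum_mul]
  refine Finset.sum_congr rfl fun j hj ↦ ?_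
  by_cases hinj : Function.Injective j
  · rw [← (Finset.mem_filter.1 hj).2, Finset.prod_image fun a _ b _ h ↦ hinj h]
  · simp [hf j hinj]

lemma homSum_update {f : (Fin q → Fin N) → ℝ} (hf : VanishesOnDiagonals f) (x : Fin N → ℝ)
    (i : Fin N) (t : ℝ) :
    homSum f (Function.update x i t) = multilin (Finset.univ.erase i) (homCoeff f) x +
      t * multilin (Finset.univ.erase i) (fun S ↦ homCoeff f (insert i S)) x := by
  have hi : i ∉ Finset.univ.erase i := by simp
  rw [homSum_eq_multilin hf, ← Finset.insert_erase (Finset.mem_univ i), multilin_insert (by simp),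
    Finset.erase_insert_eq_erase, Finset.erase_idem]
  rw [multilin_update hi, multilin_update hi, Function.update_self]

/-- Cauchy–Schwarz over the tuples with image S. A nonzero coefficient forces S to have q elements,
so there are at most q^q such tuples. -/
lemma sq_homCoeff_le {f : (Fin q → Fin N) → ℝ} (hf : VanishesOnDiagonals f) (S : Finset (Fin N)) :
    homCoeff f S ^ 2 ≤ (q : ℝ) ^ q * ∑ j : Fin q → Fin N with Finset.univ.image j = S, f j ^ 2 := by
  by_cases h : homCoeff f S = 0
  · rw [h]
    simp only [ne_eq, OfNat.ofNat_ne_zero, not_false_eq_true, zero_pow]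
    exact mul_nonneg (by positivity) (Finset.sum_nonneg fun _ _ ↦ sq_nonneg _)
  · refine (sq_sum_le_card_mul_sum_sq).trans ?_
    refine mul_le_mul_of_nonneg_right ?_ (Finset.sum_nonneg fun _ _ ↦ sq_nonneg _)
    have h1 : (Finset.univ.filter fun j : Fin q → Fin N ↦ Finset.univ.image j = S) ⊆
        Fintype.piFinset fun _ ↦ S := by
      intro j hj
      rw [Fintype.mem_piFinset]
      intro l
      rw [← (Finset.mem_filter.1 hj).2]
      exact Finset.mem_image_of_mem j (Finset.mem_univ l)
    have h2 := Finset.card_le_card h1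
    rw [Fintype.card_piFinset_const, card_of_homCoeff_ne_zero hf h] at h2
    exact_mod_cast h2

lemma influence_nonneg (f : (Fin q → Fin N) → ℝ) (i : Fin N) : 0 ≤ influence f i :=
  Finset.sum_nonneg fun _ _ ↦ sq_nonneg _

/-- Symmetry: swapping slots 0 and l is a bijection of tuples that preserves f. -/
lemma sum_sq_eq_influence {f : (Fin q → Fin N) → ℝ} (hs : IsSymm f) (i : Fin N) (l : Fin q) :
    ∑ j : Fin q → Fin N with j l = i, f j ^ 2 = influence f i := by
  classical
  have hq : 0 < q := l.pos
  set z : Fin q := ⟨0, hq⟩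
  have hinf : influence f i = ∑ j : Fin q → Fin N with j z = i, f j ^ 2 := by
    unfold influence
    rw [Finset.sum_filter, Finset.sum_filter]
    refine Finset.sum_congr rfl fun j _ ↦ ?_
    have : (∀ l : Fin q, l.val = 0 → j l = i) ↔ j z = i :=
      ⟨fun h ↦ h z rfl, fun h l hl ↦ by rwa [show l = z from Fin.ext hl]⟩
    simp only [this]
  rw [hinf]
  refine Finset.sum_equiv (Equiv.arrowCongr (Equiv.swap z l) (Equiv.refl _)) ?_ ?_
  · intro j
    simp [Equiv.arrowCongr]
  · intro j _
    have := hs (Equiv.swap z l) j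
    simp only [Equiv.arrowCongr, Equiv.coe_fn_mk, Equiv.coe_refl, Equiv.symm_swap, Function.id_comp]
    rw [this]

/-- Removing i from the image sorts the tuples that hit i into disjoint fibres, one for each S. A
tuple hits i in one of q slots, and each slot contributes one influence. This explains the extra
factor q. -/
lemma sum_sq_homCoeff_insert_le {f : (Fin q → Fin N) → ℝ} (hs : IsSymm f)
    (hf : VanishesOnDiagonals f) (i : Fin N) :
    ∑ S ∈ (Finset.univ.erase i).powerset, homCoeff f (insert i S) ^ 2 ≤
      (q : ℝ) ^ (q + 1) * influence f i := by
  have h1 : ∑ S ∈ (Finset.univ.erase i).powerset, homCoeff f (insert i S) ^ 2 ≤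
      (q : ℝ) ^ q * ∑ S ∈ (Finset.univ.erase i).powerset,
        ∑ j : Fin q → Fin N with Finset.univ.image j = insert i S, f j ^ 2 := by
    rw [Finset.mul_sum]
    exact Finset.sum_le_sum fun S _ ↦ sq_homCoeff_le hf _
  have h2 : ∑ S ∈ (Finset.univ.erase i).powerset,
        ∑ j : Fin q → Fin N with Finset.univ.image j = insert i S, f j ^ 2 =
      ∑ j : Fin q → Fin N with ∃ l, j l = i, f j ^ 2 := by
    rw [← Finset.sum_fiberwise_of_maps_to (s := Finset.univ.filter fun j : Fin q → Fin N ↦ ∃ l, j l = i)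
      (t := (Finset.univ.erase i).powerset) (g := fun j ↦ (Finset.univ.image j).erase i)]
    · refine Finset.sum_congr rfl fun S hS ↦ ?_
      have hiS : i ∉ S := fun h ↦ by simpa using Finset.mem_powerset.1 hS h
      refine Finset.sum_congr ?_ fun _ _ ↦ rfl
      ext j
      simp only [Finset.mem_filter, Finset.mem_univ, true_and]
      constructor
      · intro h
        refine ⟨?_, by rw [h, Finset.erase_insert hiS]⟩
        have : i ∈ Finset.univ.image j := by rw [h]; exact Finset.mem_insert_self _ _
        simpa using this
      · rintro ⟨⟨l, hl⟩, h⟩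
        rw [← h, Finset.insert_erase]
        rw [← hl]
        exact Finset.mem_image_of_mem j (Finset.mem_univ l)
    · intro j _
      exact Finset.mem_powerset.2 (Finset.erase_subset_erase _ (Finset.subset_univ _))
  have h3 : ∑ j : Fin q → Fin N with ∃ l, j l = i, f j ^ 2 ≤ q * influence f i := by
    calc ∑ j : Fin q → Fin N with ∃ l, j l = i, f j ^ 2
        ≤ ∑ j : Fin q → Fin N, ∑ l : Fin q, if j l = i then f j ^ 2 else 0 := by
          rw [Finset.sum_filter]
          refine Finset.sum_le_sum fun j _ ↦ ?_
          split_ifs with h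
          · obtain ⟨l, hl⟩ := h
            refine le_trans (by rw [if_pos hl]) (Finset.single_le_sum
              (f := fun l ↦ if j l = i then f j ^ 2 else 0) (fun l _ ↦ ?_) (Finset.mem_univ l))
            split_ifs <;> positivity
          · refine Finset.sum_nonneg fun l _ ↦ ?_
            split_ifs <;> positivity
      _ = ∑ l : Fin q, influence f i := by
          rw [Finset.sum_comm]
          refine Finset.sum_congr rfl fun l _ ↦ ?_
          rw [← Finset.sum_filter, sum_sq_eq_influence hs]
      _ = q * influence f i := by simp
  rw [h2] at h1
  refine h1.trans ?_
  calc (q : ℝ) ^ q * ∑ j : Fin q → Fin N with ∃ l, j l = i, f j ^ 2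
      ≤ (q : ℝ) ^ q * (q * influence f i) := by gcongr
    _ = _ := by ring

/-- The partial derivative of `Q(f; x)` in the direction of the `i`-th variable. -/
def homDeriv (f : (Fin q → Fin N) → ℝ) (i : Fin N) (x : Fin N → ℝ) : ℝ :=
  multilin (Finset.univ.erase i) (fun S ↦ homCoeff f (insert i S)) x

/-- The part of `Q(f; x)` that does not involve the `i`-th variable. -/
def homRest (f : (Fin q → Fin N) → ℝ) (i : Fin N) (x : Fin N → ℝ) : ℝ :=
  multilin (Finset.univ.erase i) (homCoeff f) x

/-- The partial derivative is homogeneous of degree q - 1. Numerical constants are enlarged from q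
to the common degree r, which is legitimate because L ≥ 1. M may be small, so its power M^{q-1} is
kept exact. -/
lemma momGrowth_homDeriv (μ : Fin N → Measure ℝ) [∀ i, IsProbabilityMeasure (μ i)] {L M s : ℝ}
    (hL : 1 ≤ L) (hM : 0 ≤ M) (hs : 1 / 2 ≤ s)
    (h : ∀ i, MomGrowth (μ i) (fun x ↦ ‖x‖ₑ) (L * M) s)
    (h0 : ∀ i, ∫ x, x ∂(μ i) = 0) {f : (Fin q → Fin N) → ℝ} (hsy : IsSymm f)
    (hf : VanishesOnDiagonals f) (hq : 1 ≤ q) {r : ℕ} (hqr : q ≤ r) (i : Fin N) :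
    MomGrowth (Measure.pi μ) (fun x ↦ ‖homDeriv f i x‖ₑ)
      ((4 * L * 2 ^ s) ^ r * (r : ℝ) ^ (r + 1) * (M ^ (q - 1) * √(influence f i)))
      (((r : ℝ) - 1) * s) := by
  have hr1 : (1 : ℝ) ≤ r := by exact_mod_cast hq.trans hqr
  have hm := momGrowth_multilin μ (A := L * M) (by positivity) hs h h0 (Finset.univ.erase i)
    (fun S ↦ homCoeff f (insert i S)) (q - 1) (by
      intro S hS hne
      have h1 := card_of_homCoeff_ne_zero hf hne
      rw [Finset.card_insert_of_notMem fun h ↦ by simpa using Finset.mem_powerset.1 hS h] at h1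
      omega)
  refine hm.mono (by positivity) ?_ ?_
  · have h2 : (1 : ℝ) ≤ 2 ^ s := Real.one_le_rpow (by norm_num) (by linarith)
    have h1 : (1 : ℝ) ≤ 4 * L * 2 ^ s := by nlinarith
    have h3 : √(∑ S ∈ (Finset.univ.erase i).powerset, homCoeff f (insert i S) ^ 2) ≤
        (r : ℝ) ^ (r + 1) * √(influence f i) := by
      have h4 : ∑ S ∈ (Finset.univ.erase i).powerset, homCoeff f (insert i S) ^ 2 ≤
          ((r : ℝ) ^ (r + 1)) ^ 2 * influence f i := by
        refine (sum_sq_homCoeff_insert_le hsy hf i).trans ?_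
        refine mul_le_mul_of_nonneg_right ?_ (influence_nonneg f i)
        calc (q : ℝ) ^ (q + 1) ≤ (r : ℝ) ^ (q + 1) := by gcongr
          _ ≤ (r : ℝ) ^ (r + 1) := pow_le_pow_right₀ hr1 (by omega)
          _ ≤ _ := le_self_pow₀ (one_le_pow₀ hr1) (by norm_num)
      refine (Real.sqrt_le_sqrt h4).trans_eq ?_
      rw [Real.sqrt_mul (by positivity), Real.sqrt_sq (by positivity)]
    calc (4 * (L * M) * 2 ^ s) ^ (q - 1) *
          √(∑ S ∈ (Finset.univ.erase i).powerset, homCoeff f (insert i S) ^ 2)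
        ≤ ((4 * L * 2 ^ s) ^ (q - 1) * M ^ (q - 1)) * ((r : ℝ) ^ (r + 1) * √(influence f i)) := by
          rw [← mul_pow]
          refine mul_le_mul (le_of_eq (by ring)) h3 (by positivity) (by positivity)
      _ ≤ ((4 * L * 2 ^ s) ^ r * M ^ (q - 1)) * ((r : ℝ) ^ (r + 1) * √(influence f i)) := by
          refine mul_le_mul_of_nonneg_right ?_ (by positivity)
          refine mul_le_mul_of_nonneg_right ?_ (by positivity)
          exact pow_le_pow_right₀ h1 (by omega)
      _ = _ := by ring
  · rw [Nat.cast_sub hq, Nat.cast_one]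
    have : (q : ℝ) ≤ r := by exact_mod_cast hqr
    gcongr

lemma momGrowth_homSum (μ : Fin N → Measure ℝ) [∀ i, IsProbabilityMeasure (μ i)] {A s : ℝ}
    (hA : 0 ≤ A) (hs : 1 / 2 ≤ s) (h : ∀ i, MomGrowth (μ i) (fun x ↦ ‖x‖ₑ) A s)
    (h0 : ∀ i, ∫ x, x ∂(μ i) = 0) {f : (Fin q → Fin N) → ℝ} (hf : VanishesOnDiagonals f) :
    ∃ B r : ℝ, MomGrowth (Measure.pi μ) (fun x ↦ ‖homSum f x‖ₑ) B r := by
  simp only [homSum_eq_multilin hf]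
  exact ⟨_, _, momGrowth_multilin μ hA hs h h0 Finset.univ (homCoeff f) q
    fun S _ hS ↦ card_of_homCoeff_ne_zero hf hS⟩

lemma measurable_homDeriv (f : (Fin q → Fin N) → ℝ) (i : Fin N) : Measurable (homDeriv f i) :=
  measurable_multilin _ _

lemma homDeriv_update (f : (Fin q → Fin N) → ℝ) (i : Fin N) (x : Fin N → ℝ) (t : ℝ) :
    homDeriv f i (Function.update x i t) = homDeriv f i x :=
  multilin_update (by simp) _ _ _

lemma homSum_eq_rest_add {f : (Fin q → Fin N) → ℝ} (hf : VanishesOnDiagonals f) (x : Fin N → ℝ)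
    (i : Fin N) : homSum f x = homRest f i x + x i * homDeriv f i x := by
  conv_lhs => rw [← Function.update_eq_self i x]
  exact homSum_update hf x i (x i)

end Coeff

/-! ### Interpolation between two values of a set function -/

section Interpolation

variable {ι : Type*} [Fintype ι] [DecidableEq ι]

lemma sum_finset_eq_sum_powerset_erase (i : ι) (F : Finset ι → ℝ) :
    ∑ B : Finset ι, F B = ∑ S ∈ (Finset.univ.erase i).powerset, (F S + F (insert i S)) := by
  rw [← Finset.powerset_univ, ← Finset.insert_erase (Finset.mem_univ i),
    Finset.sum_powerset_insert (by simp), Finset.erase_insert_eq_erase, Finset.erase_idem,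
    ← Finset.sum_add_distrib]

/-- Write N for the number of coordinates. Pairing S with `insert i S` merges two weights into w(b)
= b!(N-b-1)!/N! for b < N. The coefficient of φ(B), b = |B|, is then b w(b-1) - (N-b) w(b), and each
part equals 1/C(N,b), so they cancel. Only the full and the empty set survive: there one of the two
parts is missing and the other equals 1. -/
lemma sum_weight_mul_sum_sub (φ : Finset ι → ℝ) :
    ∑ B : Finset ι, ((B.card.factorial * (Fintype.card ι - B.card).factorial : ℕ) : ℝ) /
        ((Fintype.card ι + 1).factorial : ℝ) *
        ∑ i, (φ (insert i B) - φ (B.erase i)) = φ Finset.univ - φ ∅ := by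
  set N := Fintype.card ι with hN
  set ν : ℕ → ℝ := fun b ↦ ((b.factorial * (N - b).factorial : ℕ) : ℝ) / ((N + 1).factorial : ℝ)
    with hν
  set u : ℕ → ℝ := fun b ↦ ((b.factorial * (N - b).factorial : ℕ) : ℝ) / (N.factorial : ℝ) with hu
  set w : ℕ → ℝ := fun b ↦ ν b + ν (b + 1) with hw
  have hwu1 : ∀ b, b < N → ((N : ℝ) - b) * w b = u b := by
    intro b hb
    obtain ⟨c, hc⟩ : ∃ c, N = b + 1 + c := ⟨N - b - 1, by omega⟩
    simp only [hw, hν, hu, hc, show b + 1 + c - b = c + 1 by omega,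
      show b + 1 + c - (b + 1) = c by omega, Nat.factorial_succ]
    push_cast
    have h1 : ((b + 1 + c).factorial : ℝ) ≠ 0 := by positivity
    have h2 : (b : ℝ) + 1 + c + 1 ≠ 0 := by positivity
    field_simp
    ring
  have hwu2 : ∀ b, b < N → ((b : ℝ) + 1) * w b = u (b + 1) := by
    intro b hb
    obtain ⟨c, hc⟩ : ∃ c, N = b + 1 + c := ⟨N - b - 1, by omega⟩
    simp only [hw, hν, hu, hc, show b + 1 + c - b = c + 1 by omega,
      show b + 1 + c - (b + 1) = c by omega, Nat.factorial_succ]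
    push_cast
    have h1 : ((b + 1 + c).factorial : ℝ) ≠ 0 := by positivity
    have h2 : (b : ℝ) + 1 + c + 1 ≠ 0 := by positivity
    field_simp
    ring
  have hi : ∀ i : ι, ∑ B : Finset ι, ν B.card * (φ (insert i B) - φ (B.erase i)) =
      ∑ B : Finset ι, ((if i ∈ B then w (B.card - 1) * φ B else 0) -
        if i ∈ B then 0 else w B.card * φ B) := by
    intro i
    rw [sum_finset_eq_sum_powerset_erase i, sum_finset_eq_sum_powerset_erase i]
    refine Finset.sum_congr rfl fun S hS ↦ ?_
    have hiS : i ∉ S := fun h ↦ by simpa using Finset.mem_powerset.1 hS h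
    simp only [hiS, Finset.mem_insert_self, if_true, if_false, Finset.card_insert_of_notMem hiS,
      Finset.erase_eq_of_notMem hiS, Finset.insert_idem, Finset.erase_insert hiS, hw,
      Nat.add_sub_cancel]
    ring
  calc ∑ B : Finset ι, ν B.card * ∑ i, (φ (insert i B) - φ (B.erase i))
      = ∑ i, ∑ B : Finset ι, ν B.card * (φ (insert i B) - φ (B.erase i)) := by
        rw [Finset.sum_comm]
        exact Finset.sum_congr rfl fun B _ ↦ Finset.mul_sum _ _ _
    _ = ∑ B : Finset ι, ∑ i, ((if i ∈ B then w (B.card - 1) * φ B else 0) -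
        if i ∈ B then 0 else w B.card * φ B) := by
        rw [Finset.sum_congr rfl fun i _ ↦ hi i, Finset.sum_comm]
    _ = ∑ B : Finset ι, ((if B = Finset.univ then φ B else 0) - if B = ∅ then φ B else 0) := by
        refine Finset.sum_congr rfl fun B _ ↦ ?_
        have hcard : B.card ≤ N := Finset.card_le_univ B
        have e1 : ∑ i, (if i ∈ B then w (B.card - 1) * φ B else 0) =
            (B.card : ℝ) * (w (B.card - 1) * φ B) := by
          rw [← Finset.sum_filter]; simp
        have e2 : ∑ i, (if i ∈ B then 0 else w B.card * φ B) =
            ((N : ℝ) - B.card) * (w B.card * φ B) := by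
          have : ∀ i, (if i ∈ B then 0 else w B.card * φ B) =
              if i ∈ Bᶜ then w B.card * φ B else 0 := by
            intro i; by_cases h : i ∈ B <;> simp [h]
          simp only [this]
          rw [← Finset.sum_filter, Finset.filter_mem_eq_inter, Finset.univ_inter, Finset.sum_const,
            Finset.card_compl, nsmul_eq_mul, Nat.cast_sub hcard]
        rw [Finset.sum_sub_distrib, e1, e2]
        have f1 : (B.card : ℝ) * (w (B.card - 1) * φ B) = if B = ∅ then 0 else u B.card * φ B := by
          split_ifs with h
          · simp [h]
          · obtain ⟨b, hb⟩ : ∃ b, B.card = b + 1 :=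
              ⟨B.card - 1, by have := Finset.card_pos.2 (Finset.nonempty_iff_ne_empty.2 h); omega⟩
            rw [← mul_assoc, hb, Nat.add_sub_cancel]
            push_cast
            rw [hwu2 b (by omega)]
        have f2 : ((N : ℝ) - B.card) * (w B.card * φ B) =
            if B = Finset.univ then 0 else u B.card * φ B := by
          split_ifs with h
          · rw [h, Finset.card_univ, hN, sub_self, zero_mul]
          · rw [← mul_assoc, hwu1]
            exact lt_of_le_of_ne hcard fun h' ↦ h ((Finset.card_eq_iff_eq_univ B).1 h')
        rw [f1, f2]
        have hu0 : u 0 = 1 := by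
          simp only [hu, Nat.factorial_zero, one_mul, Nat.sub_zero]
          exact div_self (by positivity)
        have huN : u N = 1 := by
          simp only [hu, Nat.factorial_zero, mul_one, Nat.sub_self]
          exact div_self (by positivity)
        have a1 : B = ∅ → u B.card = 1 := fun h ↦ by rw [h, Finset.card_empty, hu0]
        have a2 : B = Finset.univ → u B.card = 1 := fun h ↦ by rw [h, Finset.card_univ, ← hN, huN]
        split_ifs with h1 h2 h2
        · ring
        · rw [a1 h1]; ring
        · rw [a2 h2]; ring
        · ring
    _ = φ Finset.univ - φ ∅ := by
        rw [Finset.sum_sub_distrib]; simp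

/-- The weights describe a uniform size in {0, …, N} followed by a uniform subset of that size. -/
lemma sum_weight_eq_one (N : ℕ) :
    ∑ B : Finset (Fin N), ((B.card.factorial * (Fintype.card (Fin N) - B.card).factorial : ℕ) : ℝ) /
        ((Fintype.card (Fin N) + 1).factorial : ℝ) = 1 := by
  rw [← Finset.powerset_univ, Finset.sum_powerset_apply_card (fun b ↦
    ((b.factorial * (Fintype.card (Fin N) - b).factorial : ℕ) : ℝ) /
        ((Fintype.card (Fin N) + 1).factorial : ℝ))]
  simp only [Finset.card_univ, Fintype.card_fin, nsmul_eq_mul]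
  calc ∑ b ∈ Finset.range (N + 1), ((N.choose b : ℕ) : ℝ) *
        (((b.factorial * (N - b).factorial : ℕ) : ℝ) / ((N + 1).factorial : ℝ))
      = ∑ b ∈ Finset.range (N + 1), 1 / ((N : ℝ) + 1) := by
        refine Finset.sum_congr rfl fun b hb ↦ ?_
        have h := Nat.choose_mul_factorial_mul_factorial (Nat.lt_succ_iff.1 (Finset.mem_range.1 hb))
        rw [← mul_div_assoc, ← Nat.cast_mul, ← mul_assoc, h, Nat.factorial_succ]
        push_cast
        have h1 : (N.factorial : ℝ) ≠ 0 := by positivity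
        field_simp
    _ = 1 := by
        rw [Finset.sum_const, Finset.card_range, nsmul_eq_mul]
        push_cast
        field_simp

/-- A randomized Lindeberg interpolation: the total change of `φ` from `∅` to the full set is at
most the largest sum over all coordinates of the changes at a common set. -/
lemma abs_sub_le_of_forall_sum_abs_le {N : ℕ} (φ : Finset (Fin N) → ℝ) {R : ℝ}
    (h : ∀ B, ∑ i, |φ (insert i B) - φ (B.erase i)| ≤ R) : |φ Finset.univ - φ ∅| ≤ R := by
  rw [← sum_weight_mul_sum_sub φ]
  calc _ ≤ ∑ B : Finset (Fin N), ((B.card.factorial * (Fintype.card (Fin N) - B.card).factorial : ℕ) : ℝ) /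
        ((Fintype.card (Fin N) + 1).factorial : ℝ) * R := by
        refine (Finset.abs_sum_le_sum_abs _ _).trans (Finset.sum_le_sum fun B _ ↦ ?_)
        rw [abs_mul, abs_of_nonneg (by positivity)]
        gcongr
        exact (Finset.abs_sum_le_sum_abs _ _).trans (h B)
    _ = R := by rw [← Finset.sum_mul, sum_weight_eq_one, one_mul]

end Interpolation

/-! ### Moment matching -/

/-- A centered probability law on `ℝ` with controlled moment growth. -/
structure IsCenteredGrowth (μ : Measure ℝ) (A s : ℝ) : Prop where
  prob : IsProbabilityMeasure μ
  centered : ∫ x, x ∂μ = 0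
  growth : MomGrowth μ (fun x ↦ ‖x‖ₑ) A s

lemma integrable_abs_pow {μ : Measure ℝ} [IsProbabilityMeasure μ] {A s : ℝ}
    (h : MomGrowth μ (fun x ↦ ‖x‖ₑ) A s) (m : ℕ) : Integrable (fun t : ℝ ↦ |t| ^ m) μ := by
  simpa only [Real.norm_eq_abs, abs_pow] using
    (integrable_pow_of_momGrowth (X := fun t : ℝ ↦ t) measurable_id h m).norm

lemma integrable_of_abs_sub_poly_le {μ : Measure ℝ} [IsProbabilityMeasure μ] {A s : ℝ}
    (h : MomGrowth μ (fun x ↦ ‖x‖ₑ) A s) {g : ℝ → ℝ} (hg : Measurable g) {m : ℕ} {c : ℕ → ℝ}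
    {K : ℝ} (hK : ∀ t, |g t - ∑ r ∈ Finset.range m, c r * t ^ r| ≤ K * |t| ^ m) :
    Integrable (fun t ↦ g t - ∑ r ∈ Finset.range m, c r * t ^ r) μ := by
  refine ((integrable_abs_pow h m).const_mul K).mono' ?_ (Filter.Eventually.of_forall hK)
  exact (hg.sub (by fun_prop)).aestronglyMeasurable

/-- Equal moments give the polynomial the same integral under both laws, so it cancels from the
difference. The bound by K serves only to make the remainder integrable. -/
lemma enorm_integral_sub_integral_le {μ ν : Measure ℝ} [IsProbabilityMeasure μ]
    [IsProbabilityMeasure ν] {A s : ℝ} (hμ : MomGrowth μ (fun x ↦ ‖x‖ₑ) A s)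
    (hν : MomGrowth ν (fun x ↦ ‖x‖ₑ) A s) {m : ℕ}
    (hmom : ∀ r < m, ∫ x, x ^ r ∂μ = ∫ x, x ^ r ∂ν) {g : ℝ → ℝ} (hg : Measurable g) {c : ℕ → ℝ}
    {K : ℝ} (hK : ∀ t, |g t - ∑ r ∈ Finset.range m, c r * t ^ r| ≤ K * |t| ^ m) :
    ‖∫ t, g t ∂μ - ∫ t, g t ∂ν‖ₑ ≤
      ∫⁻ t, ‖g t - ∑ r ∈ Finset.range m, c r * t ^ r‖ₑ ∂μ +
      ∫⁻ t, ‖g t - ∑ r ∈ Finset.range m, c r * t ^ r‖ₑ ∂ν := by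
  set P : ℝ → ℝ := fun t ↦ ∑ r ∈ Finset.range m, c r * t ^ r with hP
  have hPi : ∀ {η : Measure ℝ} [IsProbabilityMeasure η], MomGrowth η (fun x ↦ ‖x‖ₑ) A s →
      Integrable P η ∧ ∫ t, P t ∂η = ∑ r ∈ Finset.range m, c r * ∫ t, t ^ r ∂η := by
    intro η _ hη
    have hi : ∀ r ∈ Finset.range m, Integrable (fun t : ℝ ↦ c r * t ^ r) η := fun r _ ↦
      (integrable_pow_of_momGrowth (X := fun t : ℝ ↦ t) measurable_id hη r).const_mul _
    refine ⟨integrable_finsetSum _ hi, ?_⟩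
    rw [hP, integral_finsetSum _ hi]
    exact Finset.sum_congr rfl fun r _ ↦ integral_const_mul _ _
  have hdecomp : ∀ {η : Measure ℝ} [IsProbabilityMeasure η], MomGrowth η (fun x ↦ ‖x‖ₑ) A s →
      ∫ t, g t ∂η = ∫ t, (g t - P t) ∂η + ∫ t, P t ∂η := by
    intro η _ hη
    rw [← integral_add (integrable_of_abs_sub_poly_le hη hg hK) (hPi hη).1]
    exact integral_congr_ae (Filter.Eventually.of_forall fun t ↦ (sub_add_cancel (g t) (P t)).symm)
  have hPeq : ∫ t, P t ∂μ = ∫ t, P t ∂ν := by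
    rw [(hPi hμ).2, (hPi hν).2]
    exact Finset.sum_congr rfl fun r hr ↦ by rw [hmom r (Finset.mem_range.1 hr)]
  rw [hdecomp hμ, hdecomp hν, hPeq, add_sub_add_right_eq_sub]
  exact (enorm_sub_le).trans (add_le_add (enorm_integral_le_lintegral_enorm _)
    (enorm_integral_le_lintegral_enorm _))

/-! ### Integrability of smooth functions of the smooth maximum -/

lemma abs_smoothMax_le {d : ℕ} [NeZero d] {β : ℝ} (hβ : 0 < β) (z : Fin d → ℝ) :
    |smoothMax β z| ≤ ‖z‖ + β⁻¹ * Real.log d := by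
  have hd : (1 : ℝ) ≤ d := by exact_mod_cast Nat.one_le_iff_ne_zero.2 (NeZero.ne d)
  have hz : ∀ k, |z k| ≤ ‖z‖ := fun k ↦ norm_le_pi_norm z k
  have hS := sum_exp_pos fun k ↦ β * z k
  have h1 : Real.log (∑ j, Real.exp (β * z j)) ≤ Real.log d + β * ‖z‖ := by
    rw [← Real.log_exp (β * ‖z‖), ← Real.log_mul (by positivity) (Real.exp_pos _).ne']
    refine Real.log_le_log hS ?_
    calc ∑ j, Real.exp (β * z j) ≤ ∑ _j : Fin d, Real.exp (β * ‖z‖) :=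
          Finset.sum_le_sum fun j _ ↦ Real.exp_le_exp.2
            (mul_le_mul_of_nonneg_left ((le_abs_self _).trans (hz j)) hβ.le)
      _ = _ := by simp
  have h2 : -(β * ‖z‖) ≤ Real.log (∑ j, Real.exp (β * z j)) := by
    rw [← Real.log_exp (-(β * ‖z‖))]
    refine Real.log_le_log (Real.exp_pos _) ?_
    refine le_trans ?_ (Finset.single_le_sum (f := fun j ↦ Real.exp (β * z j))
      (fun _ _ ↦ (Real.exp_pos _).le) (Finset.mem_univ (0 : Fin d)))
    refine Real.exp_le_exp.2 ?_
    nlinarith [neg_abs_le (z 0), hz 0]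
  have hl : 0 ≤ Real.log d := Real.log_nonneg hd
  have e : β⁻¹ * (β * ‖z‖) = ‖z‖ := by field_simp
  unfold smoothMax
  rw [abs_le]
  constructor
  · have := mul_le_mul_of_nonneg_left h2 (inv_pos.2 hβ).le
    nlinarith [mul_nonneg (inv_pos.2 hβ).le hl]
  · have := mul_le_mul_of_nonneg_left h1 (inv_pos.2 hβ).le
    linarith

lemma continuous_smoothMax {d : ℕ} [NeZero d] (β : ℝ) :
    Continuous (smoothMax β : (Fin d → ℝ) → ℝ) := by
  unfold smoothMax
  refine continuous_const.mul (Continuous.log (by fun_prop) fun x ↦ (sum_exp_pos _).ne')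

lemma exists_abs_le_of_isCmb {m : ℕ} (hm : 1 ≤ m) {h : ℝ → ℝ} (hh : IsCmb m h) :
    ∃ B : ℝ, 0 ≤ B ∧ ∀ x, |h x| ≤ |h 0| + B * |x| := by
  obtain ⟨B, hB⟩ := hh.2 1 (Finset.mem_Icc.2 ⟨le_rfl, hm⟩)
  have hB0 : 0 ≤ B := (abs_nonneg _).trans (hB 0)
  refine ⟨B, hB0, fun x ↦ ?_⟩
  have hd : Differentiable ℝ h := hh.1.differentiable (by exact_mod_cast (by omega : m ≠ 0))
  have := Convex.norm_image_sub_le_of_norm_deriv_le (f := h) (C := B) (s := Set.univ) (x := 0)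
    (y := x) (fun x _ ↦ hd x) (fun x _ ↦ by simpa using hB x) convex_univ trivial trivial
  simp only [Real.norm_eq_abs, sub_zero] at this
  have h2 := abs_sub_abs_le_abs_sub (h x) (h 0)
  linarith

/-- A bounded first derivative gives h at most linear growth, and the smooth maximum is at most the
sup norm plus β⁻¹ log d in absolute value. -/
lemma integrable_comp_smoothMax {Ω : Type*} [MeasurableSpace Ω] {P : Measure Ω}
    [IsProbabilityMeasure P] {d : ℕ} [NeZero d] {m : ℕ} (hm : 1 ≤ m) {h : ℝ → ℝ} (hh : IsCmb m h)
    {β : ℝ} (hβ : 0 < β) {Z : Ω → Fin d → ℝ} (hZ : Measurable Z)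
    (hZi : ∀ k, Integrable (fun ω ↦ Z ω k) P) : Integrable (fun ω ↦ h (smoothMax β (Z ω))) P := by
  obtain ⟨B, hB0, hB⟩ := exists_abs_le_of_isCmb hm hh
  refine Integrable.mono' (g := fun ω ↦ |h 0| + B * (∑ k, ‖Z ω k‖ + β⁻¹ * Real.log d)) ?_ ?_ ?_
  · refine (integrable_const _).add (Integrable.const_mul ?_ _)
    exact (integrable_finsetSum _ fun k _ ↦ (hZi k).norm).add (integrable_const _)
  · exact (hh.1.continuous.measurable.comp
      ((continuous_smoothMax β).measurable.comp hZ)).aestronglyMeasurable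
  · refine Filter.Eventually.of_forall fun ω ↦ (hB _).trans ?_
    gcongr
    refine (abs_smoothMax_le hβ (Z ω)).trans ?_
    gcongr
    refine (pi_norm_le_iff_of_nonneg (Finset.sum_nonneg fun _ _ ↦ norm_nonneg _)).2 fun k ↦ ?_
    exact Finset.single_le_sum (f := fun k ↦ ‖Z ω k‖) (fun _ _ ↦ norm_nonneg _) (Finset.mem_univ k)

/-! ### Growth of the maximal partial derivative -/

lemma exists_norm_eq_abs {d : ℕ} [NeZero d] (v : Fin d → ℝ) : ∃ k, ‖v‖ = |v k| := by
  obtain ⟨k, -, hk⟩ := Finset.exists_mem_eq_sup Finset.univ ⟨0, Finset.mem_univ (0 : Fin d)⟩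
    fun k ↦ ‖v k‖₊
  exact ⟨k, by rw [Pi.norm_def, hk, coe_nnnorm, Real.norm_eq_abs]⟩

lemma enorm_pow_le_sum {d : ℕ} [NeZero d] (v : Fin d → ℝ) (p : ℕ) :
    ‖v‖ₑ ^ p ≤ ∑ k, ‖v k‖ₑ ^ p := by
  obtain ⟨k, hk⟩ := exists_norm_eq_abs v
  have : ‖v‖ₑ = ‖v k‖ₑ := by
    rw [← ofReal_norm, ← ofReal_norm, hk, Real.norm_eq_abs]
  rw [this]
  exact Finset.single_le_sum (f := fun k ↦ ‖v k‖ₑ ^ p) (fun _ _ ↦ zero_le) (Finset.mem_univ k)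

lemma ofReal_softAbs_eq {d : ℕ} (u v : Fin d → ℝ) (m : ℕ) :
    ENNReal.ofReal (softAbs u v m) = ∑ k, ENNReal.ofReal (softWeight u k) * ‖v k‖ₑ ^ m := by
  unfold softAbs
  rw [ENNReal.ofReal_sum_of_nonneg fun k _ ↦ mul_nonneg (softWeight_nonneg _ _) (by positivity)]
  refine Finset.sum_congr rfl fun k _ ↦ ?_
  rw [ENNReal.ofReal_mul (softWeight_nonneg _ _), ENNReal.ofReal_pow (abs_nonneg _),
    Real.enorm_eq_ofReal_abs]

/-- The weights do not depend on i, so the sum over i passes inside the average over k, and an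
average is at most a maximum. This step keeps the maximum outside the sum. -/
lemma sum_ofReal_softAbs_le {ι : Type*} (s : Finset ι) {d : ℕ} [NeZero d] (u : Fin d → ℝ)
    (v : ι → Fin d → ℝ) (m : ℕ) :
    ∑ i ∈ s, ENNReal.ofReal (softAbs u (v i) m) ≤ ⨆ k, ∑ i ∈ s, ‖v i k‖ₑ ^ m := by
  simp only [ofReal_softAbs_eq]
  rw [Finset.sum_comm]
  calc ∑ k, ∑ i ∈ s, ENNReal.ofReal (softWeight u k) * ‖v i k‖ₑ ^ m
      ≤ ∑ k, ENNReal.ofReal (softWeight u k) * ⨆ k, ∑ i ∈ s, ‖v i k‖ₑ ^ m := by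
        refine Finset.sum_le_sum fun k _ ↦ ?_
        rw [← Finset.mul_sum]
        gcongr
        exact le_iSup (fun k ↦ ∑ i ∈ s, ‖v i k‖ₑ ^ m) k
    _ = _ := by
        rw [← Finset.sum_mul, ← ENNReal.ofReal_sum_of_nonneg fun k _ ↦ softWeight_nonneg _ _,
          sum_softWeight, ENNReal.ofReal_one, one_mul]

/-- The constant in the moment growth of the partial derivatives of homogeneous sums. -/
def derivConst (L s : ℝ) (r : ℕ) : ℝ := (4 * L * 2 ^ s) ^ r * (r : ℝ) ^ (r + 1)

lemma derivConst_pos {L s : ℝ} (hL : 0 < L) {r : ℕ} (hr : 1 ≤ r) : 0 < derivConst L s r := by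
  have : (0 : ℝ) < r := by exact_mod_cast hr
  unfold derivConst
  positivity

section Growth

variable {N d : ℕ} {q : Fin d → ℕ}

/-- The vector of partial derivatives of the homogeneous sums. -/
def derivVec (f : (k : Fin d) → (Fin (q k) → Fin N) → ℝ) (i : Fin N) (x : Fin N → ℝ) :
    Fin d → ℝ := fun k ↦ homDeriv (f k) i x

lemma measurable_derivVec (f : (k : Fin d) → (Fin (q k) → Fin N) → ℝ) (i : Fin N) :
    Measurable (derivVec f i) :=
  measurable_pi_iff.2 fun k ↦ measurable_homDeriv (f k) i

lemma derivVec_update (f : (k : Fin d) → (Fin (q k) → Fin N) → ℝ) (i : Fin N) (x : Fin N → ℝ)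
    (t : ℝ) : derivVec f i (Function.update x i t) = derivVec f i x :=
  funext fun k ↦ homDeriv_update (f k) i x t

lemma Lam_nonneg (α : ℝ) (r : ℕ) {M : ℝ} (hM : 0 ≤ M)
    (f : (k : Fin d) → (Fin (q k) → Fin N) → ℝ) (i : Fin N) : 0 ≤ Lam α r M f i :=
  mul_nonneg (Real.rpow_nonneg (Real.log_natCast_nonneg d) _)
    (Real.iSup_nonneg fun _ ↦ by positivity)

variable (κ : Fin N → Measure ℝ) [∀ i, IsProbabilityMeasure (κ i)] {α L M : ℝ}
  {f : (k : Fin d) → (Fin (q k) → Fin N) → ℝ} {r : ℕ}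

lemma momGrowth_derivVec [NeZero d] (hα : 0 < α) (hα2 : α ≤ 2) (hL : 1 ≤ L) (hM : 0 ≤ M)
    (hκ : ∀ i, MomGrowth (κ i) (fun x ↦ ‖x‖ₑ) (L * M) (1 / α)) (hκ0 : ∀ i, ∫ x, x ∂(κ i) = 0)
    (hsy : ∀ k, IsSymm (f k)) (hf : ∀ k, VanishesOnDiagonals (f k)) (hq : ∀ k, 1 ≤ q k)
    (hqr : ∀ k, q k ≤ r) (hd : 2 ≤ d ∨ (d = 1 ∧ r = 1)) (i : Fin N) :
    MomGrowth (Measure.pi κ) (fun x ↦ ‖derivVec f i x‖ₑ)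
      (Real.exp 1 * 3 ^ (((r : ℝ) - 1) / α) * derivConst L (1 / α) r * Lam α r M f i)
      (((r : ℝ) - 1) / α) := by
  have hr : 1 ≤ r := (hq 0).trans (hqr 0)
  have hr' : (1 : ℝ) ≤ r := by exact_mod_cast hr
  have hs : 1 / 2 ≤ 1 / α := one_div_le_one_div_of_le hα hα2
  set S : ℝ := ⨆ k : Fin d, M ^ (q k - 1) * √(influence (f k) i) with hS
  have hS0 : 0 ≤ S := Real.iSup_nonneg fun _ ↦ by positivity
  have hc := derivConst_pos (s := 1 / α) (by linarith : 0 < L) hr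
  have h := MomGrowth.sup (μ := Measure.pi κ) (f := fun k x ↦ ‖homDeriv (f k) i x‖ₑ)
    (T := fun x ↦ ‖derivVec f i x‖ₑ) (A := derivConst L (1 / α) r * S) (s := ((r : ℝ) - 1) / α)
    (measurable_derivVec f i).enorm.aemeasurable (by positivity)
    (div_nonneg (by linarith) hα.le)
    (hd.imp_right fun h ↦ ⟨h.1, by rw [h.2]; simp⟩)
    (fun p _ x ↦ enorm_pow_le_sum (derivVec f i x) p)
    (fun k ↦ (measurable_homDeriv (f k) i).enorm.aemeasurable)
    (fun k ↦ by
      have h1 := momGrowth_homDeriv κ hL hM hs hκ hκ0 (hsy k) (hf k) (hq k) (hqr k) i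
      refine h1.mono (by positivity) ?_ (by rw [mul_one_div])
      exact mul_le_mul_of_nonneg_left (le_ciSup (f := fun k ↦ M ^ (q k - 1) *
        √(influence (f k) i)) (Set.finite_range _).bddAbove k) hc.le)
  refine h.mono (by have := Real.log_natCast_nonneg d; positivity) (le_of_eq ?_) le_rfl
  rw [Lam, ← hS]
  ring

/-- The sum over i of m-th powers has growth exponent m(r-1)/α. The maximal inequality over k then
gives the power of log d, and only its first moment is used. The prefactor M^m completes M^{m(q-1)}
to M^{mq}. -/
lemma lintegral_iSup_sum_le [NeZero d] (hα : 0 < α) (hα2 : α ≤ 2) (hL : 1 ≤ L) (hM : 0 ≤ M)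
    (hκ : ∀ i, MomGrowth (κ i) (fun x ↦ ‖x‖ₑ) (L * M) (1 / α)) (hκ0 : ∀ i, ∫ x, x ∂(κ i) = 0)
    (hsy : ∀ k, IsSymm (f k)) (hf : ∀ k, VanishesOnDiagonals (f k)) (hq : ∀ k, 1 ≤ q k)
    (hqr : ∀ k, q k ≤ r) (hd : 2 ≤ d ∨ (d = 1 ∧ r = 1)) {m : ℕ} (hm : 1 ≤ m) :
    ENNReal.ofReal (M ^ m) *
      ∫⁻ x, ⨆ k, ∑ i, ‖derivVec f i x k‖ₑ ^ m ∂(Measure.pi κ) ≤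
      ENNReal.ofReal ((Real.exp 1 * 3 ^ ((m : ℝ) * (((r : ℝ) - 1) / α)) *
        (((m : ℝ) ^ (((r : ℝ) - 1) / α)) ^ m * derivConst L (1 / α) r ^ m)) *
        (Real.log d ^ ((m : ℝ) * ((r : ℝ) - 1) / α) *
          ⨆ k : Fin d, M ^ (m * q k) * ∑ i : Fin N, influence (f k) i ^ ((m : ℝ) / 2))) := by
  have hr : 1 ≤ r := (hq 0).trans (hqr 0)
  have hr' : (1 : ℝ) ≤ r := by exact_mod_cast hr
  have hs : 1 / 2 ≤ 1 / α := one_div_le_one_div_of_le hα hα2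
  have hs'0 : 0 ≤ ((r : ℝ) - 1) / α := div_nonneg (by linarith) hα.le
  set s' := ((r : ℝ) - 1) / α with hs'
  have hc := derivConst_pos (s := 1 / α) (by linarith : 0 < L) hr
  set c₀ := derivConst L (1 / α) r
  set S : ℝ := ⨆ k : Fin d, M ^ (m * (q k - 1)) * ∑ i : Fin N, influence (f k) i ^ ((m : ℝ) / 2)
    with hS
  have hinf : ∀ k i, 0 ≤ influence (f k) i := fun k i ↦ influence_nonneg (f k) i
  have hsum0 : ∀ k, 0 ≤ ∑ i : Fin N, influence (f k) i ^ ((m : ℝ) / 2) := fun k ↦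
    Finset.sum_nonneg fun i _ ↦ Real.rpow_nonneg (hinf k i) _
  have hS0 : 0 ≤ S := Real.iSup_nonneg fun k ↦ mul_nonneg (by positivity) (hsum0 k)
  have hl := Real.log_natCast_nonneg d
  have hmeas : ∀ k, Measurable fun x ↦ ∑ i, ‖derivVec f i x k‖ₑ ^ m := fun k ↦
    Finset.measurable_sum _ fun i _ ↦ (measurable_homDeriv (f k) i).enorm.pow_const m
  have h := MomGrowth.sup (μ := Measure.pi κ) (f := fun k x ↦ ∑ i, ‖derivVec f i x k‖ₑ ^ m)
    (T := fun x ↦ ⨆ k, ∑ i, ‖derivVec f i x k‖ₑ ^ m) (A := (((m : ℝ) ^ s') ^ m * c₀ ^ m) * S)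
    (s := m * s')
    (Measurable.iSup hmeas).aemeasurable (by positivity)
    (by positivity)
    (hd.imp_right fun h ↦ ⟨h.1, by rw [hs', h.2]; simp⟩)
    (fun p _ x ↦ by
      obtain ⟨k, hk⟩ := exists_eq_ciSup_of_finite (f := fun k ↦ ∑ i, ‖derivVec f i x k‖ₑ ^ m)
      rw [← hk]
      exact Finset.single_le_sum (f := fun k ↦ (∑ i, ‖derivVec f i x k‖ₑ ^ m) ^ p)
        (fun _ _ ↦ zero_le) (Finset.mem_univ k))
    (fun k ↦ (hmeas k).aemeasurable)
    (fun k ↦ by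
      have h1 := MomGrowth.sum_pow (μ := Measure.pi κ) Finset.univ
        (f := fun i x ↦ ‖derivVec f i x k‖ₑ) (A := fun i ↦ c₀ * (M ^ (q k - 1) * √(influence (f k) i)))
        (fun i ↦ (measurable_homDeriv (f k) i).enorm.aemeasurable) (fun i ↦ by positivity)
        (r := s') (fun i ↦ by
          have h1 := momGrowth_homDeriv κ hL hM hs hκ hκ0 (hsy k) (hf k) (hq k) (hqr k) i
          exact h1.mono (by positivity) le_rfl (by rw [mul_one_div])) hm
      refine h1.mono ?_ ?_ le_rfl
      · exact mul_nonneg (by positivity) (Finset.sum_nonneg fun i _ ↦ by positivity)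
      · rw [mul_assoc]
        refine mul_le_mul_of_nonneg_left ?_ (by positivity)
        simp only [mul_pow]
        rw [← Finset.mul_sum]
        refine mul_le_mul_of_nonneg_left ?_ (by positivity)
        refine le_trans (le_of_eq ?_) (le_ciSup (f := fun k ↦ M ^ (m * (q k - 1)) *
          ∑ i : Fin N, influence (f k) i ^ ((m : ℝ) / 2)) (Set.finite_range _).bddAbove k)
        rw [← Finset.mul_sum, ← pow_mul, mul_comm (q k - 1) m]
        congr 1
        refine Finset.sum_congr rfl fun i _ ↦ ?_
        rw [Real.sqrt_eq_rpow, ← Real.rpow_natCast, ← Real.rpow_mul (hinf k i)]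
        congr 1
        ring)
  have h1 := h 1 le_rfl
  simp only [pow_one, Nat.cast_one, Real.one_rpow, mul_one] at h1
  refine (mul_le_mul_right h1 _).trans_eq ?_
  rw [← ENNReal.ofReal_mul (by positivity)]
  congr 1
  have e : M ^ m * S = ⨆ k : Fin d, M ^ (m * q k) *
      ∑ i : Fin N, influence (f k) i ^ ((m : ℝ) / 2) := by
    rw [hS, Real.mul_iSup_of_nonneg (by positivity)]
    refine iSup_congr fun k ↦ ?_
    rw [← mul_assoc, ← pow_add]
    congr 2
    obtain ⟨n, hn⟩ : ∃ n, q k = n + 1 := ⟨q k - 1, by have := hq k; omega⟩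
    rw [hn, Nat.add_sub_cancel]
    ring
  rw [← e, hs', mul_div_assoc]
  ring

end Growth

/-! ### Replacing one coordinate -/

/-- The pointwise bound, up to a constant, for the Taylor remainder in the replaced coordinate. -/
def stepErr {d : ℕ} (β : ℝ) (m : ℕ) (u v : Fin d → ℝ) (t : ℝ) : ℝ≥0∞ :=
  ‖t‖ₑ ^ m * (ENNReal.ofReal (softAbs (fun k ↦ β * u k) v m) +
    if β⁻¹ < |t| * ‖v‖ then ‖v‖ₑ ^ m else 0)

lemma ofReal_softAbs_le_enorm {d : ℕ} [NeZero d] (u v : Fin d → ℝ) (m : ℕ) :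
    ENNReal.ofReal (softAbs u v m) ≤ ‖v‖ₑ ^ m := by
  rw [← ofReal_norm, ← ENNReal.ofReal_pow (norm_nonneg _)]
  exact ENNReal.ofReal_le_ofReal (softAbs_le_norm u v m)

lemma measurable_softAbs {Ω : Type*} [MeasurableSpace Ω] {d : ℕ} {u v : Ω → Fin d → ℝ}
    (hu : Measurable u) (hv : Measurable v) (m : ℕ) :
    Measurable fun x ↦ softAbs (u x) (v x) m := by
  have hu' : ∀ k, Measurable fun x ↦ u x k := fun k ↦ (measurable_pi_apply k).comp hu
  have hv' : ∀ k, Measurable fun x ↦ v x k := fun k ↦ (measurable_pi_apply k).comp hv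
  unfold softAbs softWeight
  refine Finset.measurable_sum _ fun j _ ↦ ?_
  refine Measurable.mul ?_ (((hv' j).abs).pow_const m)
  exact (Real.measurable_exp.comp (hu' j)).div
    (Finset.measurable_sum _ fun k _ ↦ Real.measurable_exp.comp (hu' k))

section Step

variable {N d : ℕ} {q : Fin d → ℕ}

/-- The vector of homogeneous sums, shifted by `y`. -/
def homVec (f : (k : Fin d) → (Fin (q k) → Fin N) → ℝ) (y : Fin d → ℝ) (x : Fin N → ℝ) :
    Fin d → ℝ := fun k ↦ homSum (f k) x - y k

/-- The part of the shifted vector of homogeneous sums that does not involve coordinate `i`. -/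
def restVec (f : (k : Fin d) → (Fin (q k) → Fin N) → ℝ) (y : Fin d → ℝ) (i : Fin N)
    (x : Fin N → ℝ) : Fin d → ℝ := fun k ↦ homRest (f k) i x - y k

lemma measurable_restVec (f : (k : Fin d) → (Fin (q k) → Fin N) → ℝ) (y : Fin d → ℝ) (i : Fin N) :
    Measurable (restVec f y i) :=
  measurable_pi_iff.2 fun _ ↦ (measurable_multilin _ _).sub_const _

lemma measurable_homVec (f : (k : Fin d) → (Fin (q k) → Fin N) → ℝ) (y : Fin d → ℝ) :
    Measurable (homVec f y) := by
  refine measurable_pi_iff.2 fun k ↦ Measurable.sub_const ?_ _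
  unfold homSum
  fun_prop

lemma homVec_update {f : (k : Fin d) → (Fin (q k) → Fin N) → ℝ}
    (hf : ∀ k, VanishesOnDiagonals (f k)) (y : Fin d → ℝ) (i : Fin N) (x : Fin N → ℝ) (t : ℝ) :
    homVec f y (Function.update x i t) = fun k ↦ restVec f y i x k + t * derivVec f i x k := by
  ext k
  simp only [homVec, restVec, derivVec, homSum_update (hf k), homRest, homDeriv]
  ring

/-- The two sets of exponents differ by β x_i V_i, which is at most 1 in every component when |x_i|
≤ a and ‖V_i‖ ≤ b. On each exceptional event the softmax average is bounded crudely by ‖V_i‖^m. -/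
lemma ofReal_softAbs_restVec_le [NeZero d] {f : (k : Fin d) → (Fin (q k) → Fin N) → ℝ}
    (hf : ∀ k, VanishesOnDiagonals (f k)) (y : Fin d → ℝ) (i : Fin N) (m : ℕ) {β a b : ℝ}
    (hβ : 0 < β) (ha : 0 ≤ a) (hab : a * b ≤ β⁻¹) (x : Fin N → ℝ) :
    ENNReal.ofReal (softAbs (fun k ↦ β * restVec f y i x k) (derivVec f i x) m) ≤
      ENNReal.ofReal (Real.exp 2) *
        ENNReal.ofReal (softAbs (fun k ↦ β * homVec f y x k) (derivVec f i x) m) +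
      ‖derivVec f i x‖ₑ ^ m * {t : ℝ | ENNReal.ofReal a < ‖t‖ₑ}.indicator 1 (x i) +
      {x | ENNReal.ofReal b < ‖derivVec f i x‖ₑ}.indicator (fun x ↦ ‖derivVec f i x‖ₑ ^ m) x := by
  by_cases h1 : ENNReal.ofReal a < ‖x i‖ₑ
  · rw [Set.indicator_of_mem (s := {t : ℝ | ENNReal.ofReal a < ‖t‖ₑ}) h1]
    refine le_trans (ofReal_softAbs_le_enorm _ _ _) ?_
    refine le_trans ?_ le_self_add
    refine le_trans ?_ le_add_self
    simp
  by_cases h2 : ENNReal.ofReal b < ‖derivVec f i x‖ₑ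
  · rw [Set.indicator_of_mem (s := {x | ENNReal.ofReal b < ‖derivVec f i x‖ₑ}) h2]
    exact le_trans (ofReal_softAbs_le_enorm _ _ _) le_add_self
  refine le_trans ?_ le_self_add
  refine le_trans ?_ le_self_add
  rw [← ENNReal.ofReal_mul (Real.exp_pos _).le]
  refine ENNReal.ofReal_le_ofReal ?_
  have hx : |x i| ≤ a := by
    rw [not_lt, Real.enorm_eq_ofReal_abs, ENNReal.ofReal_le_ofReal_iff ha] at h1
    exact h1
  have hz : ∀ k, |-(β * (x i * derivVec f i x k))| ≤ 1 := by
    intro k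
    rw [abs_neg, abs_mul, abs_of_pos hβ, abs_mul]
    have hk : |derivVec f i x k| ≤ ‖derivVec f i x‖ := norm_le_pi_norm (derivVec f i x) k
    rcases le_or_gt 0 b with hb | hb
    · rw [not_lt, ← ofReal_norm, ENNReal.ofReal_le_ofReal_iff hb] at h2
      calc β * (|x i| * |derivVec f i x k|) ≤ β * (a * b) := by
            gcongr
            exact hk.trans h2
        _ ≤ β * β⁻¹ := by gcongr
        _ = 1 := mul_inv_cancel₀ hβ.ne'
    -- A negative b is truncated to 0 by `ENNReal.ofReal`, so in this case V_i = 0 and nothing is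
    -- perturbed.
    · rw [not_lt, ENNReal.ofReal_of_nonpos hb.le, nonpos_iff_eq_zero, enorm_eq_zero] at h2
      simp [h2]
  have h := softAbs_add_le (fun k ↦ β * homVec f y x k) _ (derivVec f i x) hz m
  convert h using 2
  ext k
  have := homSum_eq_rest_add (hf k) x i
  simp only [restVec, homVec, derivVec, this]
  ring

variable (κ : Fin N → Measure ℝ) [∀ i, IsProbabilityMeasure (κ i)]

/-- V_i does not involve coordinate i and is therefore independent of it. -/
lemma lintegral_mul_indicator_coord (f : (k : Fin d) → (Fin (q k) → Fin N) → ℝ) (i : Fin N)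
    (m : ℕ) {S : Set ℝ} (hS : MeasurableSet S) :
    ∫⁻ x, ‖derivVec f i x‖ₑ ^ m * S.indicator 1 (x i) ∂(Measure.pi κ) =
      (∫⁻ x, ‖derivVec f i x‖ₑ ^ m ∂(Measure.pi κ)) * κ i S := by
  have hm : Measurable fun x ↦ ‖derivVec f i x‖ₑ ^ m := (measurable_derivVec f i).enorm.pow_const m
  rw [lintegral_pi_eq_lintegral_update κ i
    (F := fun x ↦ ‖derivVec f i x‖ₑ ^ m * S.indicator 1 (x i)) (hm.mul ((measurable_one.indicator hS).comp (measurable_pi_apply i))),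
    ← lintegral_mul_const _ hm]
  refine lintegral_congr fun x ↦ ?_
  simp only [derivVec_update, Function.update_self]
  rw [lintegral_const_mul _ (measurable_one.indicator hS), lintegral_indicator_one hS]

end Step

/-- The expected remainder when one coordinate is replaced. -/
lemma exists_lintegral_stepErr_le {α : ℝ} (hα : 0 < α) (hα2 : α ≤ 2) {L : ℝ} (hL : 1 ≤ L) :
    ∃ K₁ : ℝ, 0 < K₁ ∧ ∀ r : ℕ, 1 ≤ r → ∃ K₂ : ℝ, 0 < K₂ ∧ ∃ K₃ : ℝ, 0 < K₃ ∧
    ∀ m : ℕ, 1 ≤ m → ∃ C : ℝ, 0 < C ∧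
    ∀ (N d : ℕ) [NeZero d] (q : Fin d → ℕ) (f : (k : Fin d) → (Fin (q k) → Fin N) → ℝ)
      (κ : Fin N → Measure ℝ) [∀ i, IsProbabilityMeasure (κ i)] (η : Measure ℝ)
      [IsProbabilityMeasure η] (M : ℝ), 0 ≤ M →
      (∀ i, MomGrowth (κ i) (fun x ↦ ‖x‖ₑ) (L * M) (1 / α)) → (∀ i, ∫ x, x ∂(κ i) = 0) →
      MomGrowth η (fun x ↦ ‖x‖ₑ) (L * M) (1 / α) →
      (∀ k, IsSymm (f k)) → (∀ k, VanishesOnDiagonals (f k)) → (∀ k, 1 ≤ q k) →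
      (∀ k, q k ≤ r) → (2 ≤ d ∨ (d = 1 ∧ r = 1)) →
      ∀ (β τ ρ : ℝ), 0 < β → 0 ≤ τ → 0 ≤ ρ → ∀ (i : Fin N) (y : Fin d → ℝ),
      τ * ρ * M * Lam α r M f i ≤ β⁻¹ →
      ∫⁻ x, ∫⁻ t, stepErr β m (restVec f y i x) (derivVec f i x) t ∂η ∂(Measure.pi κ) ≤
        ENNReal.ofReal C * (ENNReal.ofReal (M ^ m) *
          ∫⁻ x, ENNReal.ofReal (softAbs (fun k ↦ β * homVec f y x k) (derivVec f i x) m)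
            ∂(Measure.pi κ) +
          ENNReal.ofReal ((Real.exp (-(τ / K₁) ^ α) + chi (((r : ℝ) - 1) / α) (ρ / K₂) +
            Real.exp (-(τ * ρ / K₃) ^ (α / (r : ℝ)))) * (M ^ m * Lam α r M f i ^ m))) := by
  have hL0 : 0 < L := by linarith
  obtain ⟨K₁, hK₁, hT1⟩ := exists_lintegral_tail_le (1 / α) (by positivity) L hL0
  -- K₁ concerns the tail of a single coordinate, so it is fixed before the degree. K₂ and K₃ depend
  -- on the degree but precede m.
  refine ⟨K₁, hK₁, fun r hr ↦ ?_⟩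
  have hr' : (1 : ℝ) ≤ r := by exact_mod_cast hr
  set s' := ((r : ℝ) - 1) / α with hs'
  have hs'0 : 0 ≤ s' := div_nonneg (by linarith) hα.le
  have hdc := derivConst_pos (s := 1 / α) hL0 hr
  set L' := Real.exp 1 * 3 ^ s' * derivConst L (1 / α) r with hL'
  have hL'0 : 0 < L' := by positivity
  obtain ⟨K₂, hK₂, hT2⟩ := exists_lintegral_tail_le s' hs'0 L' hL'0
  obtain ⟨K₃, hK₃, hT3⟩ := exists_lintegral_tail_le (s' + 1 / α) (by positivity) (L' * L)
    (by positivity)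
  refine ⟨K₂, hK₂, K₃, hK₃, fun m hm ↦ ?_⟩
  -- With the zeroth power the truncated moment is just the tail probability of the coordinate.
  obtain ⟨C₁, hC₁, hT1⟩ := hT1 0
  obtain ⟨C₂, hC₂, hT2⟩ := hT2 m
  obtain ⟨C₃, hC₃, hT3⟩ := hT3 m
  have hm0 : (0 : ℝ) < m := by exact_mod_cast hm
  set A₁ : ℝ := (L * (m : ℝ) ^ (1 / α)) ^ m with hA₁
  set A₂ : ℝ := (L' * (m : ℝ) ^ s') ^ m with hA₂
  have hA₁0 : 0 < A₁ := by positivity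
  have hA₂0 : 0 < A₂ := by positivity
  refine ⟨A₁ * Real.exp 2 + A₁ * A₂ * C₁ + A₁ * C₂ + C₃, by positivity, ?_⟩
  intro N d _ q f κ _ η _ M hM hκ hκ0 hη hsy hf hq hqr hd β τ ρ hβ hτ hρ i y hcond
  set P := Measure.pi κ with hP
  set Λ := Lam α r M f i with hΛ
  have hΛ0 : 0 ≤ Λ := Lam_nonneg α r hM f i
  set T : (Fin N → ℝ) → ℝ≥0∞ := fun x ↦ ‖derivVec f i x‖ₑ with hT
  have hTm : Measurable T := (measurable_derivVec f i).enorm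
  have hTg : MomGrowth P T (L' * Λ) s' :=
    momGrowth_derivVec κ hα hα2 hL hM hκ hκ0 hsy hf hq hqr hd i
  set χ₁ := Real.exp (-(τ / K₁) ^ α) with hχ₁
  set χ₂ := chi s' (ρ / K₂) with hχ₂
  set χ₃ := Real.exp (-(τ * ρ / K₃) ^ (α / (r : ℝ))) with hχ₃
  have hχ₂0 : 0 ≤ χ₂ := chi_nonneg _ _
  have hc1 : chi (1 / α) (τ / K₁) = χ₁ := by
    rw [chi, if_pos (by positivity), one_div_one_div]
  have hc3 : chi (s' + 1 / α) (τ * ρ / K₃) = χ₃ := by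
    have e : s' + 1 / α = r / α := by rw [hs']; ring
    rw [chi, if_pos (by positivity), e, one_div_div]
  have hη1 : ∫⁻ t, ‖t‖ₑ ^ m ∂η ≤ ENNReal.ofReal (A₁ * M ^ m) := by
    refine (hη m hm).trans_eq ?_
    rw [← ENNReal.ofReal_pow (by positivity), hA₁]
    congr 1
    rw [← mul_pow]; ring
  have hT2' : ∫⁻ x, T x ^ m ∂P ≤ ENNReal.ofReal (A₂ * Λ ^ m) := by
    refine (hTg m hm).trans_eq ?_
    rw [← ENNReal.ofReal_pow (by positivity), hA₂]
    congr 1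
    rw [← mul_pow]; ring
  have hset : MeasurableSet {t : ℝ | ENNReal.ofReal (τ * M) < ‖t‖ₑ} :=
    measurableSet_lt measurable_const measurable_enorm
  have htail1 : κ i {t : ℝ | ENNReal.ofReal (τ * M) < ‖t‖ₑ} ≤ ENNReal.ofReal (C₁ * χ₁) := by
    have h := hT1 (κ i) (fun t ↦ ‖t‖ₑ) M τ measurable_enorm hM hτ (hκ i)
    rw [hc1] at h
    simpa using h
  have hset2 : MeasurableSet {x | ENNReal.ofReal (ρ * Λ) < T x} :=
    measurableSet_lt measurable_const hTm
  have htail2 : ∫⁻ x, {x | ENNReal.ofReal (ρ * Λ) < T x}.indicator (fun x ↦ T x ^ m) x ∂P ≤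
      ENNReal.ofReal (C₂ * Λ ^ m * χ₂) := by
    rw [lintegral_indicator hset2]
    exact hT2 P T Λ ρ hTm hΛ0 hρ hTg
  have hsoft : ∫⁻ x, ENNReal.ofReal (softAbs (fun k ↦ β * restVec f y i x k) (derivVec f i x) m) ∂P ≤
      ENNReal.ofReal (Real.exp 2) *
        ∫⁻ x, ENNReal.ofReal (softAbs (fun k ↦ β * homVec f y x k) (derivVec f i x) m) ∂P +
      ENNReal.ofReal (A₂ * Λ ^ m) * ENNReal.ofReal (C₁ * χ₁) +
      ENNReal.ofReal (C₂ * Λ ^ m * χ₂) := by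
    have hm1 : Measurable fun x ↦
        ENNReal.ofReal (softAbs (fun k ↦ β * homVec f y x k) (derivVec f i x) m) := by
      refine (measurable_softAbs ?_ (measurable_derivVec f i) m).ennreal_ofReal
      exact measurable_pi_iff.2 fun k ↦
        ((measurable_pi_apply k).comp (measurable_homVec f y)).const_mul β
    refine (lintegral_mono (ofReal_softAbs_restVec_le hf y i m hβ (a := τ * M) (b := ρ * Λ)
      (by positivity) (le_trans (le_of_eq (by ring)) hcond))).trans ?_
    rw [lintegral_add_right _ ((hTm.pow_const m).indicator hset2),
      lintegral_add_left (hm1.const_mul _), lintegral_const_mul _ hm1,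
      lintegral_mul_indicator_coord κ f i m hset]
    gcongr
  -- The new value t is independent of V_i, so on the product space ‖V_i‖|t| has growth exponent
  -- (r-1)/α + 1/α = r/α. The event |t|‖V_i‖ > 1/β lies in a tail event at level τρ, because τρMΛ_i
  -- ≤ 1/β.
  have hprod : ∫⁻ x, ∫⁻ t, ‖t‖ₑ ^ m * (if β⁻¹ < |t| * ‖derivVec f i x‖ then
      ‖derivVec f i x‖ₑ ^ m else 0) ∂η ∂P ≤ ENNReal.ofReal (C₃ * (Λ * M) ^ m * χ₃) := by
    set F : (Fin N → ℝ) × ℝ → ℝ≥0∞ := fun z ↦ T z.1 * ‖z.2‖ₑ with hF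
    have hFm : Measurable F := (hTm.comp measurable_fst).mul measurable_snd.enorm
    have hFg : MomGrowth (P.prod η) F ((L' * L) * (Λ * M)) (s' + 1 / α) := by
      have := MomGrowth.prod (μ := P) (ν := η) hTm measurable_enorm (by positivity) hTg hη
      convert this using 1
      ring
    have hset3 : MeasurableSet {z | ENNReal.ofReal (τ * ρ * (Λ * M)) < F z} :=
      measurableSet_lt measurable_const hFm
    have h := hT3 (P.prod η) F (Λ * M) (τ * ρ) hFm (by positivity) (by positivity) hFg
    rw [hc3, ← lintegral_indicator hset3,
      lintegral_prod _ ((hFm.pow_const m).indicator hset3).aemeasurable] at h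
    refine le_trans (lintegral_mono fun x ↦ lintegral_mono fun t ↦ ?_) h
    split_ifs with hlt
    · have hmem : (x, t) ∈ {z | ENNReal.ofReal (τ * ρ * (Λ * M)) < F z} := by
        show ENNReal.ofReal (τ * ρ * (Λ * M)) < ‖derivVec f i x‖ₑ * ‖t‖ₑ
        rw [← ofReal_norm, ← ofReal_norm, ← ENNReal.ofReal_mul (norm_nonneg _), Real.norm_eq_abs t,
          ENNReal.ofReal_lt_ofReal_iff_of_nonneg (by positivity)]
        calc τ * ρ * (Λ * M) = τ * ρ * M * Λ := by ring
          _ ≤ β⁻¹ := hcond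
          _ < |t| * ‖derivVec f i x‖ := hlt
          _ = _ := mul_comm _ _
      rw [Set.indicator_of_mem hmem]
      simp only [hF, hT, mul_pow]
      rw [mul_comm]
    · simp
  have hmr : Measurable fun x ↦
      ENNReal.ofReal (softAbs (fun k ↦ β * restVec f y i x k) (derivVec f i x) m) := by
    refine (measurable_softAbs ?_ (measurable_derivVec f i) m).ennreal_ofReal
    exact measurable_pi_iff.2 fun k ↦
      ((measurable_pi_apply k).comp (measurable_restVec f y i)).const_mul β
  set X := ∫⁻ x, ENNReal.ofReal (softAbs (fun k ↦ β * homVec f y x k) (derivVec f i x) m) ∂P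
  have hmain : ∫⁻ x, ∫⁻ t, stepErr β m (restVec f y i x) (derivVec f i x) t ∂η ∂P ≤
      ENNReal.ofReal (A₁ * M ^ m) * (ENNReal.ofReal (Real.exp 2) * X +
        ENNReal.ofReal (A₂ * Λ ^ m) * ENNReal.ofReal (C₁ * χ₁) +
        ENNReal.ofReal (C₂ * Λ ^ m * χ₂)) + ENNReal.ofReal (C₃ * (Λ * M) ^ m * χ₃) := by
    have hinner : ∀ x, ∫⁻ t, stepErr β m (restVec f y i x) (derivVec f i x) t ∂η =
        (∫⁻ t, ‖t‖ₑ ^ m ∂η) *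
          ENNReal.ofReal (softAbs (fun k ↦ β * restVec f y i x k) (derivVec f i x) m) +
        ∫⁻ t, ‖t‖ₑ ^ m * (if β⁻¹ < |t| * ‖derivVec f i x‖ then ‖derivVec f i x‖ₑ ^ m else 0) ∂η := by
      intro x
      have hpm : Measurable fun t : ℝ ↦ ‖t‖ₑ ^ m := measurable_enorm.pow_const m
      simp only [stepErr, mul_add]
      rw [lintegral_add_left (hpm.mul_const _), lintegral_mul_const _ hpm]
    simp only [hinner]
    rw [lintegral_add_left (hmr.const_mul _), lintegral_const_mul _ hmr]
    gcongr
  refine hmain.trans ?_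
  set C := A₁ * Real.exp 2 + A₁ * A₂ * C₁ + A₁ * C₂ + C₃ with hC
  have hMm : 0 ≤ M ^ m := by positivity
  have hΛm : 0 ≤ Λ ^ m := by positivity
  have h1 : ENNReal.ofReal (A₁ * M ^ m) * (ENNReal.ofReal (Real.exp 2) * X) ≤
      ENNReal.ofReal C * (ENNReal.ofReal (M ^ m) * X) := by
    rw [← mul_assoc, ← mul_assoc, ← ENNReal.ofReal_mul (by positivity),
      ← ENNReal.ofReal_mul (by positivity)]
    gcongr ENNReal.ofReal ?_ * X
    have : A₁ * Real.exp 2 ≤ C := by rw [hC]; linarith [mul_pos (mul_pos hA₁0 hA₂0) hC₁, mul_pos hA₁0 hC₂]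
    nlinarith
  have h2 : ENNReal.ofReal (A₁ * M ^ m) * (ENNReal.ofReal (A₂ * Λ ^ m) * ENNReal.ofReal (C₁ * χ₁)) +
      ENNReal.ofReal (A₁ * M ^ m) * ENNReal.ofReal (C₂ * Λ ^ m * χ₂) +
      ENNReal.ofReal (C₃ * (Λ * M) ^ m * χ₃) ≤
      ENNReal.ofReal C * ENNReal.ofReal ((χ₁ + χ₂ + χ₃) * (M ^ m * Λ ^ m)) := by
    have hχ₁0 : 0 ≤ χ₁ := (Real.exp_pos _).le
    have hχ₃0 : 0 ≤ χ₃ := (Real.exp_pos _).le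
    rw [← ENNReal.ofReal_mul (by positivity), ← ENNReal.ofReal_mul (by positivity),
      ← ENNReal.ofReal_mul (by positivity), ← ENNReal.ofReal_mul (by positivity),
      ← ENNReal.ofReal_add (by positivity) (by positivity),
      ← ENNReal.ofReal_add (by positivity) (by positivity)]
    refine ENNReal.ofReal_le_ofReal ?_
    have hp : 0 ≤ M ^ m * Λ ^ m := by positivity
    have e : A₁ * M ^ m * (A₂ * Λ ^ m * (C₁ * χ₁)) + A₁ * M ^ m * (C₂ * Λ ^ m * χ₂) +
        C₃ * (Λ * M) ^ m * χ₃ = (A₁ * A₂ * C₁ * χ₁ + A₁ * C₂ * χ₂ + C₃ * χ₃) * (M ^ m * Λ ^ m) := by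
      rw [mul_pow]; ring
    rw [e, ← mul_assoc C]
    refine mul_le_mul_of_nonneg_right ?_ hp
    have hpos1 : 0 ≤ A₁ * Real.exp 2 := by positivity
    have hpos2 : 0 ≤ A₁ * A₂ * C₁ := by positivity
    have hpos3 : 0 ≤ A₁ * C₂ := by positivity
    rw [mul_add, mul_add]
    refine add_le_add (add_le_add ?_ ?_) ?_
    · exact mul_le_mul_of_nonneg_right (by rw [hC]; linarith) hχ₁0
    · exact mul_le_mul_of_nonneg_right (by rw [hC]; linarith) hχ₂0
    · exact mul_le_mul_of_nonneg_right (by rw [hC]; linarith) hχ₃0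
  calc _ = ENNReal.ofReal (A₁ * M ^ m) * (ENNReal.ofReal (Real.exp 2) * X) +
      (ENNReal.ofReal (A₁ * M ^ m) * (ENNReal.ofReal (A₂ * Λ ^ m) * ENNReal.ofReal (C₁ * χ₁)) +
      ENNReal.ofReal (A₁ * M ^ m) * ENNReal.ofReal (C₂ * Λ ^ m * χ₂) +
      ENNReal.ofReal (C₃ * (Λ * M) ^ m * χ₃)) := by ring
    _ ≤ _ := by
      rw [mul_add (ENNReal.ofReal C)]
      exact add_le_add h1 h2

/-! ### Lindeberg replacement between product laws -/

section Laws

variable {N d : ℕ} {q : Fin d → ℕ}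

lemma integrable_comp_homVec [NeZero d] (κ : Fin N → Measure ℝ) {A s : ℝ} (hA : 0 ≤ A)
    (hs : 1 / 2 ≤ s) (hκ : ∀ i, IsCenteredGrowth (κ i) A s)
    {f : (k : Fin d) → (Fin (q k) → Fin N) → ℝ} (hf : ∀ k, VanishesOnDiagonals (f k))
    {m : ℕ} (hm : 1 ≤ m) {h : ℝ → ℝ} (hh : IsCmb m h) {β : ℝ} (hβ : 0 < β) (y : Fin d → ℝ) :
    Integrable (fun x ↦ h (smoothMax β (homVec f y x))) (Measure.pi κ) := by
  have := fun i ↦ (hκ i).prob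
  refine integrable_comp_smoothMax hm hh hβ (measurable_homVec f y) fun k ↦ ?_
  obtain ⟨B, r, hB⟩ := momGrowth_homSum κ hA hs (fun i ↦ (hκ i).growth) (fun i ↦ (hκ i).centered)
    (hf k)
  have hmeas : Measurable fun x : Fin N → ℝ ↦ homSum (f k) x := by
    unfold homSum
    fun_prop
  have h1 := integrable_pow_of_momGrowth hmeas hB 1
  simp only [pow_one] at h1
  exact h1.sub (integrable_const _)

lemma measurable_stepErr [NeZero d] (f : (k : Fin d) → (Fin (q k) → Fin N) → ℝ) (y : Fin d → ℝ)
    (i : Fin N) (β : ℝ) (m : ℕ) :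
    Measurable fun z : (Fin N → ℝ) × ℝ ↦
      stepErr β m (restVec f y i z.1) (derivVec f i z.1) z.2 := by
  have hv : Measurable fun z : (Fin N → ℝ) × ℝ ↦ derivVec f i z.1 :=
    (measurable_derivVec f i).comp measurable_fst
  have hu : Measurable fun z : (Fin N → ℝ) × ℝ ↦ fun k ↦ β * restVec f y i z.1 k :=
    measurable_pi_iff.2 fun k ↦ ((measurable_pi_apply k).comp
      ((measurable_restVec f y i).comp measurable_fst)).const_mul β
  have habs : Measurable fun z : (Fin N → ℝ) × ℝ ↦ |z.2| := by fun_prop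
  unfold stepErr
  refine (measurable_snd.enorm.pow_const m).mul
    ((measurable_softAbs hu hv m).ennreal_ofReal.add ?_)
  exact Measurable.ite (measurableSet_lt measurable_const (habs.mul hv.norm))
    (hv.enorm.pow_const m) measurable_const

/-- The effect of changing the law of one coordinate. -/
lemma exists_enorm_integral_update_sub_le (m : ℕ) (hm : 1 ≤ m) : ∃ C : ℝ, 0 < C ∧
    ∀ (N d : ℕ) [NeZero d] (q : Fin d → ℕ) (f : (k : Fin d) → (Fin (q k) → Fin N) → ℝ)
      (κ : Fin N → Measure ℝ) (η₁ η₂ : Measure ℝ) (A s : ℝ), 0 ≤ A → 1 / 2 ≤ s →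
      (∀ i, IsCenteredGrowth (κ i) A s) → IsCenteredGrowth η₁ A s → IsCenteredGrowth η₂ A s →
      (∀ r < m, ∫ x, x ^ r ∂η₁ = ∫ x, x ^ r ∂η₂) → (∀ k, VanishesOnDiagonals (f k)) →
      ∀ (h : ℝ → ℝ) (β : ℝ), IsCmb m h → 0 < β → ∀ (i : Fin N) (y : Fin d → ℝ),
      ‖∫ x, h (smoothMax β (homVec f y x)) ∂(Measure.pi (Function.update κ i η₁)) -
        ∫ x, h (smoothMax β (homVec f y x)) ∂(Measure.pi (Function.update κ i η₂))‖ₑ ≤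
      ENNReal.ofReal (C * derivBound m β h) *
        (∫⁻ x, ∫⁻ t, stepErr β m (restVec f y i x) (derivVec f i x) t ∂η₁ ∂(Measure.pi κ) +
         ∫⁻ x, ∫⁻ t, stepErr β m (restVec f y i x) (derivVec f i x) t ∂η₂ ∂(Measure.pi κ)) := by
  obtain ⟨C, hC, hT⟩ := exists_taylor_smoothMax m hm
  refine ⟨C, hC, ?_⟩
  intro N d _ q f κ η₁ η₂ A s hA hs hκ h₁ h₂ hmom hf h β hh hβ i y
  have hκp := fun i ↦ (hκ i).prob
  have := h₁.prob
  have := h₂.prob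
  set P := Measure.pi κ with hP
  set G : (Fin N → ℝ) → ℝ := fun x ↦ h (smoothMax β (homVec f y x)) with hG
  have hD := derivBound_nonneg m hβ h
  have hGm : Measurable G := hh.1.continuous.measurable.comp
    ((continuous_smoothMax β).measurable.comp (measurable_homVec f y))
  have hint : ∀ η, IsCenteredGrowth η A s →
      Integrable (fun z : (Fin N → ℝ) × ℝ ↦ G (Function.update z.1 i z.2)) (P.prod η) ∧
      ∫ x, G x ∂(Measure.pi (Function.update κ i η)) =
        ∫ x, ∫ t, G (Function.update x i t) ∂η ∂P := by
    intro η hη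
    have := hη.prob
    have hup : ∀ j, IsCenteredGrowth (Function.update κ i η j) A s := by
      intro j
      rcases eq_or_ne j i with rfl | hj
      · simpa
      · simpa [hj] using hκ j
    have hI := integrable_comp_homVec (Function.update κ i η) hA hs hup hf hm hh hβ y
    rw [← map_update_prod κ i η] at hI ⊢
    have hI2 : Integrable (fun z : (Fin N → ℝ) × ℝ ↦ G (Function.update z.1 i z.2)) (P.prod η) :=
      hI.comp_measurable (measurable_update_prod i)
    refine ⟨hI2, ?_⟩
    rw [integral_map (measurable_update_prod i).aemeasurable hGm.aestronglyMeasurable,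
      integral_prod _ hI2]
  obtain ⟨hI₁, e₁⟩ := hint η₁ h₁
  obtain ⟨hI₂, e₂⟩ := hint η₂ h₂
  rw [e₁, e₂, ← integral_sub hI₁.integral_prod_left hI₂.integral_prod_left]
  refine (enorm_integral_le_lintegral_enorm _).trans ?_
  have hpt : ∀ x, ‖∫ t, G (Function.update x i t) ∂η₁ - ∫ t, G (Function.update x i t) ∂η₂‖ₑ ≤
      ENNReal.ofReal (C * derivBound m β h) *
        (∫⁻ t, stepErr β m (restVec f y i x) (derivVec f i x) t ∂η₁ +
          ∫⁻ t, stepErr β m (restVec f y i x) (derivVec f i x) t ∂η₂) := by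
    intro x
    obtain ⟨c, hc⟩ := hT d h β hh hβ (restVec f y i x) (derivVec f i x)
    have hGx : ∀ t, G (Function.update x i t) =
        h (smoothMax β fun k ↦ restVec f y i x k + t * derivVec f i x k) := by
      intro t
      simp only [hG, homVec_update hf]
    -- The softmax remainder is used when |t|‖V_i‖ ≤ 1/β, and the sup-norm remainder otherwise. The
    -- two summands of `stepErr` correspond to these cases.
    have hR : ∀ t, ‖G (Function.update x i t) - ∑ r ∈ Finset.range m, c r * t ^ r‖ₑ ≤
        ENNReal.ofReal (C * derivBound m β h) *
          stepErr β m (restVec f y i x) (derivVec f i x) t := by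
      intro t
      obtain ⟨hc1, hc2⟩ := hc t
      rw [Real.enorm_eq_ofReal_abs, hGx, stepErr, Real.enorm_eq_ofReal_abs t,
        ← ENNReal.ofReal_pow (abs_nonneg t)]
      by_cases hlt : β⁻¹ < |t| * ‖derivVec f i x‖
      · rw [if_pos hlt, ← ofReal_norm, ← ENNReal.ofReal_pow (norm_nonneg _)]
        refine (ENNReal.ofReal_le_ofReal hc2).trans ?_
        rw [ENNReal.ofReal_mul (mul_nonneg hC.le hD),
          ENNReal.ofReal_mul (p := |t| ^ m) (by positivity)]
        exact mul_le_mul_right (mul_le_mul_right le_add_self _) _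
      · rw [if_neg hlt, add_zero]
        refine (ENNReal.ofReal_le_ofReal (hc1 (not_lt.1 hlt))).trans ?_
        rw [ENNReal.ofReal_mul (mul_nonneg hC.le hD),
          ENNReal.ofReal_mul (p := |t| ^ m) (by positivity)]
    have hgm : Measurable fun t ↦ G (Function.update x i t) :=
      hGm.comp ((measurable_update_prod i).comp measurable_prodMk_left)
    have hK : ∀ t, |G (Function.update x i t) - ∑ r ∈ Finset.range m, c r * t ^ r| ≤
        (C * derivBound m β h * ‖derivVec f i x‖ ^ m) * |t| ^ m := by
      intro t
      rw [hGx]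
      exact (hc t).2.trans_eq (by ring)
    refine (enorm_integral_sub_integral_le h₁.growth h₂.growth hmom hgm hK).trans ?_
    rw [mul_add, ← lintegral_const_mul' _ _ ENNReal.ofReal_ne_top,
      ← lintegral_const_mul' _ _ ENNReal.ofReal_ne_top]
    exact add_le_add (lintegral_mono hR) (lintegral_mono hR)
  refine (lintegral_mono hpt).trans_eq ?_
  rw [lintegral_const_mul' _ _ ENNReal.ofReal_ne_top, lintegral_add_left]
  exact (measurable_stepErr f y i β m).lintegral_prod_right'

/-- The product law with the coordinates in `B` taken from `ν` and the others from `μ`. -/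
def mixLaw (μ ν : Fin N → Measure ℝ) (B : Finset (Fin N)) (i : Fin N) : Measure ℝ :=
  if i ∈ B then ν i else μ i

lemma mixLaw_insert (μ ν : Fin N → Measure ℝ) (B : Finset (Fin N)) (i : Fin N) :
    mixLaw μ ν (insert i B) = Function.update (mixLaw μ ν B) i (ν i) := by
  ext1 j
  rcases eq_or_ne j i with rfl | hj
  · simp [mixLaw]
  · simp [mixLaw, hj]

lemma mixLaw_erase (μ ν : Fin N → Measure ℝ) (B : Finset (Fin N)) (i : Fin N) :
    mixLaw μ ν (B.erase i) = Function.update (mixLaw μ ν B) i (μ i) := by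
  ext1 j
  rcases eq_or_ne j i with rfl | hj
  · simp [mixLaw]
  · simp [mixLaw, hj]

end Laws

/-- The comparison of product laws with matching moments. -/
lemma exists_abs_integral_pi_sub_le {α : ℝ} (hα : 0 < α) (hα2 : α ≤ 2) {L : ℝ} (hL : 1 ≤ L) :
    ∃ K₁ : ℝ, 0 < K₁ ∧ ∀ r : ℕ, 1 ≤ r → ∃ K₂ : ℝ, 0 < K₂ ∧ ∃ K₃ : ℝ, 0 < K₃ ∧
    ∀ m : ℕ, 1 ≤ m → ∃ C : ℝ, 0 < C ∧
    ∀ (N d : ℕ) [NeZero d] (q : Fin d → ℕ) (f : (k : Fin d) → (Fin (q k) → Fin N) → ℝ)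
      (μ ν : Fin N → Measure ℝ) (M : ℝ), 0 ≤ M →
      (∀ i, IsCenteredGrowth (μ i) (L * M) (1 / α)) → (∀ i, IsCenteredGrowth (ν i) (L * M) (1 / α)) →
      (∀ i, ∀ l < m, ∫ x, x ^ l ∂(μ i) = ∫ x, x ^ l ∂(ν i)) →
      (∀ k, IsSymm (f k)) → (∀ k, VanishesOnDiagonals (f k)) → (∀ k, 1 ≤ q k) →
      (∀ k, q k ≤ r) → (2 ≤ d ∨ (d = 1 ∧ r = 1)) →
      ∀ (h : ℝ → ℝ) (β τ ρ : ℝ), IsCmb m h → 0 < β → 0 ≤ τ → 0 ≤ ρ →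
      (∀ i, τ * ρ * M * Lam α r M f i ≤ β⁻¹) → ∀ y : Fin d → ℝ,
      |∫ x, h (smoothMax β (homVec f y x)) ∂(Measure.pi ν) -
        ∫ x, h (smoothMax β (homVec f y x)) ∂(Measure.pi μ)| ≤
        C * derivBound m β h * (Real.log d ^ ((m : ℝ) * ((r : ℝ) - 1) / α) *
          (⨆ k : Fin d, M ^ (m * q k) * ∑ i : Fin N, influence (f k) i ^ ((m : ℝ) / 2)) +
          (Real.exp (-(τ / K₁) ^ α) + chi (((r : ℝ) - 1) / α) (ρ / K₂) +
            Real.exp (-(τ * ρ / K₃) ^ (α / (r : ℝ)))) * (M ^ m * ∑ i, Lam α r M f i ^ m)) := by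
  obtain ⟨K₁, hK₁, hstep⟩ := exists_lintegral_stepErr_le hα hα2 hL
  refine ⟨K₁, hK₁, fun r hr ↦ ?_⟩
  obtain ⟨K₂, hK₂, K₃, hK₃, hstep⟩ := hstep r hr
  refine ⟨K₂, hK₂, K₃, hK₃, fun m hm ↦ ?_⟩
  obtain ⟨C₁, hC₁, hstep⟩ := hstep m hm
  obtain ⟨C₂, hC₂, hupd⟩ := exists_enorm_integral_update_sub_le m hm
  have hm0 : (0 : ℝ) < m := by exact_mod_cast hm
  have hs : 1 / 2 ≤ 1 / α := one_div_le_one_div_of_le hα hα2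
  have hdc := derivConst_pos (s := 1 / α) (by linarith : 0 < L) hr
  set C₃ : ℝ := Real.exp 1 * 3 ^ ((m : ℝ) * (((r : ℝ) - 1) / α)) *
        (((m : ℝ) ^ (((r : ℝ) - 1) / α)) ^ m * derivConst L (1 / α) r ^ m) with hC₃
  have hC₃0 : 0 < C₃ := by positivity
  refine ⟨C₂ * (2 * C₁) * (C₃ + 1), by positivity, ?_⟩
  intro N d _ q f μ ν M hM hμ hν hmom hsy hf hq hqr hd h β τ ρ hh hβ hτ hρ hcond y
  set D := derivBound m β h with hD
  have hD0 : 0 ≤ D := derivBound_nonneg m hβ h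
  set S := Real.log d ^ ((m : ℝ) * ((r : ℝ) - 1) / α) *
    (⨆ k : Fin d, M ^ (m * q k) * ∑ i : Fin N, influence (f k) i ^ ((m : ℝ) / 2)) with hS
  have hS0 : 0 ≤ S := mul_nonneg (Real.rpow_nonneg (Real.log_natCast_nonneg d) _)
    (Real.iSup_nonneg fun k ↦ mul_nonneg (by positivity)
      (Finset.sum_nonneg fun i _ ↦ Real.rpow_nonneg (influence_nonneg (f k) i) _))
  set χ := Real.exp (-(τ / K₁) ^ α) + chi (((r : ℝ) - 1) / α) (ρ / K₂) +
            Real.exp (-(τ * ρ / K₃) ^ (α / (r : ℝ))) with hχ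
  have hχ0 : 0 ≤ χ := add_nonneg (add_nonneg (Real.exp_pos _).le (chi_nonneg _ _))
    (Real.exp_pos _).le
  have hΛ0 : ∀ i, 0 ≤ Lam α r M f i := fun i ↦ Lam_nonneg α r hM f i
  have hΛs : 0 ≤ ∑ i, Lam α r M f i ^ m := Finset.sum_nonneg fun i _ ↦ pow_nonneg (hΛ0 i) m
  set φ : Finset (Fin N) → ℝ := fun B ↦
    ∫ x, h (smoothMax β (homVec f y x)) ∂(Measure.pi (mixLaw μ ν B)) with hφ
  have e1 : mixLaw μ ν Finset.univ = ν := by ext1 i; simp [mixLaw]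
  have e0 : mixLaw μ ν ∅ = μ := by ext1 i; simp [mixLaw]
  have hgoal : |φ Finset.univ - φ ∅| ≤ C₂ * (2 * C₁) * (C₃ + 1) * D *
      (S + χ * (M ^ m * ∑ i, Lam α r M f i ^ m)) := by
    -- From here B is fixed. Inserting or erasing i only updates one coordinate of the same law `κ`,
    -- so all N errors refer to one product measure.
    refine abs_sub_le_of_forall_sum_abs_le φ fun B ↦ ?_
    set κ := mixLaw μ ν B with hκdef
    have hκ : ∀ i, IsCenteredGrowth (κ i) (L * M) (1 / α) := by
      intro i
      simp only [hκdef, mixLaw]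
      split_ifs
      · exact hν i
      · exact hμ i
    have hκp := fun i ↦ (hκ i).prob
    set X : Fin N → ℝ≥0∞ := fun i ↦
      ∫⁻ x, ENNReal.ofReal (softAbs (fun k ↦ β * homVec f y x k) (derivVec f i x) m)
        ∂(Measure.pi κ) with hX
    have hone : ∀ i, ENNReal.ofReal |φ (insert i B) - φ (B.erase i)| ≤
        ENNReal.ofReal (C₂ * D) * (2 * (ENNReal.ofReal C₁ * (ENNReal.ofReal (M ^ m) * X i +
          ENNReal.ofReal (χ * (M ^ m * Lam α r M f i ^ m))))) := by
      intro i
      have := (hμ i).prob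
      have := (hν i).prob
      rw [← Real.enorm_eq_ofReal_abs]
      simp only [hφ, mixLaw_insert, mixLaw_erase]
      refine (hupd N d q f κ (ν i) (μ i) (L * M) (1 / α) (by positivity) hs hκ (hν i) (hμ i)
        (fun l hl ↦ (hmom i l hl).symm) hf h β hh hβ i y).trans ?_
      gcongr
      rw [two_mul]
      exact add_le_add
        (hstep N d q f κ (ν i) M hM (fun i ↦ (hκ i).growth) (fun i ↦ (hκ i).centered)
          (hν i).growth hsy hf hq hqr hd β τ ρ hβ hτ hρ i y (hcond i))
        (hstep N d q f κ (μ i) M hM (fun i ↦ (hκ i).growth) (fun i ↦ (hκ i).centered)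
          (hμ i).growth hsy hf hq hqr hd β τ ρ hβ hτ hρ i y (hcond i))
    -- The sum over i goes under the single integral, where the weights at `homVec f y x` are common
    -- to all i.
    have hXsum : ENNReal.ofReal (M ^ m) * ∑ i, X i ≤ ENNReal.ofReal (C₃ * S) := by
      have hmeas : ∀ i, Measurable fun x ↦
          ENNReal.ofReal (softAbs (fun k ↦ β * homVec f y x k) (derivVec f i x) m) := by
        intro i
        refine (measurable_softAbs ?_ (measurable_derivVec f i) m).ennreal_ofReal
        exact measurable_pi_iff.2 fun k ↦
          ((measurable_pi_apply k).comp (measurable_homVec f y)).const_mul β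
      rw [hX, ← lintegral_finsetSum _ fun i _ ↦ hmeas i]
      refine le_trans ?_ (lintegral_iSup_sum_le κ hα hα2 hL hM (fun i ↦ (hκ i).growth)
        (fun i ↦ (hκ i).centered) hsy hf hq hqr hd hm)
      gcongr with x
      exact sum_ofReal_softAbs_le Finset.univ _ (fun i ↦ derivVec f i x) m
    have hΛsum : ∑ i, ENNReal.ofReal (χ * (M ^ m * Lam α r M f i ^ m)) =
        ENNReal.ofReal (χ * (M ^ m * ∑ i, Lam α r M f i ^ m)) := by
      rw [← ENNReal.ofReal_sum_of_nonneg fun i _ ↦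
        mul_nonneg hχ0 (mul_nonneg (by positivity) (pow_nonneg (hΛ0 i) m)), Finset.mul_sum,
        Finset.mul_sum]
    rw [← ENNReal.ofReal_le_ofReal_iff (by positivity),
      ENNReal.ofReal_sum_of_nonneg fun i _ ↦ abs_nonneg _]
    calc ∑ i, ENNReal.ofReal |φ (insert i B) - φ (B.erase i)|
        ≤ ∑ i, ENNReal.ofReal (C₂ * D) * (2 * (ENNReal.ofReal C₁ * (ENNReal.ofReal (M ^ m) * X i +
          ENNReal.ofReal (χ * (M ^ m * Lam α r M f i ^ m))))) := Finset.sum_le_sum fun i _ ↦ hone i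
      _ = ENNReal.ofReal (C₂ * D) * (2 * (ENNReal.ofReal C₁ * (ENNReal.ofReal (M ^ m) * ∑ i, X i +
          ENNReal.ofReal (χ * (M ^ m * ∑ i, Lam α r M f i ^ m))))) := by
          rw [← Finset.mul_sum, ← Finset.mul_sum, ← Finset.mul_sum, Finset.sum_add_distrib,
            ← Finset.mul_sum, hΛsum]
      _ ≤ ENNReal.ofReal (C₂ * D) * (ENNReal.ofReal 2 * (ENNReal.ofReal C₁ *
          (ENNReal.ofReal (C₃ * S) +
          ENNReal.ofReal (χ * (M ^ m * ∑ i, Lam α r M f i ^ m))))) := by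
          rw [ENNReal.ofReal_ofNat]
          gcongr
      _ = ENNReal.ofReal (C₂ * D * (2 * (C₁ *
          (C₃ * S + χ * (M ^ m * ∑ i, Lam α r M f i ^ m))))) := by
          rw [← ENNReal.ofReal_add (by positivity) (by positivity),
            ← ENNReal.ofReal_mul (by positivity), ← ENNReal.ofReal_mul (by positivity),
            ← ENNReal.ofReal_mul (by positivity)]
      _ ≤ _ := by
          refine ENNReal.ofReal_le_ofReal ?_
          have hR : 0 ≤ χ * (M ^ m * ∑ i, Lam α r M f i ^ m) := by positivity
          calc C₂ * D * (2 * (C₁ * (C₃ * S + χ * (M ^ m * ∑ i, Lam α r M f i ^ m))))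
              ≤ C₂ * D * (2 * (C₁ * ((C₃ + 1) * S +
                (C₃ + 1) * (χ * (M ^ m * ∑ i, Lam α r M f i ^ m))))) := by
                refine mul_le_mul_of_nonneg_left (mul_le_mul_of_nonneg_left
                  (mul_le_mul_of_nonneg_left (add_le_add ?_ ?_) hC₁.le) zero_le_two)
                  (mul_nonneg hC₂.le hD0)
                · exact mul_le_mul_of_nonneg_right (by linarith) hS0
                · exact le_mul_of_one_le_left hR (by linarith)
            _ = _ := by ring
  simpa only [hφ, e1, e0] using hgoal

/-! ### From ψ_α-norms of random variables to growth of their laws -/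

lemma MomGrowth.of_forall_lt {Ω : Type*} [MeasurableSpace Ω] {μ : Measure Ω} {f : Ω → ℝ≥0∞}
    {L M s : ℝ} (h : ∀ M', M < M' → MomGrowth μ f (L * M') s) : MomGrowth μ f (L * M) s := by
  intro p hp
  have hc : Continuous fun M' : ℝ ↦ ENNReal.ofReal (L * M' * (p : ℝ) ^ s) ^ p :=
    (ENNReal.continuous_pow p).comp (ENNReal.continuous_ofReal.comp (by fun_prop))
  have ht : Filter.Tendsto (fun M' : ℝ ↦ ENNReal.ofReal (L * M' * (p : ℝ) ^ s) ^ p)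
      (nhdsWithin M (Set.Ioi M)) (nhds (ENNReal.ofReal (L * M * (p : ℝ) ^ s) ^ p)) :=
    (hc.tendsto M).mono_left nhdsWithin_le_nhds
  exact ge_of_tendsto ht
    (eventually_nhdsWithin_of_forall fun M' hM' ↦ h M' hM' p hp)

lemma momGrowth_of_psiNorm_le {Ω : Type*} [MeasurableSpace Ω] {P : Measure Ω}
    [IsProbabilityMeasure P] {X : Ω → ℝ} (hX : Measurable X) {α M : ℝ} (hα : 0 < α) (hM : 0 ≤ M)
    (h : psiNorm α X P ≤ ENNReal.ofReal M) :
    MomGrowth P (fun ω ↦ ‖X ω‖ₑ) (2 * (1 / α) ^ (1 / α) * M) (1 / α) := by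
  -- The infimum defining the norm need not be known to be attained, so the bound is proved for
  -- every M' > M and the limit M' → M is taken.
  refine MomGrowth.of_forall_lt fun M' hM' ↦ ?_
  have hlt : psiNorm α X P < ENNReal.ofReal M' :=
    h.trans_lt ((ENNReal.ofReal_lt_ofReal_iff_of_nonneg hM).2 hM')
  obtain ⟨c, ⟨C, hC, rfl, hint⟩, hcM⟩ := sInf_lt_iff.1 hlt
  refine (momGrowth_of_lintegral_exp_le hX hα hC hint).mono (by positivity) ?_ le_rfl
  have := (ENNReal.ofReal_lt_ofReal_iff_of_nonneg hC.le).1 hcM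
  gcongr

lemma isCenteredGrowth_map {Ω : Type*} [MeasurableSpace Ω] {P : Measure Ω}
    [IsProbabilityMeasure P] {X : Ω → ℝ} (hX : Measurable X) (h0 : ∫ ω, X ω ∂P = 0) {A s : ℝ}
    (h : MomGrowth P (fun ω ↦ ‖X ω‖ₑ) A s) : IsCenteredGrowth (P.map X) A s where
  prob := Measure.isProbabilityMeasure_map hX.aemeasurable
  centered := by rw [integral_map hX.aemeasurable (by fun_prop)]; exact h0
  growth p hp := by
    rw [lintegral_map (measurable_enorm.pow_const p) hX]
    exact h p hp

lemma integrable_and_integral_eq_pi {Ω : Type*} [MeasurableSpace Ω] {P : Measure Ω}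
    [IsProbabilityMeasure P] {N : ℕ} {X : Fin N → Ω → ℝ} (hX : IsIndepStd X P)
    {G : (Fin N → ℝ) → ℝ} (hG : Integrable G (Measure.pi fun i ↦ P.map (X i))) :
    Integrable (fun ω ↦ G fun i ↦ X i ω) P ∧
      ∫ ω, G (fun i ↦ X i ω) ∂P = ∫ x, G x ∂(Measure.pi fun i ↦ P.map (X i)) := by
  have hm : Measurable fun ω ↦ fun i ↦ X i ω := measurable_pi_iff.2 hX.measurable
  rw [← (iIndepFun_iff_map_fun_eq_pi_map fun i ↦ (hX.measurable i).aemeasurable).1 hX.indep]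
    at hG ⊢
  exact ⟨hG.comp_measurable hm, (integral_map hm.aemeasurable hG.aestronglyMeasurable).symm⟩

end HomSum

end

theorem mainTheorem6 (α : ℝ) (hα : 0 < α) (hα2 : α ≤ 2) :
    ∃ K₁ : ℝ, 0 < K₁ ∧ ∀ qbar : ℕ,
    ∃ K₂ : ℝ, 0 < K₂ ∧ ∃ K₃ : ℝ, 0 < K₃ ∧ ∀ m : ℕ, 3 ≤ m →
    ∃ C : ℝ, 0 < C ∧
    ∀ {Ω : Type*} [MeasurableSpace Ω] (P : Measure Ω) [IsProbabilityMeasure P]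
      {Ω' : Type*} [MeasurableSpace Ω'] (P' : Measure Ω') [IsProbabilityMeasure P']
      (N d : ℕ) (q : Fin d → ℕ) (f : (k : Fin d) → (Fin (q k) → Fin N) → ℝ)
      (X : Fin N → Ω → ℝ) (Y : Fin N → Ω' → ℝ) (M : ℝ),
      (∀ k, 1 ≤ q k) → Finset.univ.sup q = qbar →
      (2 ≤ d ∨ (d = 1 ∧ qbar = 1)) →
      (∀ k, HomSum.IsSymm (f k)) → (∀ k, HomSum.VanishesOnDiagonals (f k)) →
      HomSum.IsIndepStd X P → HomSum.IsIndepStd Y P' →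
      0 ≤ M →
      (⨆ i : Fin N, max (HomSum.psiNorm α (X i) P) (HomSum.psiNorm α (Y i) P')) =
        ENNReal.ofReal M →
      (∀ i : Fin N, ∀ r ∈ Finset.Icc 1 (m - 1), ∫ ω, X i ω ^ r ∂P = ∫ ω, Y i ω ^ r ∂P') →
      ∀ (h : ℝ → ℝ) (β τ ρ : ℝ), HomSum.IsCmb m h → 0 < β → 0 ≤ τ → 0 ≤ ρ →
      τ * ρ * M * (⨆ i : Fin N, HomSum.Lam α qbar M f i) ≤ β⁻¹ →
      ∀ y : Fin d → ℝ,
        Integrable (fun ω ↦ h (HomSum.smoothMax β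
          (fun k ↦ HomSum.homSum (f k) (fun i ↦ X i ω) - y k))) P ∧
        Integrable (fun ω ↦ h (HomSum.smoothMax β
          (fun k ↦ HomSum.homSum (f k) (fun i ↦ Y i ω) - y k))) P' ∧
        |∫ ω, h (HomSum.smoothMax β (fun k ↦ HomSum.homSum (f k) (fun i ↦ X i ω) - y k)) ∂P -
          ∫ ω, h (HomSum.smoothMax β (fun k ↦ HomSum.homSum (f k) (fun i ↦ Y i ω) - y k)) ∂P'| ≤
          C * HomSum.derivBound m β h *
            (Real.log d ^ ((m : ℝ) * ((qbar : ℝ) - 1) / α) *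
                (⨆ k : Fin d, M ^ (m * q k) *
                  ∑ i : Fin N, HomSum.influence (f k) i ^ ((m : ℝ) / 2)) +
              (Real.exp (-(τ / K₁) ^ α) +
                HomSum.chi (((qbar : ℝ) - 1) / α) (ρ / K₂) * max ρ 1 ^ m +
                Real.exp (-(τ * ρ / K₃) ^ (α / (qbar : ℝ))) * max (τ * ρ) 1 ^ m) *
                (M ^ m * ∑ i : Fin N, HomSum.Lam α qbar M f i ^ m)) := by
  -- The maximum with 1 makes the powers of L monotone in the degree, as needed to pass from each `q
  -- k` to `qbar`.
  have hL : (1 : ℝ) ≤ max 1 (2 * (1 / α) ^ (1 / α)) := le_max_left _ _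
  obtain ⟨K₁, hK₁, hmain⟩ := HomSum.exists_abs_integral_pi_sub_le hα hα2 hL
  refine ⟨K₁, hK₁, fun qbar ↦ ?_⟩
  -- The constants must exist for every `qbar`. The value 0 is incompatible with d ≥ 1 and `1 ≤ q
  -- k`, so any constants will do.
  rcases Nat.eq_zero_or_pos qbar with rfl | hqbar
  · refine ⟨1, one_pos, 1, one_pos, fun m _ ↦ ⟨1, one_pos, ?_⟩⟩
    intro Ω _ P _ Ω' _ P' _ N d q f X Y M hq hsup hd
    have hd0 : 0 < d := by omega
    have h1 := Finset.le_sup (f := q) (Finset.mem_univ ⟨0, hd0⟩)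
    have h2 := hq ⟨0, hd0⟩
    omega
  obtain ⟨K₂, hK₂, K₃, hK₃, hmain⟩ := hmain qbar hqbar
  refine ⟨K₂, hK₂, K₃, hK₃, fun m hm ↦ ?_⟩
  obtain ⟨C, hC, hmain⟩ := hmain m (by omega)
  refine ⟨C, hC, ?_⟩
  intro Ω _ P _ Ω' _ P' _ N d q f X Y M hq hsup hd hsy hf hX hY hM hpsi hmom h β τ ρ hh hβ hτ hρ
    hcond y
  have : NeZero d := ⟨by omega⟩
  have hs : 1 / 2 ≤ 1 / α := one_div_le_one_div_of_le hα hα2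
  have hle : ∀ i, HomSum.psiNorm α (X i) P ≤ ENNReal.ofReal M ∧
      HomSum.psiNorm α (Y i) P' ≤ ENNReal.ofReal M := by
    intro i
    rw [← hpsi]
    have := le_iSup (fun i ↦ max (HomSum.psiNorm α (X i) P) (HomSum.psiNorm α (Y i) P')) i
    exact ⟨(le_max_left _ _).trans this, (le_max_right _ _).trans this⟩
  have hLM : 2 * (1 / α) ^ (1 / α) * M ≤ max 1 (2 * (1 / α) ^ (1 / α)) * M :=
    mul_le_mul_of_nonneg_right (le_max_right _ _) hM
  have hμ : ∀ i, HomSum.IsCenteredGrowth (P.map (X i)) (max 1 (2 * (1 / α) ^ (1 / α)) * M)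
      (1 / α) := fun i ↦ HomSum.isCenteredGrowth_map (hX.measurable i) (hX.centered i).2
    ((HomSum.momGrowth_of_psiNorm_le (hX.measurable i) hα hM (hle i).1).mono (by positivity)
      hLM le_rfl)
  have hν : ∀ i, HomSum.IsCenteredGrowth (P'.map (Y i)) (max 1 (2 * (1 / α) ^ (1 / α)) * M)
      (1 / α) := fun i ↦ HomSum.isCenteredGrowth_map (hY.measurable i) (hY.centered i).2
    ((HomSum.momGrowth_of_psiNorm_le (hY.measurable i) hα hM (hle i).2).mono (by positivity)
      hLM le_rfl)
  have hA : 0 ≤ max 1 (2 * (1 / α) ^ (1 / α)) * M := by positivity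
  obtain ⟨hIX, eX⟩ := HomSum.integrable_and_integral_eq_pi hX
    (HomSum.integrable_comp_homVec _ hA hs hμ hf (by omega) hh hβ y)
  obtain ⟨hIY, eY⟩ := HomSum.integrable_and_integral_eq_pi hY
    (HomSum.integrable_comp_homVec _ hA hs hν hf (by omega) hh hβ y)
  refine ⟨hIX, hIY, ?_⟩
  have hmom' : ∀ i, ∀ l < m, ∫ x, x ^ l ∂(P.map (X i)) = ∫ x, x ^ l ∂(P'.map (Y i)) := by
    intro i l hl
    rw [integral_map (hX.measurable i).aemeasurable (by fun_prop),
      integral_map (hY.measurable i).aemeasurable (by fun_prop)]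
    -- The zeroth moments agree because both laws are probabilities; the hypothesis starts at order
    -- 1.
    rcases Nat.eq_zero_or_pos l with rfl | hl0
    · simp
    · exact hmom i l (Finset.mem_Icc.2 ⟨hl0, by omega⟩)
  have hqr : ∀ k, q k ≤ qbar := fun k ↦ hsup ▸ Finset.le_sup (f := q) (Finset.mem_univ k)
  have hcond' : ∀ i, τ * ρ * M * HomSum.Lam α qbar M f i ≤ β⁻¹ := by
    intro i
    refine le_trans ?_ hcond
    exact mul_le_mul_of_nonneg_left (le_ciSup (f := fun i ↦ HomSum.Lam α qbar M f i)
      (Set.finite_range _).bddAbove i) (by positivity)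
  have hb := hmain N d q f _ _ M hM hμ hν hmom' hsy hf hq hqr hd h β τ ρ hh hβ hτ hρ hcond' y
  rw [← eX, ← eY, abs_sub_comm] at hb
  refine hb.trans ?_
  have hD := HomSum.derivBound_nonneg m hβ h
  have hΛs : 0 ≤ ∑ i : Fin N, HomSum.Lam α qbar M f i ^ m :=
    Finset.sum_nonneg fun i _ ↦ pow_nonneg (HomSum.Lam_nonneg α qbar hM f i) m
  -- The bound already holds without the factors (ρ ∨ 1)^m and (τρ ∨ 1)^m; both are at least 1.
  gcongr
  · exact le_mul_of_one_le_right (HomSum.chi_nonneg _ _) (one_le_pow₀ (le_max_right _ _))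
  · exact le_mul_of_one_le_right (Real.exp_pos _).le (one_le_pow₀ (le_max_right _ _))
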